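/- Let $N\ge 0$ and let $z=(z_1,\dots,z_{N+3})$ be distinct points of $\mathbb C$. A \emph{triangulation} $T$ of these points is a set $\mathcal F(T)$ of nondegenerate triangles (faces) whose vertices are among the points, such that two faces always meet exactly in the convex hull of their common vertices, the faces cover the convex hull of $\{z_1,\dots,z_{N+3}\}$, and each $z_v$ is a vertex of some face; all faces are given the positive (counterclockwise) orientation. It is a \emph{Delaunay triangulation} if no point $z_v$ lies in the open disc bounded by the circumcircle of a face. For a triangle $f$ in $\mathbb C$ let $\mathbf V(f)>0$ be the hyperbolic volume of the ideal tetrahedron in the upper half-space $\mathbb H^3=\{(w,h):w\in\mathbb C,\ h>0\}$ with metric $(dw\,d\bar w+dh^2)/h^2$ whose ideal vertices are $\infty$ and the three vertices of $f$. For a triangulation $T$ put $\mathcal A_T=-\sum_{f\in\mathcal F(T)}\mathbf V(f)$, regarded (with the combinatorics of $T$ fixed) as a function of the positions of the vertices, and let $$D_{u\bar v}(T)=\frac{\partial}{\partial z_u}\frac{\partial}{\partial\bar z_v}\mathcal A_T,\qquad 1\le u,v\le N+3,$$ evaluated at $z$. For distinct $i,j,k\in\{1,\dots,N+3\}$ let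 $$d_{(ijk)}(T)=\det\big[D_{u\bar v}(T)\big]_{u,v\notin\{i,j,k\}}.$$ Then for every Delaunay triangulation $T^D$ of the points and all distinct $i,j,k$, $$d_{(ijk)}(T^D)=\max_{T}\,d_{(ijk)}(T),$$ where $T$ ranges over all triangulations of $\{z_1,\dots,z_{N+3}\}$ (in particular these complex numbers are compared through real, nonnegative differences). -/

import Mathlib

open MeasureTheory

noncomputable section

/-- A triangulation of the finite planar point configuration `z : ι → ℂ`, recorded by its set of
bounded faces. Each face is a set of three (indices of) points forming a nondegenerate triangle,
two faces meet exactly in the convex hull of their common vertices, the faces fill the convex hull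
of the configuration, and every point is a vertex. (These conditions force `z` to be injective and
forbid a point in a face of which it is not a vertex.) -/
structure PointTriangulation {ι : Type*} (z : ι → ℂ) where
  faces : Finset (Finset ι)
  card_face : ∀ f ∈ faces, f.card = 3
  affineIndependent_face : ∀ f ∈ faces, AffineIndependent ℝ (fun v : f => z v)
  inter_face : ∀ f ∈ faces, ∀ g ∈ faces,
    convexHull ℝ (z '' (f : Set ι)) ∩ convexHull ℝ (z '' (g : Set ι)) =
      convexHull ℝ (z '' ((f : Set ι) ∩ (g : Set ι)))
  iUnion_face : ⋃ f ∈ faces, convexHull ℝ (z '' (f : Set ι)) = convexHull ℝ (Set.range z)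
  exists_face : ∀ v, ∃ f ∈ faces, v ∈ f

/-- A triangulation is Delaunay when the open disc bounded by the circumcircle of any face contains
no point of the configuration. -/
def PointTriangulation.IsDelaunay {ι : Type*} {z : ι → ℂ} (T : PointTriangulation z) : Prop :=
  ∀ f ∈ T.faces, ∀ (c : ℂ) (R : ℝ), (∀ v ∈ f, dist (z v) c = R) → ∀ w, R ≤ dist (z w) c

/-- The volume measure of the upper half-space `{(w, h) : w ∈ ℂ, h > 0}` for the Poincaré metric
`(dw dw̄ + dh²) / h²`, that is `dx dy dh / h³`. -/
def hyperbolicVolume : Measure (ℂ × ℝ) :=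
  (volume.restrict {p : ℂ × ℝ | 0 < p.2}).withDensity
    (fun p => ENNReal.ofReal (1 / p.2 ^ 3))

/-- The ideal tetrahedron in the upper half-space with ideal vertices `∞` and the three points of
`s ⊆ ℂ`: the part of the vertical prism over the Euclidean triangle spanned by `s` that lies on or
above the hemisphere centred on `ℂ` through the points of `s`. -/
def idealTetrahedron (s : Set ℂ) : Set (ℂ × ℝ) :=
  {p | p.1 ∈ convexHull ℝ s ∧ 0 < p.2 ∧
    ∀ (c : ℂ) (R : ℝ), (∀ a ∈ s, dist a c = R) → R ^ 2 ≤ dist p.1 c ^ 2 + p.2 ^ 2}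

/-- The hyperbolic volume of the ideal tetrahedron with vertices `∞` and the points of `s`. -/
def idealVolume (s : Set ℂ) : ℝ :=
  hyperbolicVolume.real (idealTetrahedron s)

/-- The prepotential: minus the sum over the faces of the volumes of the ideal tetrahedra above
them, as a function of the positions `x` of the vertices (the set of faces being kept fixed). -/
def prepotential {ι : Type*} (F : Finset (Finset ι)) (x : ι → ℂ) : ℝ :=
  - ∑ f ∈ F, idealVolume (x '' (f : Set ι))

/-- The Wirtinger derivative `∂g/∂z_u = (∂g/∂x_u - i ∂g/∂y_u) / 2`, where `z_u = x_u + i y_u`. -/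
def wirtinger {ι : Type*} [DecidableEq ι] (u : ι) (g : (ι → ℂ) → ℂ) (x : ι → ℂ) : ℂ :=
  (1 / 2) * (lineDeriv ℝ g x (Pi.single u 1) - Complex.I * lineDeriv ℝ g x (Pi.single u Complex.I))

/-- The Wirtinger derivative `∂g/∂z̄_u = (∂g/∂x_u + i ∂g/∂y_u) / 2`, where `z_u = x_u + i y_u`. -/
def wirtingerBar {ι : Type*} [DecidableEq ι] (u : ι) (g : (ι → ℂ) → ℂ) (x : ι → ℂ) : ℂ :=
  (1 / 2) * (lineDeriv ℝ g x (Pi.single u 1) + Complex.I * lineDeriv ℝ g x (Pi.single u Complex.I))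

/-- The Kähler matrix `D_{u v̄}(T) = ∂/∂z_u ∂/∂z̄_v 𝒜_T`, evaluated at the configuration `z`. -/
def kahlerMatrix {ι : Type*} [DecidableEq ι] {z : ι → ℂ} (T : PointTriangulation z) :
    Matrix ι ι ℂ :=
  Matrix.of fun u v =>
    wirtinger u (wirtingerBar v (fun x => (prepotential T.faces x : ℂ))) z

/-- `d_{(ijk)}(T)`: the determinant of the Kähler matrix with the rows and columns `i`, `j`, `k`
removed. -/
def kahlerMinor {ι : Type*} [Fintype ι] [DecidableEq ι] {z : ι → ℂ} (i j k : ι)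
    (T : PointTriangulation z) : ℂ :=
  ((kahlerMatrix T).submatrix
    (Subtype.val : {u : ι // u ≠ i ∧ u ≠ j ∧ u ≠ k} → ι)
    (Subtype.val : {u : ι // u ≠ i ∧ u ≠ j ∧ u ≠ k} → ι)).det

end

-- `a ≤ b` in `ℂ` means that `b - a` is a nonnegative real number.
open scoped ComplexOrder

open scoped ENNReal
open Real (sin cos)

/-! The volume over a triangle is a sum of Lobachevsky functions of its angles
(`idealVolume_eq_logSinIntegral`), and its mixed second derivatives form a matrix of rank one
(`wirtinger_volumeWirtingerBar`). Hence the form of the Kähler matrix at a vector with conjugate `φ`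
is the sum over the faces of the area times `|φ[a,b,c]|²`, where `φ[a,b,c]` is a second divided
difference. The matrix is positive semidefinite, and the determinant is monotone for the Loewner
order (`det_le_det`), so it suffices that for each `φ` a Delaunay triangulation maximises this sum.

On four points the second divided differences are `G - k * (omitted point)`, and in the alternating
sum of the face terms only `|k|²` times the in-circle determinant survives
(`exists_faceForm_coboundary`). Flipping an edge that violates the Delaunay condition therefore
never decreases the sum, and cocircular points make no difference. Adding `ε` times the form of
`z³`, for which `k = 1`, makes these flips strictly increasing; `ε` is removed at the end.

The optimisation runs over chains (`IsFilling`), which are closed under flips and finite in number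
for a given boundary; all triangulations share their boundary (`boundary_faceChain_eq`). A
maximising chain is locally Delaunay, hence Delaunay (`circumpower_nonneg_of_local`). Two Delaunay
chains may differ, but their difference splits into cycles, one for each circumcentre
(`cocircularBoundary_eq_zero`). On each of these the integrand is a coboundary, so both chains give
the same sum (`sum_mul_eq_zero_of_delaunay_cycle`). -/

/-! ### Monotonicity of the determinant. -/

open scoped Matrix MatrixOrder in
/-- For a positive semidefinite matrix `P`, `det (1 + P) ≥ 1`. -/
theorem Matrix.PosSemidef.one_le_det_one_add {n : Type*} [Fintype n] [DecidableEq n]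
    {P : Matrix n n ℂ} (hP : P.PosSemidef) : 1 ≤ (1 + P).det := by
  have hdet : (1 + P).det = ∏ i, ((1 + hP.1.eigenvalues i : ℝ) : ℂ) := by
    -- Up to the sign `(-1) ^ card n`, `det (1 + P)` is the characteristic polynomial of `P` at
    -- `-1`.
    have h := congrArg (Polynomial.eval (-1)) hP.1.charpoly_eq
    rw [Matrix.eval_charpoly, Polynomial.eval_prod] at h
    have h1 : Matrix.scalar n (-1 : ℂ) - P = -(1 + P) := by
      simp [Matrix.scalar_apply, ← Matrix.diagonal_one, sub_eq_add_neg, add_comm]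
    rw [h1, Matrix.det_neg] at h
    have h2 : ((-1 : ℂ) ^ Fintype.card n) * ((-1 : ℂ) ^ Fintype.card n) = 1 := by
      rw [← mul_pow]; simp
    calc (1 + P).det = (-1 : ℂ) ^ Fintype.card n * ((-1 : ℂ) ^ Fintype.card n * (1 + P).det) := by
          rw [← mul_assoc, h2, one_mul]
      _ = _ := by
          rw [h, ← Finset.card_univ, ← Finset.prod_const, ← Finset.prod_mul_distrib]
          refine Finset.prod_congr rfl fun i _ => ?_
          simp
          ring
  rw [hdet, ← Complex.ofReal_prod]
  have : ∏ _i : n, (1 : ℝ) ≤ ∏ i, (1 + hP.1.eigenvalues i) :=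
    Finset.prod_le_prod (fun _ _ => zero_le_one) fun i _ => by linarith [hP.eigenvalues_nonneg i]
  rw [Finset.prod_const_one] at this
  exact_mod_cast this

open scoped Matrix MatrixOrder in
/-- The determinant is monotone for the Loewner order on positive semidefinite matrices. -/
theorem Matrix.PosSemidef.det_le_det {n : Type*} [Fintype n] [DecidableEq n]
    {A B : Matrix n n ℂ} (hA : A.PosSemidef) (hAB : (B - A).PosSemidef) : A.det ≤ B.det := by
  have hB : B.PosSemidef := by simpa using hA.add hAB
  by_cases h0 : A.det = 0
  · rw [h0]; exact hB.det_nonneg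
  -- With `A = Cᴴ C` invertible, `B = Cᴴ (1 + P) C` for a `P` congruent to `B - A`, so `det B = det
  -- A * det (1 + P)`.
  obtain ⟨C, hC⟩ := CStarAlgebra.nonneg_iff_eq_star_mul_self.mp hA.nonneg
  rw [Matrix.star_eq_conjTranspose] at hC
  have hCdet : C.det ≠ 0 := by
    intro h
    apply h0
    rw [hC, Matrix.det_mul, h, mul_zero]
  have hCu : IsUnit C.det := isUnit_iff_ne_zero.mpr hCdet
  have hP : ((C⁻¹)ᴴ * (B - A) * C⁻¹).PosSemidef := hAB.conjTranspose_mul_mul_same C⁻¹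
  have hCC : Cᴴ * (C⁻¹)ᴴ = 1 := by
    rw [← Matrix.conjTranspose_mul, Matrix.nonsing_inv_mul _ hCu, Matrix.conjTranspose_one]
  have hB' : B = Cᴴ * (1 + (C⁻¹)ᴴ * (B - A) * C⁻¹) * C := by
    have : Cᴴ * ((C⁻¹)ᴴ * (B - A) * C⁻¹) * C = B - A := by
      calc _ = (Cᴴ * (C⁻¹)ᴴ) * (B - A) * (C⁻¹ * C) := by simp only [Matrix.mul_assoc]
        _ = _ := by rw [hCC, Matrix.nonsing_inv_mul _ hCu, Matrix.one_mul, Matrix.mul_one]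
    rw [Matrix.mul_add, Matrix.add_mul, this, Matrix.mul_one, ← hC]; abel
  have hdet : B.det = A.det * (1 + (C⁻¹)ᴴ * (B - A) * C⁻¹).det := by
    conv_lhs => rw [hB']
    rw [hC, Matrix.det_mul, Matrix.det_mul, Matrix.det_mul]; ring
  rw [hdet]
  exact le_mul_of_one_le_right hA.det_nonneg hP.one_le_det_one_add

/-! ### Orientation and circumcircles in the plane -/

/-- Twice the signed area of the triangle `a b c`. -/
def orient (a b c : ℂ) : ℝ :=
  (b.re - a.re) * (c.im - a.im) - (b.im - a.im) * (c.re - a.re)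

/-- The real scalar product on `ℂ`. -/
def dotp (u v : ℂ) : ℝ := u.re * v.re + u.im * v.im

/-- The power of the point `w` with respect to the circle with centre `o` through `a`. -/
def power (o a w : ℂ) : ℝ := Complex.normSq (w - o) - Complex.normSq (a - o)

theorem orient_rotate (a b c : ℂ) : orient b c a = orient a b c := by
  simp only [orient]; ring

theorem orient_swap (a b c : ℂ) : orient b a c = - orient a b c := by
  simp only [orient]; ring

@[simp] theorem orient_self_left (a c : ℂ) : orient a a c = 0 := by simp [orient]

@[simp] theorem orient_self_right (a c : ℂ) : orient a c c = 0 := by simp [orient]; ring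

@[simp] theorem orient_self_outer (a c : ℂ) : orient a c a = 0 := by simp [orient]

theorem orient_add (a b c v : ℂ) : orient b c v + orient c a v + orient a b v = orient a b c := by
  simp only [orient]; ring

/-- Barycentric coordinates: `orient p q ·` is affine. -/
theorem orient_mul_orient (a b c p q w : ℂ) :
    orient a b c * orient p q w =
      orient b c w * orient p q a + orient c a w * orient p q b + orient a b w * orient p q c := by
  simp only [orient]; ring

theorem power_self (o a : ℂ) : power o a a = 0 := sub_self _

/-- The quadratic terms cancel: powers for two circles through `a` differ by a linear function of `w
- a`. -/
theorem power_sub_power (o o' a w : ℂ) :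
    power o a w - power o' a w = 2 * dotp (o' - o) (w - a) := by
  simp only [power, dotp, Complex.normSq_apply, Complex.sub_re, Complex.sub_im]; ring

/-- Splits `w - a` along `b - a` and its normal. For `q` orthogonal to `b - a` only the normal term
remains, so the sign depends on the side of the line `a b`. -/
theorem normSq_mul_dotp (q a b w : ℂ) :
    Complex.normSq (b - a) * dotp q (w - a) =
      dotp q (b - a) * dotp (b - a) (w - a) + orient 0 (b - a) q * orient a b w := by
  simp only [orient, dotp, Complex.normSq_apply, Complex.sub_re, Complex.sub_im, Complex.zero_re,
    Complex.zero_im]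
  ring

theorem ne_of_orient_ne_zero {a b c : ℂ} (h : orient a b c ≠ 0) : a ≠ b ∧ b ≠ c ∧ c ≠ a := by
  refine ⟨?_, ?_, ?_⟩ <;> rintro rfl <;> simp at h

theorem normSq_sub_pos {a b : ℂ} (h : a ≠ b) : 0 < Complex.normSq (b - a) :=
  Complex.normSq_pos.mpr (sub_ne_zero.mpr h.symm)

/-- A vector orthogonal to `b - a` has scalar products of the same sign with two points on the
same side of the line `a b`. -/
theorem dotp_nonneg_of_same_side {q a b d w : ℂ} (hab : a ≠ b) (hq : dotp q (b - a) = 0)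
    (hd : orient a b d < 0) (hw : orient a b w < 0) (h : 0 ≤ dotp q (d - a)) :
    0 ≤ dotp q (w - a) := by
  have hN := normSq_sub_pos hab
  have h1 := normSq_mul_dotp q a b d
  have h2 := normSq_mul_dotp q a b w
  rw [hq, zero_mul, zero_add] at h1 h2
  have h3 : orient 0 (b - a) q ≤ 0 := by
    by_contra hc
    push Not at hc
    have := mul_neg_of_pos_of_neg hc hd
    nlinarith [mul_nonneg hN.le h]
  by_contra hc
  push Not at hc
  have := mul_nonneg_of_nonpos_of_nonpos h3 hw.le
  nlinarith [mul_neg_of_pos_of_neg hN hc]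

theorem eq_zero_of_dotp_eq_zero {q a b w : ℂ} (hw : orient a b w ≠ 0)
    (hq : dotp q (b - a) = 0) (h : dotp q (w - a) = 0) : q = 0 := by
  simp only [dotp, Complex.sub_re, Complex.sub_im] at hq h
  have h1 : q.re * orient a b w = 0 := by
    simp only [orient]; linear_combination (w.im - a.im) * hq - (b.im - a.im) * h
  have h2 : q.im * orient a b w = 0 := by
    simp only [orient]; linear_combination (b.re - a.re) * h - (w.re - a.re) * hq
  apply Complex.ext
  · simpa [hw] using h1
  · simpa [hw] using h2

/-- Distances from `o` to `a` and `b` agree for two centres iff the difference is orthogonal. -/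
theorem dotp_sub_eq_zero {o o' a b : ℂ} (h : power o a b = 0) (h' : power o' a b = 0) :
    dotp (o' - o) (b - a) = 0 := by
  have := power_sub_power o o' a b
  rw [h, h'] at this
  linarith

/-- The circumcentre of a nondegenerate triangle. -/
noncomputable def ccenter (a b c : ℂ) : ℂ :=
  ⟨a.re + ((c.im - a.im) * Complex.normSq (b - a) - (b.im - a.im) * Complex.normSq (c - a)) /
      (2 * orient a b c),
    a.im + ((b.re - a.re) * Complex.normSq (c - a) - (c.re - a.re) * Complex.normSq (b - a)) /
      (2 * orient a b c)⟩

theorem power_ccenter_snd {a b c : ℂ} (h : orient a b c ≠ 0) : power (ccenter a b c) a b = 0 := by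
  simp only [power, ccenter, Complex.normSq_apply, Complex.sub_re, Complex.sub_im]
  field_simp
  simp only [orient]
  ring

theorem power_ccenter_thd {a b c : ℂ} (h : orient a b c ≠ 0) : power (ccenter a b c) a c = 0 := by
  simp only [power, ccenter, Complex.normSq_apply, Complex.sub_re, Complex.sub_im]
  field_simp
  simp only [orient]
  ring

theorem eq_of_power_eq_zero {a b c o o' : ℂ} (h : orient a b c ≠ 0)
    (hb : power o a b = 0) (hc : power o a c = 0) (hb' : power o' a b = 0)
    (hc' : power o' a c = 0) : o' = o :=
  sub_eq_zero.mp (eq_zero_of_dotp_eq_zero h (dotp_sub_eq_zero hb hb') (dotp_sub_eq_zero hc hc'))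

theorem eq_ccenter {a b c o : ℂ} (h : orient a b c ≠ 0)
    (hb : power o a b = 0) (hc : power o a c = 0) : o = ccenter a b c :=
  eq_of_power_eq_zero h (power_ccenter_snd h) (power_ccenter_thd h) hb hc

theorem power_eq_of_power_eq_zero {o a b : ℂ} (h : power o a b = 0) (w : ℂ) :
    power o b w = power o a w := by
  simp only [power] at *; linarith

theorem power_comm_zero {o a b : ℂ} (h : power o a b = 0) : power o b a = 0 := by
  rw [power_eq_of_power_eq_zero h, power_self]

theorem ccenter_rotate {a b c : ℂ} (h : orient a b c ≠ 0) : ccenter b c a = ccenter a b c := by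
  have hb := power_ccenter_snd h
  have hc := power_ccenter_thd h
  refine (eq_ccenter (by rwa [orient_rotate]) ?_ ?_).symm
  · rw [power_eq_of_power_eq_zero hb, hc]
  · exact power_comm_zero hb

/-- The power of a point in barycentric coordinates. -/
theorem orient_sq_mul_power {a b c o v : ℂ} (hb : power o a b = 0) (hc : power o a c = 0) :
    orient a b c ^ 2 * power o a v =
      -(orient b c v * orient c a v * Complex.normSq (b - a) +
        orient c a v * orient a b v * Complex.normSq (c - b) +
        orient a b v * orient b c v * Complex.normSq (a - c)) := by
  simp only [power, orient, Complex.normSq_apply, Complex.sub_re, Complex.sub_im] at *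
  linear_combination
    (((b.re - a.re) * (c.im - a.im) - (b.im - a.im) * (c.re - a.re)) *
      ((a.re - c.re) * (v.im - c.im) - (a.im - c.im) * (v.re - c.re))) * hb +
    (((b.re - a.re) * (c.im - a.im) - (b.im - a.im) * (c.re - a.re)) *
      ((b.re - a.re) * (v.im - a.im) - (b.im - a.im) * (v.re - a.re))) * hc

/-- With `D = orient a b c`, `s = -orient b c v` and `t = -orient a b v`, the barycentric formula
becomes `D² * power = D * (s |b - a|² + t |c - b|²) + |s (b - a) - t (c - b)|²`, a positive term
plus a square. -/
theorem power_pos_of_orient_nonpos {a b c o v : ℂ} (h : 0 < orient a b c) (hb : power o a b = 0)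
    (hc : power o a c = 0) (h1 : orient a b v < 0) (h2 : orient b c v ≤ 0) :
    0 < power o a v := by
  have hid := orient_sq_mul_power (v := v) hb hc
  have hsum := orient_add a b c v
  have hne := ne_of_orient_ne_zero h.ne'
  have hY : 0 < Complex.normSq (c - b) := normSq_sub_pos hne.2.1
  have hX : 0 < Complex.normSq (b - a) := normSq_sub_pos hne.1
  have hsq : (0 : ℝ) ≤ (-orient b c v * (b.re - a.re) + orient a b v * (c.re - b.re)) ^ 2 +
      (-orient b c v * (b.im - a.im) + orient a b v * (c.im - b.im)) ^ 2 := by positivity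
  have hZ : (-orient b c v - orient a b v) * (-orient b c v * Complex.normSq (b - a) -
      orient a b v * Complex.normSq (c - b)) -
        orient a b v * orient b c v * Complex.normSq (a - c) =
      (-orient b c v * (b.re - a.re) + orient a b v * (c.re - b.re)) ^ 2 +
      (-orient b c v * (b.im - a.im) + orient a b v * (c.im - b.im)) ^ 2 := by
    generalize orient b c v = s
    generalize orient a b v = t
    simp only [Complex.normSq_apply, Complex.sub_re, Complex.sub_im]
    ring
  have hca : orient c a v = orient a b c - orient b c v - orient a b v := by linarith
  have hpos : 0 < orient a b c * (-orient b c v * Complex.normSq (b - a) -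
      orient a b v * Complex.normSq (c - b)) := by
    apply mul_pos h
    have := mul_nonneg (neg_nonneg.mpr h2) hX.le
    have := mul_pos (neg_pos.mpr h1) hY
    linarith
  have : 0 < orient a b c ^ 2 * power o a v := by
    rw [hid, hca]; nlinarith
  exact pos_of_mul_pos_right this (sq_nonneg _)

/-- A point of the closed circumdisc beyond the edge `a b` is not beyond the other edges. -/
theorem orient_pos_of_power_nonpos {a b c o v : ℂ} (h : 0 < orient a b c) (hb : power o a b = 0)
    (hc : power o a c = 0) (h1 : orient a b v < 0) (hv : power o a v ≤ 0) :
    0 < orient b c v ∧ 0 < orient c a v := by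
  constructor
  · by_contra hcon
    exact absurd (power_pos_of_orient_nonpos h hb hc h1 (not_lt.mp hcon)) (not_lt.mpr hv)
  · by_contra hcon
    rcases (not_lt.mp hcon).lt_or_eq with hlt | heq
    · have := power_pos_of_orient_nonpos (a := c) (b := a) (c := b) (o := o) (v := v)
        (by rwa [← orient_rotate c a b]) (power_comm_zero hc)
        (by rw [power_eq_of_power_eq_zero hc, hb]) hlt h1.le
      rw [power_eq_of_power_eq_zero hc] at this
      linarith
    · have hid := orient_sq_mul_power (v := v) hb hc
      have hsum := orient_add a b c v
      rw [heq] at hid hsum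
      have hne := ne_of_orient_ne_zero h.ne'
      have hX : 0 < Complex.normSq (a - c) := normSq_sub_pos hne.2.2
      have : orient a b v * orient b c v < 0 := mul_neg_of_neg_of_pos h1 (by linarith)
      have h3 := mul_neg_of_neg_of_pos this hX
      have h4 : orient a b c ^ 2 * power o a v ≤ 0 :=
        mul_nonpos_of_nonneg_of_nonpos (sq_nonneg _) hv
      rw [hid] at h4
      linarith

/-! ### Fillings: chains of empty triangles with prescribed boundary -/

/-- A nonnegative integral chain `m` of positively oriented triangles of the configuration `z`, none
of which contains a point of the configuration other than its vertices, with boundary `B`. -/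
structure IsFilling {ι : Type*} [Fintype ι] (z : ι → ℂ) (B : ι → ι → ℤ) (m : ι → ι → ι → ℤ) :
    Prop where
  nonneg : ∀ a b c, 0 ≤ m a b c
  rotate : ∀ a b c, m b c a = m a b c
  pos : ∀ a b c, m a b c ≠ 0 → 0 < orient (z a) (z b) (z c)
  empty : ∀ a b c, m a b c ≠ 0 → ∀ v, 0 ≤ orient (z a) (z b) (z v) →
    0 ≤ orient (z b) (z c) (z v) → 0 ≤ orient (z c) (z a) (z v) → v = a ∨ v = b ∨ v = c
  boundary : ∀ a b, ∑ c, m a b c - ∑ c, m b a c = B a b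

theorem sum_rotate {ι M : Type*} [Fintype ι] [AddCommMonoid M] (F : ι → ι → ι → M) :
    ∑ a, ∑ b, ∑ c, F b c a = ∑ a, ∑ b, ∑ c, F a b c := by
  rw [Finset.sum_comm]
  refine Finset.sum_congr rfl fun a _ => ?_
  rw [Finset.sum_comm]

/-- Discrete Stokes formula. -/
theorem sum_mul_coboundary {ι : Type*} [Fintype ι] (m : ι → ι → ι → ℝ)
    (hm : ∀ a b c, m b c a = m a b c) (x : ι → ι → ℝ) (hx : ∀ a b, x b a = - x a b) :
    2 * ∑ a, ∑ b, ∑ c, m a b c * (x a b + x b c + x c a) =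
      3 * ∑ a, ∑ b, (∑ c, m a b c - ∑ c, m b a c) * x a b := by
  -- By rotation the three edge sums agree, which gives the factor 3; ordered pairs see each edge
  -- twice, which gives the factor 2.
  have h1 : ∑ a, ∑ b, ∑ c, m a b c * x b c = ∑ a, ∑ b, ∑ c, m a b c * x a b := by
    rw [← sum_rotate (fun a b c => m a b c * x a b)]
    simp only [hm]
  have h2 : ∑ a, ∑ b, ∑ c, m a b c * x c a = ∑ a, ∑ b, ∑ c, m a b c * x a b := by
    rw [← sum_rotate (fun a b c => m a b c * x c a)]
    simp only [hm]
  have h3 : ∑ a, ∑ b, (∑ c, m b a c) * x a b = - ∑ a, ∑ b, (∑ c, m a b c) * x a b := by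
    rw [Finset.sum_comm, ← Finset.sum_neg_distrib]
    refine Finset.sum_congr rfl fun a _ => ?_
    rw [← Finset.sum_neg_distrib]
    refine Finset.sum_congr rfl fun b _ => ?_
    rw [hx a b, mul_neg]
  simp only [mul_add, Finset.sum_add_distrib, h1, h2, sub_mul, Finset.sum_sub_distrib, h3]
  simp only [← Finset.sum_mul]
  ring

namespace IsFilling

variable {ι : Type*} [Fintype ι] {z : ι → ℂ} {B : ι → ι → ℤ} {m : ι → ι → ι → ℤ}

theorem rotate' (h : IsFilling z B m) (a b c : ι) : m c a b = m a b c := by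
  rw [h.rotate b c a, h.rotate]

theorem one_le (h : IsFilling z B m) {a b c : ι} (hm : m a b c ≠ 0) : 1 ≤ m a b c :=
  lt_of_le_of_ne (h.nonneg a b c) hm.symm

/-- Beyond an edge of a triangle that is not a boundary edge there is another triangle. -/
theorem exists_neighbour (h : IsFilling z B m) {a b c : ι} (hm : m a b c ≠ 0) (hB : B a b ≤ 0) :
    ∃ d, m b a d ≠ 0 := by
  by_contra hcon
  push Not at hcon
  have h1 := h.boundary a b
  simp only [hcon, Finset.sum_const_zero, sub_zero] at h1
  have h2 : m a b c ≤ ∑ c, m a b c :=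
    Finset.single_le_sum (f := fun c => m a b c) (fun c _ => h.nonneg a b c) (Finset.mem_univ c)
  have := h.one_le hm
  omega

/-- The shoelace formula: the boundary alone determines the total area. -/
theorem sum_orient (h : IsFilling z B m) :
    2 * ∑ a, ∑ b, ∑ c, (m a b c : ℝ) * orient (z a) (z b) (z c) =
      3 * ∑ a, ∑ b, (B a b : ℝ) * orient 0 (z a) (z b) := by
  have := sum_mul_coboundary (fun a b c => (m a b c : ℝ)) (fun a b c => by rw [h.rotate])
    (fun a b => orient 0 (z a) (z b)) (fun a b => by simp only [orient]; ring)
  simp only [← h.boundary]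
  push_cast
  rw [← this]
  congr 1
  refine Finset.sum_congr rfl fun a _ => Finset.sum_congr rfl fun b _ =>
    Finset.sum_congr rfl fun c _ => ?_
  simp only [orient, Complex.zero_re, Complex.zero_im]; ring

theorem mul_orient_nonneg (h : IsFilling z B m) (a b c : ι) :
    0 ≤ (m a b c : ℝ) * orient (z a) (z b) (z c) := by
  by_cases h0 : m a b c = 0
  · simp [h0]
  · exact mul_nonneg (by exact_mod_cast h.nonneg a b c) (h.pos a b c h0).le

-- The terms of the area sum are nonnegative and their total is fixed by `B`, so each coefficient is
-- bounded by the total divided by the area of its triangle.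
variable (z B) in
theorem finite [DecidableEq ι] : {m | IsFilling z B m}.Finite := by
  set S : ℝ := 3 / 2 * ∑ a, ∑ b, (B a b : ℝ) * orient 0 (z a) (z b) with hS
  refine (Set.finite_Icc (0 : ι → ι → ι → ℤ)
    (fun a b c => if 0 < orient (z a) (z b) (z c) then ⌈S / orient (z a) (z b) (z c)⌉ else 0)).subset
    fun m h => ⟨fun a b c => h.nonneg a b c, fun a b c => ?_⟩
  by_cases h0 : m a b c = 0
  · simp only [h0]
    have hS0 : 0 ≤ S := by
      have := h.sum_orient
      have h2 : 0 ≤ ∑ a, ∑ b, ∑ c, (m a b c : ℝ) * orient (z a) (z b) (z c) :=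
        Finset.sum_nonneg fun a _ => Finset.sum_nonneg fun b _ => Finset.sum_nonneg fun c _ =>
          h.mul_orient_nonneg a b c
      linarith
    split_ifs with hp
    · exact Int.ceil_nonneg (div_nonneg hS0 hp.le)
    · exact le_rfl
  · have hp := h.pos a b c h0
    simp only [hp, if_true]
    have h1 : (m a b c : ℝ) * orient (z a) (z b) (z c) ≤ S := by
      have h2 := h.sum_orient
      have h3 : (m a b c : ℝ) * orient (z a) (z b) (z c) ≤
          ∑ a, ∑ b, ∑ c, (m a b c : ℝ) * orient (z a) (z b) (z c) :=
        calc _ ≤ ∑ c, (m a b c : ℝ) * orient (z a) (z b) (z c) :=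
              Finset.single_le_sum (f := fun c => (m a b c : ℝ) * orient (z a) (z b) (z c))
                (fun c _ => h.mul_orient_nonneg a b c) (Finset.mem_univ c)
          _ ≤ ∑ b, ∑ c, (m a b c : ℝ) * orient (z a) (z b) (z c) :=
              Finset.single_le_sum
                (f := fun b => ∑ c, (m a b c : ℝ) * orient (z a) (z b) (z c))
                (fun b _ => Finset.sum_nonneg fun c _ => h.mul_orient_nonneg a b c)
                (Finset.mem_univ b)
          _ ≤ _ :=
              Finset.single_le_sum
                (f := fun a => ∑ b, ∑ c, (m a b c : ℝ) * orient (z a) (z b) (z c))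
                (fun a _ => Finset.sum_nonneg fun b _ => Finset.sum_nonneg fun c _ =>
                  h.mul_orient_nonneg a b c)
                (Finset.mem_univ a)
      linarith
    have h4 : (m a b c : ℝ) ≤ S / orient (z a) (z b) (z c) := (le_div_iff₀ hp).mpr h1
    exact_mod_cast h4.trans (Int.le_ceil _)

end IsFilling

/-! ### Edge flips of fillings. -/

/-- The elementary chain of the triangle `a b c`. -/
def triangleChain {ι : Type*} [DecidableEq ι] (a b c x y w : ι) : ℤ :=
  (if x = a ∧ y = b ∧ w = c then 1 else 0) + (if x = b ∧ y = c ∧ w = a then 1 else 0) +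
    (if x = c ∧ y = a ∧ w = b then 1 else 0)

section triangleChain

variable {ι : Type*} [DecidableEq ι]

theorem triangleChain_rotate (a b c x y w : ι) :
    triangleChain a b c y w x = triangleChain a b c x y w := by
  simp only [triangleChain, and_comm, and_left_comm]
  ring

theorem triangleChain_nonneg (a b c x y w : ι) : 0 ≤ triangleChain a b c x y w := by
  unfold triangleChain; positivity

theorem triangleChain_ne_zero {a b c x y w : ι} (h : triangleChain a b c x y w ≠ 0) :
    (x = a ∧ y = b ∧ w = c) ∨ (x = b ∧ y = c ∧ w = a) ∨ (x = c ∧ y = a ∧ w = b) := by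
  by_contra hcon
  push Not at hcon
  apply h
  simp only [triangleChain]
  rw [if_neg, if_neg, if_neg] <;> simp <;> tauto

theorem sum_triangleChain [Fintype ι] (a b c x y : ι) :
    ∑ w, triangleChain a b c x y w =
      (if x = a ∧ y = b then 1 else 0) + (if x = b ∧ y = c then 1 else 0) +
        (if x = c ∧ y = a then 1 else 0) := by
  simp only [triangleChain, Finset.sum_add_distrib, ← and_assoc, ite_and]
  congr 1
  · congr 1
    · split_ifs <;> simp
    · split_ifs <;> simp
  · split_ifs <;> simp

theorem sum_triangleChain_mul [Fintype ι] (a b c : ι) (W : ι → ι → ι → ℝ)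
    (hW : ∀ a b c, W b c a = W a b c) :
    ∑ x, ∑ y, ∑ w, (triangleChain a b c x y w : ℝ) * W x y w = 3 * W a b c := by
  have key : ∀ p q r : ι, ∑ x, ∑ y, ∑ w,
      ((if x = p ∧ y = q ∧ w = r then 1 else 0 : ℤ) : ℝ) * W x y w = W p q r := by
    intro p q r
    rw [Finset.sum_eq_single p, Finset.sum_eq_single q, Finset.sum_eq_single r]
    · simp
    · intro w _ hw; simp [hw]
    · simp
    · intro w _ hw; simp [hw]
    · simp
    · intro w _ hw; simp [hw]
    · simp
  simp only [triangleChain, Int.cast_add, add_mul, Finset.sum_add_distrib, key, hW]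
  rw [hW c a b]
  ring

end triangleChain

/-- A point of the triangle `a d c`, one of the two halves of the convex quadrilateral `a d b c`,
lies in one of the two halves `a b c` and `b a d`. -/
theorem empty_of_flip {a b c d w : ℂ} (habc : 0 < orient a b c) (hbad : 0 < orient b a d)
    (hadc : 0 < orient a d c) (hdbc : 0 < orient d b c)
    (h1 : 0 ≤ orient a d w) (h2 : 0 ≤ orient d c w) (h3 : 0 ≤ orient c a w) :
    (0 ≤ orient a b w ∧ 0 ≤ orient b c w ∧ 0 ≤ orient c a w) ∨
      (0 ≤ orient b a w ∧ 0 ≤ orient a d w ∧ 0 ≤ orient d b w) := by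
  rcases le_total 0 (orient a b w) with h | h
  · refine Or.inl ⟨h, ?_, h3⟩
    have := orient_mul_orient a d c b c w
    rw [orient_self_right, mul_zero, add_zero] at this
    have e1 : 0 < orient b c a := by rwa [orient_rotate]
    have e2 : 0 < orient b c d := by rwa [orient_rotate]
    have : 0 ≤ orient a d c * orient b c w := by rw [this]; positivity
    exact nonneg_of_mul_nonneg_right this hadc
  · refine Or.inr ⟨by rw [orient_swap]; linarith, h1, ?_⟩
    have := orient_mul_orient a d c d b w
    rw [orient_self_outer, mul_zero, add_zero] at this
    have e1 : 0 < orient d b a := by rwa [← orient_rotate d b a]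
    have : 0 ≤ orient a d c * orient d b w := by rw [this]; positivity
    exact nonneg_of_mul_nonneg_right this hadc

namespace IsFilling

variable {ι : Type*} [Fintype ι] {z : ι → ℂ} {B : ι → ι → ℤ} {m : ι → ι → ι → ℤ}

theorem ne (h : IsFilling z B m) {a b c : ι} (hm : m a b c ≠ 0) : a ≠ b ∧ b ≠ c ∧ c ≠ a := by
  have := ne_of_orient_ne_zero (h.pos a b c hm).ne'
  exact ⟨fun e => this.1 (by rw [e]), fun e => this.2.1 (by rw [e]), fun e => this.2.2 (by rw [e])⟩

/-- The new triangle is covered by the two old ones, which contain no points but their vertices; `b`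
is excluded because it lies beyond the edge `d c`. -/
theorem empty_flip (h : IsFilling z B m) {a b c d : ι} (h1 : m a b c ≠ 0) (h2 : m b a d ≠ 0)
    (hadc : 0 < orient (z a) (z d) (z c)) (hdbc : 0 < orient (z d) (z b) (z c)) (v : ι)
    (hv1 : 0 ≤ orient (z a) (z d) (z v)) (hv2 : 0 ≤ orient (z d) (z c) (z v))
    (hv3 : 0 ≤ orient (z c) (z a) (z v)) : v = a ∨ v = d ∨ v = c := by
  have hb : v ≠ b := by
    rintro rfl
    have : orient (z d) (z c) (z v) = - orient (z d) (z v) (z c) := by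
      simp only [orient]; ring
    linarith
  rcases empty_of_flip (h.pos _ _ _ h1) (h.pos _ _ _ h2) hadc hdbc hv1 hv2 hv3 with
    ⟨e1, e2, e3⟩ | ⟨e1, e2, e3⟩
  · have := h.empty _ _ _ h1 v e1 e2 e3; tauto
  · have := h.empty _ _ _ h2 v e1 e2 e3; tauto

variable [DecidableEq ι]

/-- Flipping the diagonal `a b` of the quadrilateral `a d b c`. -/
def flip (m : ι → ι → ι → ℤ) (a b c d : ι) (x y w : ι) : ℤ :=
  m x y w - triangleChain a b c x y w - triangleChain b a d x y w +
    triangleChain a d c x y w + triangleChain d b c x y w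

/-- Both pairs of triangles have the quadrilateral as boundary, because the two sides of a diagonal
cancel. -/
theorem isFilling_flip (h : IsFilling z B m) {a b c d : ι} (h1 : m a b c ≠ 0) (h2 : m b a d ≠ 0)
    (hadc : 0 < orient (z a) (z d) (z c)) (hdbc : 0 < orient (z d) (z b) (z c)) :
    IsFilling z B (flip m a b c d) := by
  have hcd : c ≠ d := by
    rintro rfl
    have e1 := h.pos _ _ _ h1
    have e2 := h.pos _ _ _ h2
    rw [orient_swap] at e2
    linarith
  obtain ⟨hab, hbc, hca⟩ := h.ne h1
  obtain ⟨-, had, hdb⟩ := h.ne h2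
  -- Both old triangles occur in `m`, and no rotation of one is a rotation of the other, so each
  -- coefficient loses at most 1.
  have hsub : ∀ x y w, 0 ≤ m x y w - triangleChain a b c x y w - triangleChain b a d x y w := by
    intro x y w
    have p1 := h.one_le h1
    have p1' : 1 ≤ m b c a := by rwa [h.rotate]
    have p1'' : 1 ≤ m c a b := by rwa [h.rotate']
    have p2 := h.one_le h2
    have p2' : 1 ≤ m a d b := by rwa [h.rotate]
    have p2'' : 1 ≤ m d b a := by rwa [h.rotate']
    have p3 := h.nonneg x y w
    by_cases e1 : triangleChain a b c x y w = 0
    · by_cases e2 : triangleChain b a d x y w = 0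
      · rw [e1, e2]; omega
      · rw [e1]
        rcases triangleChain_ne_zero e2 with ⟨rfl, rfl, rfl⟩ | ⟨rfl, rfl, rfl⟩ | ⟨rfl, rfl, rfl⟩ <;>
          simp [triangleChain, *, Ne.symm hab, Ne.symm had, Ne.symm hdb]
    · rcases triangleChain_ne_zero e1 with ⟨rfl, rfl, rfl⟩ | ⟨rfl, rfl, rfl⟩ | ⟨rfl, rfl, rfl⟩ <;>
        simp [triangleChain, *, Ne.symm hab, Ne.symm hbc, Ne.symm hca]
  have hsupp : ∀ x y w, flip m a b c d x y w ≠ 0 → m x y w ≠ 0 ∨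
      triangleChain a d c x y w ≠ 0 ∨ triangleChain d b c x y w ≠ 0 := by
    intro x y w hne
    by_contra hcon
    push Not at hcon
    apply hne
    have e1 := hsub x y w
    have e2 := triangleChain_nonneg a b c x y w
    have e3 := triangleChain_nonneg b a d x y w
    simp only [flip]
    omega
  have hE1 := h.empty_flip h1 h2 hadc hdbc
  -- The configuration is symmetric under exchanging `a` with `b` and `c` with `d`.
  have hE2 := h.empty_flip h2 h1 (by rwa [orient_rotate]) (by rwa [← orient_rotate (z c)])
  refine ⟨fun x y w => ?_, fun x y w => ?_, fun x y w hne => ?_, fun x y w hne v v1 v2 v3 => ?_,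
    fun x y => ?_⟩
  · have e1 := hsub x y w
    have e2 := triangleChain_nonneg a d c x y w
    have e3 := triangleChain_nonneg d b c x y w
    simp only [flip]
    omega
  · simp only [flip, triangleChain_rotate, h.rotate]
  · rcases hsupp x y w hne with e | e | e
    · exact h.pos _ _ _ e
    · rcases triangleChain_ne_zero e with ⟨rfl, rfl, rfl⟩ | ⟨rfl, rfl, rfl⟩ | ⟨rfl, rfl, rfl⟩
      · exact hadc
      · rwa [orient_rotate]
      · rwa [← orient_rotate (z x)]
    · rcases triangleChain_ne_zero e with ⟨rfl, rfl, rfl⟩ | ⟨rfl, rfl, rfl⟩ | ⟨rfl, rfl, rfl⟩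
      · exact hdbc
      · rwa [orient_rotate]
      · rwa [← orient_rotate (z x)]
  · rcases hsupp x y w hne with e | e | e
    · exact h.empty _ _ _ e v v1 v2 v3
    · rcases triangleChain_ne_zero e with ⟨rfl, rfl, rfl⟩ | ⟨rfl, rfl, rfl⟩ | ⟨rfl, rfl, rfl⟩
      · exact hE1 v v1 v2 v3
      · have := hE1 v v3 v1 v2; tauto
      · have := hE1 v v2 v3 v1; tauto
    · rcases triangleChain_ne_zero e with ⟨rfl, rfl, rfl⟩ | ⟨rfl, rfl, rfl⟩ | ⟨rfl, rfl, rfl⟩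
      · have := hE2 v v2 v3 v1; tauto
      · have := hE2 v v1 v2 v3; tauto
      · have := hE2 v v3 v1 v2; tauto
  · rw [← h.boundary x y]
    simp only [flip, Finset.sum_add_distrib, Finset.sum_sub_distrib, sum_triangleChain]
    simp only [and_comm (a := y = _)]
    ring

theorem sum_flip (a b c d : ι) (W : ι → ι → ι → ℝ) (hW : ∀ a b c, W b c a = W a b c) :
    ∑ x, ∑ y, ∑ w, (flip m a b c d x y w : ℝ) * W x y w =
      ∑ x, ∑ y, ∑ w, (m x y w : ℝ) * W x y w +
        3 * (W a d c + W d b c - W a b c - W b a d) := by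
  simp only [flip, Int.cast_add, Int.cast_sub, add_mul, sub_mul, Finset.sum_add_distrib,
    Finset.sum_sub_distrib, sum_triangleChain_mul _ _ _ W hW]
  ring

end IsFilling

/-! ### From locally Delaunay to Delaunay. -/

/-- The power of `w` with respect to the circumcircle of `a b c`. -/
noncomputable def circumpower (a b c w : ℂ) : ℝ := power (ccenter a b c) a w

theorem circumpower_rotate {a b c : ℂ} (h : orient a b c ≠ 0) (w : ℂ) :
    circumpower b c a w = circumpower a b c w := by
  rw [circumpower, circumpower, ccenter_rotate h,
    power_eq_of_power_eq_zero (power_ccenter_snd h)]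

theorem circumpower_vertex {a b c : ℂ} (h : orient a b c ≠ 0) :
    circumpower a b c a = 0 ∧ circumpower a b c b = 0 ∧ circumpower a b c c = 0 :=
  ⟨power_self _ _, power_ccenter_snd h, power_ccenter_thd h⟩

/-- Across a locally Delaunay edge, the power of a point beyond the edge decreases, strictly unless
the two circles agree. -/
theorem circumpower_le_of_neighbour {a b c d w : ℂ} (habc : 0 < orient a b c)
    (hbad : 0 < orient b a d) (hd : 0 ≤ circumpower a b c d) (hw : orient a b w < 0) :
    circumpower b a d w ≤ circumpower a b c w ∧
      (circumpower b a d w = circumpower a b c w → ccenter b a d = ccenter a b c) := by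
  have hb := power_ccenter_snd habc.ne'
  have ha' := power_ccenter_snd hbad.ne'
  have hd' := power_ccenter_thd hbad.ne'
  set o := ccenter a b c with ho
  set o' := ccenter b a d with ho'
  have hb' := power_comm_zero ha'
  have hq := dotp_sub_eq_zero hb hb'
  have key := fun x => power_sub_power o o' a x
  have e : ∀ x, circumpower b a d x = power o' a x := fun x => by
    rw [circumpower, ← ho', power_eq_of_power_eq_zero ha']
  rw [e, circumpower, ← ho]
  have hdd : 0 ≤ dotp (o' - o) (d - a) := by
    have := key d
    rw [circumpower, ← ho] at hd
    have h2 : power o' a d = 0 := (power_eq_of_power_eq_zero ha' d).trans hd'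
    rw [h2] at this
    linarith
  have hdneg : orient a b d < 0 := by rw [orient_swap]; linarith
  have hab := (ne_of_orient_ne_zero habc.ne').1
  -- The difference of the two powers vanishes on the line `a b` and has the right sign at `d`,
  -- which is on the same side as `w`.
  have hww := dotp_nonneg_of_same_side hab hq hdneg hw hdd
  have kw := key w
  refine ⟨by linarith, fun heq => ?_⟩
  have : o' - o = 0 := eq_zero_of_dotp_eq_zero hw.ne hq (by linarith)
  exact sub_eq_zero.mp this

namespace IsFilling

variable {ι : Type*} [Fintype ι] {z : ι → ℂ} {B : ι → ι → ℤ} {m : ι → ι → ι → ℤ}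

/-- A point in the open circumdisc of a triangle of a filling lies beyond one of its edges. -/
theorem exists_edge_of_circumpower_neg (h : IsFilling z B m) {a b c w : ι} (hm : m a b c ≠ 0)
    (hw : circumpower (z a) (z b) (z c) (z w) < 0) :
    orient (z a) (z b) (z w) < 0 ∨ orient (z b) (z c) (z w) < 0 ∨ orient (z c) (z a) (z w) < 0 := by
  by_contra hcon
  push Not at hcon
  have hv := circumpower_vertex (h.pos _ _ _ hm).ne'
  rcases h.empty _ _ _ hm w hcon.1 hcon.2.1 hcon.2.2 with rfl | rfl | rfl
  · exact hw.ne hv.1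
  · exact hw.ne hv.2.1
  · exact hw.ne hv.2.2

/-- A locally Delaunay filling is Delaunay. -/
theorem circumpower_nonneg_of_local (h : IsFilling z B m)
    (hB : ∀ a b, 0 < B a b → ∀ v, 0 ≤ orient (z a) (z b) (z v))
    (hloc : ∀ a b c d, m a b c ≠ 0 → m b a d ≠ 0 → 0 ≤ circumpower (z a) (z b) (z c) (z d))
    {a b c : ι} (hm : m a b c ≠ 0) (w : ι) : 0 ≤ circumpower (z a) (z b) (z c) (z w) := by
  classical
  by_contra hcon
  push Not at hcon
  let P : Finset (ι × ι × ι) := Finset.univ.filter fun t =>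
    m t.1 t.2.1 t.2.2 ≠ 0 ∧ orient (z t.1) (z t.2.1) (z w) < 0 ∧
      circumpower (z t.1) (z t.2.1) (z t.2.2) (z w) < 0
  let S : ι × ι × ι → Finset ι := fun t => Finset.univ.filter fun v =>
    orient (z t.1) (z t.2.1) (z v) < 0 ∧ circumpower (z t.1) (z t.2.1) (z t.2.2) (z v) = 0
  have hPmem : ∀ {a b c : ι}, m a b c ≠ 0 → circumpower (z a) (z b) (z c) (z w) < 0 →
      orient (z a) (z b) (z w) < 0 → (a, b, c) ∈ P := fun h1 h2 h3 => by
    simp only [P, Finset.mem_filter, Finset.mem_univ, true_and]; exact ⟨h1, h3, h2⟩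
  have hne : P.Nonempty := by
    have hp := (h.pos _ _ _ hm).ne'
    rcases h.exists_edge_of_circumpower_neg hm hcon with e | e | e
    · exact ⟨_, hPmem hm hcon e⟩
    · exact ⟨_, hPmem (by rwa [h.rotate a b c]) (by rwa [circumpower_rotate hp]) e⟩
    · exact ⟨_, hPmem (by rwa [h.rotate' a b c])
        (by rwa [← circumpower_rotate (by rwa [← orient_rotate (z c)])]) e⟩
  -- Walk towards `w`: crossing an edge does not raise the power of `w`, and when the circle stays
  -- the same, the set `S` of points on it beyond the chosen edge shrinks. A lexicographic minimum
  -- leaves no further step.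
  obtain ⟨⟨a, b, c⟩, hmem, hmin⟩ := P.exists_min_image
    (fun t => toLex (circumpower (z t.1) (z t.2.1) (z t.2.2) (z w), (S t).card)) hne
  simp only [P, Finset.mem_filter, Finset.mem_univ, true_and] at hmem
  obtain ⟨hm, how, hpw⟩ := hmem
  have hBab : B a b ≤ 0 := by
    by_contra hc
    exact absurd (hB a b (not_le.mp hc) w) (not_le.mpr how)
  obtain ⟨d, hd⟩ := h.exists_neighbour hm hBab
  have habc := h.pos _ _ _ hm
  have hbad := h.pos _ _ _ hd
  obtain ⟨hle, heq⟩ := circumpower_le_of_neighbour habc hbad (hloc a b c d hm hd) how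
  have hneg : circumpower (z b) (z a) (z d) (z w) < 0 := hle.trans_lt hpw
  -- the neighbouring triangle, entered through `a b`, has an edge nearer to `w`
  have step : ∀ p q r : ι, m p q r ≠ 0 → orient (z p) (z q) (z w) < 0 →
      (∀ v, circumpower (z p) (z q) (z r) v = circumpower (z b) (z a) (z d) v) →
      orient (z p) (z q) (z d) = 0 →
      (∀ v, orient (z p) (z q) (z v) < 0 → circumpower (z b) (z a) (z d) (z v) = 0 →
        0 < orient (z b) (z a) (z v)) → False := by
    intro p q r h1 h2 h3 h4 h5
    have hmn := hmin (p, q, r) (hPmem h1 (by rwa [h3]) h2)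
    rw [Prod.Lex.toLex_le_toLex] at hmn
    simp only [h3] at hmn
    rcases hmn with hlt | ⟨he, hcard⟩
    · linarith
    · have hcc := heq he.symm
      have hpp : ∀ v, circumpower (z b) (z a) (z d) v = circumpower (z a) (z b) (z c) v := by
        intro v
        rw [circumpower, circumpower, hcc]
        exact power_eq_of_power_eq_zero (power_ccenter_snd habc.ne') v
      -- The inclusion is strict at `d`, which is on the circle and beyond `a b`, but on the line `p
      -- q`.
      have hss : S (p, q, r) ⊂ S (a, b, c) := by
        rw [Finset.ssubset_iff_of_subset]
        · refine ⟨d, ?_, ?_⟩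
          · simp only [S, Finset.mem_filter, Finset.mem_univ, true_and]
            refine ⟨by rw [orient_swap]; linarith, ?_⟩
            rw [← hpp]; exact (circumpower_vertex hbad.ne').2.2
          · simp only [S, Finset.mem_filter, Finset.mem_univ, true_and, not_and]
            intro h6; linarith
        · intro v hv
          simp only [S, Finset.mem_filter, Finset.mem_univ, true_and] at hv ⊢
          rw [h3] at hv
          have := h5 v hv.1 hv.2
          rw [orient_swap] at this
          exact ⟨by linarith, by rw [← hpp]; exact hv.2⟩
      exact absurd (Finset.card_lt_card hss) (not_lt.mpr hcard)
  have r1 : ∀ v, circumpower (z a) (z d) (z b) v = circumpower (z b) (z a) (z d) v :=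
    circumpower_rotate hbad.ne'
  have hadb : 0 < orient (z a) (z d) (z b) := by rwa [orient_rotate]
  have r2 : ∀ v, circumpower (z d) (z b) (z a) v = circumpower (z b) (z a) (z d) v := fun v => by
    rw [circumpower_rotate hadb.ne', r1]
  have hdba : 0 < orient (z d) (z b) (z a) := by rwa [orient_rotate]
  rcases h.exists_edge_of_circumpower_neg hd hneg with e | e | e
  · rw [orient_swap] at e; linarith
  · refine step a d b (by rwa [h.rotate]) e r1 (by simp) fun v hv1 hv2 => ?_
    rw [← r1] at hv2
    exact (orient_pos_of_power_nonpos hadb (power_ccenter_snd hadb.ne')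
      (power_ccenter_thd hadb.ne') hv1 hv2.le).2
  · refine step d b a (by rwa [h.rotate']) e r2 (by simp) fun v hv1 hv2 => ?_
    rw [← r2] at hv2
    exact (orient_pos_of_power_nonpos hdba (power_ccenter_snd hdba.ne')
      (power_ccenter_thd hdba.ne') hv1 hv2.le).1

end IsFilling

/-! ### Cycles of Delaunay triangles. -/

/-- Three distinct points of a circle are not collinear. -/
theorem orient_ne_zero_of_power_eq_zero {o a b c : ℂ} (hb : power o a b = 0) (hc : power o a c = 0)
    (hab : a ≠ b) (hac : a ≠ c) (hbc : b ≠ c) : orient a b c ≠ 0 := by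
  intro h
  have h' : orient a c b = 0 := by
    have : orient a c b = - orient a b c := by simp only [orient]; ring
    rw [this, h, neg_zero]
  have e1 := normSq_mul_dotp (o - a) a b c
  have e2 := normSq_mul_dotp (o - a) a c b
  rw [h, mul_zero, add_zero] at e1
  rw [h', mul_zero, add_zero] at e2
  have hb2 : 2 * dotp (o - a) (b - a) = Complex.normSq (b - a) := by
    simp only [power, dotp, Complex.normSq_apply, Complex.sub_re, Complex.sub_im] at *
    linarith
  have hc2 : 2 * dotp (o - a) (c - a) = Complex.normSq (c - a) := by
    simp only [power, dotp, Complex.normSq_apply, Complex.sub_re, Complex.sub_im] at *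
    linarith
  have hB := normSq_sub_pos hab
  have hC := normSq_sub_pos hac
  -- For collinear points the chord equations `hb2` and `hc2` make `|c - a|²` and `|b - a|²` both
  -- equal to the scalar product, whence `|c - b|² = 0`.
  have f1 : Complex.normSq (c - a) = dotp (b - a) (c - a) := by
    apply mul_left_cancel₀ hB.ne'
    linear_combination 2 * e1 - Complex.normSq (b - a) * hc2 + dotp (b - a) (c - a) * hb2
  have f2 : Complex.normSq (b - a) = dotp (c - a) (b - a) := by
    apply mul_left_cancel₀ hC.ne'
    linear_combination 2 * e2 - Complex.normSq (c - a) * hb2 + dotp (c - a) (b - a) * hc2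
  have h3 : Complex.normSq (c - b) = 0 := by
    simp only [dotp, Complex.normSq_apply, Complex.sub_re, Complex.sub_im] at *
    linarith
  exact (normSq_sub_pos hbc).ne' h3

/-- Some linear functional separates the points of a finite configuration. -/
theorem exists_dotp_injective {ι : Type*} [Finite ι] {z : ι → ℂ} (hz : Function.Injective z) :
    ∃ g : ℂ, Function.Injective fun a => dotp g (z a) := by
  -- Among the functionals `(1, t)`, each pair of points excludes at most one `t`.
  have hfin : (⋃ p : {p : ι × ι // p.1 ≠ p.2},
      {t : ℝ | dotp ⟨1, t⟩ (z p.1.1) = dotp ⟨1, t⟩ (z p.1.2)}).Finite := by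
    refine Set.finite_iUnion fun p => Set.Subsingleton.finite ?_
    intro t ht s hs
    simp only [dotp, Set.mem_ofPred_eq, one_mul] at ht hs
    by_contra hts
    have h1 : (t - s) * ((z p.1.1).im - (z p.1.2).im) = 0 := by linarith
    have h2 := (mul_eq_zero.mp h1).resolve_left (sub_ne_zero.mpr hts)
    apply p.2
    apply hz
    apply Complex.ext
    · have : (z p.1.1).im = (z p.1.2).im := by linarith
      rw [this] at ht
      linarith
    · linarith
  obtain ⟨t, -, ht⟩ := Set.infinite_univ.exists_notMem_finite hfin
  refine ⟨⟨1, t⟩, fun a b hab => ?_⟩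
  by_contra hne
  exact ht (Set.mem_iUnion.mpr ⟨⟨(a, b), hne⟩, hab⟩)

section DelaunayCycle

variable {ι : Type*} {z : ι → ℂ} {δ : ι → ι → ι → ℝ}

open scoped Classical in
/-- The part of a chain made of the triangles with circumcentre `o`. -/
noncomputable def cocircularPart (z : ι → ℂ) (δ : ι → ι → ι → ℝ) (o : ℂ) (a b c : ι) : ℝ :=
  if ccenter (z a) (z b) (z c) = o then δ a b c else 0

theorem cocircularPart_rotate (hrot : ∀ a b c, δ b c a = δ a b c)
    (hpos : ∀ a b c, δ a b c ≠ 0 → 0 < orient (z a) (z b) (z c)) (o : ℂ) (a b c : ι) :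
    cocircularPart z δ o b c a = cocircularPart z δ o a b c := by
  unfold cocircularPart
  rw [hrot]
  by_cases h : δ a b c = 0
  · simp [h]
  · rw [ccenter_rotate (hpos _ _ _ h).ne']

theorem cocircularPart_ne_zero {o : ℂ} {a b c : ι} (h : cocircularPart z δ o a b c ≠ 0) :
    δ a b c ≠ 0 ∧ ccenter (z a) (z b) (z c) = o := by
  unfold cocircularPart at h
  split_ifs at h with h1
  · exact ⟨h, h1⟩
  · exact absurd rfl h

theorem sum_cocircularPart [DecidableEq ℂ] {s : Finset ℂ} {a b c : ι}
    (h : ccenter (z a) (z b) (z c) ∈ s) : ∑ o ∈ s, cocircularPart z δ o a b c = δ a b c := by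
  unfold cocircularPart
  rw [Finset.sum_eq_single (ccenter (z a) (z b) (z c))]
  · simp
  · intro o _ ho; rw [if_neg (Ne.symm ho)]
  · intro h'; exact absurd h h'

variable [Fintype ι]

/-- The boundary of the part of a chain made of the triangles with circumcentre `o`. -/
noncomputable def cocircularBoundary (z : ι → ℂ) (δ : ι → ι → ι → ℝ) (o : ℂ) (a b : ι) : ℝ :=
  ∑ c, cocircularPart z δ o a b c - ∑ c, cocircularPart z δ o b a c

theorem cocircularBoundary_swap (o : ℂ) (a b : ι) :
    cocircularBoundary z δ o b a = - cocircularBoundary z δ o a b := by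
  simp only [cocircularBoundary]; ring

/-- An edge in the boundary of a cocircular part spans a chord of an empty circle. -/
theorem empty_of_cocircularBoundary_ne_zero
    (hpos : ∀ a b c, δ a b c ≠ 0 → 0 < orient (z a) (z b) (z c))
    (hdel : ∀ a b c, δ a b c ≠ 0 → ∀ w, 0 ≤ circumpower (z a) (z b) (z c) (z w))
    {o : ℂ} {a b : ι} (h : cocircularBoundary z δ o a b ≠ 0) :
    (∃ c d e, ccenter (z c) (z d) (z e) = o) ∧ z a ≠ z b ∧ power o (z a) (z b) = 0 ∧
      ∀ w, 0 ≤ power o (z a) (z w) := by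
  have : (∃ c, cocircularPart z δ o a b c ≠ 0) ∨ ∃ c, cocircularPart z δ o b a c ≠ 0 := by
    by_contra hcon
    push Not at hcon
    apply h
    simp [cocircularBoundary, hcon]
  rcases this with ⟨c, hc⟩ | ⟨c, hc⟩
  · obtain ⟨hδ, rfl⟩ := cocircularPart_ne_zero hc
    have hp := (hpos _ _ _ hδ).ne'
    exact ⟨⟨_, _, _, rfl⟩, (ne_of_orient_ne_zero hp).1, power_ccenter_snd hp, hdel _ _ _ hδ⟩
  · obtain ⟨hδ, rfl⟩ := cocircularPart_ne_zero hc
    have hp := (hpos _ _ _ hδ).ne'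
    have hs := power_ccenter_snd hp
    refine ⟨⟨_, _, _, rfl⟩, (ne_of_orient_ne_zero hp).1.symm, power_comm_zero hs, fun w => ?_⟩
    rw [power_eq_of_power_eq_zero hs]
    exact hdel _ _ _ hδ w

/-- In a cycle of Delaunay triangles, the triangles with a given circumcircle form a cycle. -/
theorem cocircularBoundary_eq_zero (hz : Function.Injective z)
    (hrot : ∀ a b c, δ b c a = δ a b c)
    (hpos : ∀ a b c, δ a b c ≠ 0 → 0 < orient (z a) (z b) (z c))
    (hdel : ∀ a b c, δ a b c ≠ 0 → ∀ w, 0 ≤ circumpower (z a) (z b) (z c) (z w))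
    (hcyc : ∀ a b, ∑ c, δ a b c = ∑ c, δ b a c) (o : ℂ) (a b : ι) :
    cocircularBoundary z δ o a b = 0 := by
  classical
  by_contra hcon
  obtain ⟨g, hg⟩ := exists_dotp_injective hz
  let C : Finset ℂ := Finset.univ.image fun t : ι × ι × ι => ccenter (z t.1) (z t.2.1) (z t.2.2)
  have hC : ∀ a b c, ccenter (z a) (z b) (z c) ∈ C := fun a b c =>
    Finset.mem_image.mpr ⟨(a, b, c), Finset.mem_univ _, rfl⟩
  have hsum : ∀ a b, ∑ o ∈ C, cocircularBoundary z δ o a b = 0 := by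
    intro a b
    simp only [cocircularBoundary, Finset.sum_sub_distrib]
    rw [Finset.sum_comm, Finset.sum_comm (s := C) (t := Finset.univ)]
    simp only [sum_cocircularPart (hC _ _ _), hcyc a b, sub_self]
  have hemp := @empty_of_cocircularBoundary_ne_zero ι z δ _ hpos hdel
  let E : Finset ℂ := C.filter fun o => ∃ a b, cocircularBoundary z δ o a b ≠ 0
  have hE : ∀ {o : ℂ} {a b : ι}, cocircularBoundary z δ o a b ≠ 0 → o ∈ E := by
    intro o a b h
    obtain ⟨⟨c, d, e, he⟩, -⟩ := hemp h
    exact Finset.mem_filter.mpr ⟨he ▸ hC c d e, a, b, h⟩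
  -- The vector `⟨g.im, -g.re⟩` is `g` turned clockwise by a right angle. With `o` extreme in this
  -- direction and `a` the top vertex along `g`, two distinct boundary edges at `a` will be
  -- contradictory.
  obtain ⟨o, ho, hmax⟩ := E.exists_max_image (fun o => dotp ⟨g.im, -g.re⟩ o) ⟨_, hE hcon⟩
  obtain ⟨-, a₀, b₀, h₀⟩ := Finset.mem_filter.mp ho
  let V : Finset ι := Finset.univ.filter fun a => ∃ b, cocircularBoundary z δ o a b ≠ 0
  have hV : ∀ {a b : ι}, cocircularBoundary z δ o a b ≠ 0 → a ∈ V := fun {a b} h =>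
    Finset.mem_filter.mpr ⟨Finset.mem_univ _, b, h⟩
  obtain ⟨a, ha, htop⟩ := V.exists_max_image (fun a => dotp g (z a)) ⟨_, hV h₀⟩
  obtain ⟨-, b, hb⟩ := Finset.mem_filter.mp ha
  have hrot' := cocircularPart_rotate hrot hpos o
  -- A boundary has no boundary, so `a` cannot lie on just one boundary edge.
  have hdd : ∑ b, cocircularBoundary z δ o a b = 0 := by
    simp only [cocircularBoundary, Finset.sum_sub_distrib]
    rw [Finset.sum_comm (f := fun b c => cocircularPart z δ o b a c), sub_eq_zero]
    refine Finset.sum_congr rfl fun b _ => Finset.sum_congr rfl fun c _ => ?_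
    rw [hrot' c a b]
  obtain ⟨b', hb'b, hb'⟩ : ∃ b', b' ≠ b ∧ cocircularBoundary z δ o a b' ≠ 0 := by
    by_contra hc
    push Not at hc
    rw [Finset.sum_eq_single b (fun c _ hcb => hc c hcb) (by simp)] at hdd
    exact hb hdd
  -- every point of the circle lies to the left of a boundary edge leaving `a`
  have key : ∀ b b', cocircularBoundary z δ o a b ≠ 0 → power o (z a) (z b') = 0 →
      0 ≤ orient (z a) (z b) (z b') := by
    intro b b' hb hb'
    -- The total boundary is zero, so the edge must be compensated by another centre `o'`. Since the
    -- edge points down along `g`, maximality of `o` puts `o'` to its right; as the circle of `o'`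
    -- is empty, `b'` cannot lie on the right.
    obtain ⟨o', ho', hoo'⟩ : ∃ o', o' ≠ o ∧ cocircularBoundary z δ o' a b ≠ 0 := by
      by_contra hc
      push Not at hc
      have := hsum a b
      rw [Finset.sum_eq_single o (fun c _ hcb => hc c hcb)
        (fun h => absurd (Finset.mem_filter.mp (hE hb)).1 h)] at this
      exact hb this
    obtain ⟨-, hne, hpb, -⟩ := hemp hb
    obtain ⟨-, -, hpb', hemp'⟩ := hemp hoo'
    have hq := dotp_sub_eq_zero hpb hpb'
    have hm := hmax o' (hE hoo')
    have hps := power_sub_power o o' (z a) (z b')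
    have hl : dotp g (z b) < dotp g (z a) := by
      refine lt_of_le_of_ne (htop b (hV (a := b) (b := a) ?_)) fun e => hne ?_
      · rw [cocircularBoundary_swap]; exact neg_ne_zero.mpr hb
      · rw [hg e]
    have hw := hemp' b'
    have hN := normSq_sub_pos hne
    have hqne : o' - o ≠ 0 := sub_ne_zero.mpr ho'
    have i1 := normSq_mul_dotp (o' - o) (z a) (z b) (z b')
    rw [hq, zero_mul, zero_add] at i1
    -- `o' - o` is a positive multiple of the outward normal
    have i2 : Complex.normSq (z b - z a) * (dotp ⟨g.im, -g.re⟩ (o') - dotp ⟨g.im, -g.re⟩ o) =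
        - orient 0 (z b - z a) (o' - o) * (dotp g (z b) - dotp g (z a)) := by
      simp only [orient, dotp, Complex.normSq_apply, Complex.sub_re, Complex.sub_im,
        Complex.zero_re, Complex.zero_im] at hq ⊢
      linear_combination (g.im * ((z b).re - (z a).re) - g.re * ((z b).im - (z a).im)) * hq
    have i3 : orient 0 (z b - z a) (o' - o) ≤ 0 := by
      by_contra hc
      push Not at hc
      have h1 : 0 < - orient 0 (z b - z a) (o' - o) * (dotp g (z b) - dotp g (z a)) :=
        mul_pos_of_neg_of_neg (by linarith) (by linarith)
      rw [← i2] at h1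
      have h2 := pos_of_mul_pos_right h1 hN.le
      linarith
    have i4 : orient 0 (z b - z a) (o' - o) ≠ 0 := by
      intro h0
      apply hqne
      simp only [orient, dotp, Complex.sub_re, Complex.sub_im, Complex.zero_re, Complex.zero_im,
        sub_zero, Complex.normSq_apply] at h0 hq hN
      apply Complex.ext
      · simp only [Complex.sub_re, Complex.zero_re]
        apply (mul_eq_zero.mp (_ : (_ : ℝ) * (o'.re - o.re) = 0)).resolve_left hN.ne'
        linear_combination ((z b).re - (z a).re) * hq - ((z b).im - (z a).im) * h0
      · simp only [Complex.sub_im, Complex.zero_im]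
        apply (mul_eq_zero.mp (_ : (_ : ℝ) * (o'.im - o.im) = 0)).resolve_left hN.ne'
        linear_combination ((z b).im - (z a).im) * hq + ((z b).re - (z a).re) * h0
    have i5 := lt_of_le_of_ne i3 i4
    by_contra hc
    push Not at hc
    have := mul_pos_of_neg_of_neg i5 hc
    rw [← i1] at this
    have h2 := pos_of_mul_pos_right this hN.le
    linarith
  obtain ⟨-, hne, hpb, -⟩ := hemp hb
  obtain ⟨-, hne', hpb', -⟩ := hemp hb'
  -- Each of `b`, `b'` is weakly to the left of the edge towards the other, so `a`, `b`, `b'` would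
  -- be collinear points of a circle.
  have k1 := key b b' hb hpb'
  have k2 := key b' b hb' hpb
  have k3 : orient (z a) (z b') (z b) = - orient (z a) (z b) (z b') := by
    simp only [orient]; ring
  exact orient_ne_zero_of_power_eq_zero hpb hpb' hne hne' (fun e => hb'b (hz e).symm)
    (by linarith)

/-- A function on triangles that is alternating and additive on cocircular points integrates to
zero over a cycle of Delaunay triangles. -/
theorem sum_mul_eq_zero_of_delaunay_cycle (hz : Function.Injective z)
    (hrot : ∀ a b c, δ b c a = δ a b c)
    (hpos : ∀ a b c, δ a b c ≠ 0 → 0 < orient (z a) (z b) (z c))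
    (hdel : ∀ a b c, δ a b c ≠ 0 → ∀ w, 0 ≤ circumpower (z a) (z b) (z c) (z w))
    (hcyc : ∀ a b, ∑ c, δ a b c = ∑ c, δ b a c)
    {W : ι → ι → ι → ℝ} (hW : ∀ a b c, W b a c = - W a b c)
    (hWc : ∀ a b c v, 0 < orient (z a) (z b) (z c) → circumpower (z a) (z b) (z c) (z v) = 0 →
      W a b c = W a b v + W b c v + W c a v) :
    ∑ a, ∑ b, ∑ c, δ a b c * W a b c = 0 := by
  classical
  let C : Finset ℂ := Finset.univ.image fun t : ι × ι × ι => ccenter (z t.1) (z t.2.1) (z t.2.2)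
  have hC : ∀ a b c, ccenter (z a) (z b) (z c) ∈ C := fun a b c =>
    Finset.mem_image.mpr ⟨(a, b, c), Finset.mem_univ _, rfl⟩
  have hsplit : ∑ a, ∑ b, ∑ c, δ a b c * W a b c =
      ∑ o ∈ C, ∑ a, ∑ b, ∑ c, cocircularPart z δ o a b c * W a b c := by
    symm
    rw [Finset.sum_comm]
    refine Finset.sum_congr rfl fun a _ => ?_
    rw [Finset.sum_comm]
    refine Finset.sum_congr rfl fun b _ => ?_
    rw [Finset.sum_comm]
    refine Finset.sum_congr rfl fun c _ => ?_
    rw [← Finset.sum_mul, sum_cocircularPart (hC _ _ _)]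
  rw [hsplit]
  refine Finset.sum_eq_zero fun o _ => ?_
  by_cases hex : ∃ a b c, cocircularPart z δ o a b c ≠ 0
  · obtain ⟨v, v', v'', hv⟩ := hex
    obtain ⟨hδv, hov⟩ := cocircularPart_ne_zero hv
    -- Cone from a vertex `v` on the circle: there `W` is the coboundary of `W a b v`.
    have hst := sum_mul_coboundary (fun a b c => cocircularPart z δ o a b c)
      (cocircularPart_rotate hrot hpos o) (fun a b => W a b v) (fun a b => hW a b v)
    have hb : ∀ a b, ∑ c, cocircularPart z δ o a b c - ∑ c, cocircularPart z δ o b a c = 0 :=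
      cocircularBoundary_eq_zero hz hrot hpos hdel hcyc o
    simp only [hb, zero_mul, Finset.sum_const_zero, mul_zero] at hst
    have h2 := (mul_eq_zero.mp hst).resolve_left two_ne_zero
    rw [← h2]
    refine Finset.sum_congr rfl fun a _ => Finset.sum_congr rfl fun b _ =>
      Finset.sum_congr rfl fun c _ => ?_
    by_cases h0 : cocircularPart z δ o a b c = 0
    · simp [h0]
    · obtain ⟨hδ, ho⟩ := cocircularPart_ne_zero h0
      rw [hWc a b c v (hpos _ _ _ hδ)]
      -- Neither circle contains the chosen vertex of the other in its interior, and both have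
      -- centre `o`, so they coincide.
      have e1 := hdel _ _ _ hδ v
      have e2 := hdel _ _ _ hδv a
      rw [circumpower, hov] at e2
      rw [circumpower, ho] at e1 ⊢
      simp only [power] at e1 e2 ⊢
      linarith
  · push Not at hex
    simp [hex]

end DelaunayCycle

/-- A function on triangles that increases under Lawson flips and is additive on cocircular points
is maximised by Delaunay fillings. -/
theorem IsFilling.sum_mul_le_of_delaunay {ι : Type*} [Fintype ι] {z : ι → ℂ} {B : ι → ι → ℤ}
    {m mD : ι → ι → ι → ℤ} (hz : Function.Injective z)
    (hB : ∀ a b, 0 < B a b → ∀ v, 0 ≤ orient (z a) (z b) (z v))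
    (h : IsFilling z B m) (hD : IsFilling z B mD)
    (hdel : ∀ a b c, mD a b c ≠ 0 → ∀ w, 0 ≤ circumpower (z a) (z b) (z c) (z w))
    {W : ι → ι → ι → ℝ} (hWr : ∀ a b c, W b c a = W a b c) (hWs : ∀ a b c, W b a c = - W a b c)
    (hWc : ∀ a b c v, 0 < orient (z a) (z b) (z c) → circumpower (z a) (z b) (z c) (z v) = 0 →
      W a b c = W a b v + W b c v + W c a v)
    (hWf : ∀ a b c d, 0 < orient (z a) (z b) (z c) → 0 < orient (z b) (z a) (z d) →
      circumpower (z a) (z b) (z c) (z d) < 0 → W a b c + W b a d < W a d c + W d b c) :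
    ∑ a, ∑ b, ∑ c, (m a b c : ℝ) * W a b c ≤ ∑ a, ∑ b, ∑ c, (mD a b c : ℝ) * W a b c := by
  classical
  obtain ⟨m', hm', hmax⟩ := Set.exists_max_image {m | IsFilling z B m}
    (fun m => ∑ a, ∑ b, ∑ c, (m a b c : ℝ) * W a b c) (IsFilling.finite z B) ⟨m, h⟩
  refine (hmax m h).trans (le_of_eq ?_)
  have hm'F : IsFilling z B m' := hm'
  have hloc : ∀ a b c d, m' a b c ≠ 0 → m' b a d ≠ 0 →
      0 ≤ circumpower (z a) (z b) (z c) (z d) := by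
    intro a b c d h1 h2
    by_contra hcon
    push Not at hcon
    have hp1 := hm'F.pos _ _ _ h1
    have hp2 := hm'F.pos _ _ _ h2
    -- A violated edge is a diagonal of a strictly convex quadrilateral, so it can be flipped,
    -- against the maximality of `m'`.
    obtain ⟨e1, e2⟩ := orient_pos_of_power_nonpos hp1 (power_ccenter_snd hp1.ne')
      (power_ccenter_thd hp1.ne') (v := z d) (by rw [orient_swap]; linarith) hcon.le
    have := hmax _ (hm'F.isFilling_flip h1 h2 (by rwa [← orient_rotate (z c)] at e2)
      (by rwa [orient_rotate] at e1))
    rw [IsFilling.sum_flip _ _ _ _ W hWr] at this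
    have := hWf a b c d hp1 hp2 hcon
    linarith
  have hdel' : ∀ a b c, m' a b c ≠ 0 → ∀ w, 0 ≤ circumpower (z a) (z b) (z c) (z w) :=
    fun a b c hm w => hm'F.circumpower_nonneg_of_local hB hloc hm w
  have hsupp : ∀ a b c, (m' a b c : ℝ) - mD a b c ≠ 0 → m' a b c ≠ 0 ∨ mD a b c ≠ 0 := by
    intro a b c hne
    by_contra hcon
    push Not at hcon
    simp [hcon] at hne
  have hzero := sum_mul_eq_zero_of_delaunay_cycle (δ := fun a b c => (m' a b c : ℝ) - mD a b c) hz
    (fun a b c => by simp only [hm'F.rotate, hD.rotate])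
    (fun a b c hne => (hsupp a b c hne).elim (hm'F.pos a b c) (hD.pos a b c))
    (fun a b c hne => (hsupp a b c hne).elim (hdel' a b c) (hdel a b c))
    (fun a b => by
      have e1 := hm'F.boundary a b
      have e2 := hD.boundary a b
      have e3 : ∑ c, m' a b c - ∑ c, mD a b c = ∑ c, m' b a c - ∑ c, mD b a c := by linarith
      simp only [Finset.sum_sub_distrib]
      exact_mod_cast e3) hWs hWc
  simp only [sub_mul, Finset.sum_sub_distrib] at hzero
  linarith

/-! ### The quadratic form of second divided differences -/

/-- The second divided difference at `p, q, r` of a function with values `x, y, w`. -/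
noncomputable def divDiff (p q r x y w : ℂ) : ℂ :=
  x / ((p - q) * (p - r)) + y / ((q - p) * (q - r)) + w / ((r - p) * (r - q))

theorem divDiff_rotate (p q r x y w : ℂ) : divDiff q r p y w x = divDiff p q r x y w := by
  simp only [divDiff]
  ring

theorem divDiff_swap (p q r x y w : ℂ) : divDiff q p r y x w = divDiff p q r x y w := by
  simp only [divDiff]
  ring

/-- This shows that the third divided difference of the cube is 1, which makes the cube the source
of strictness below. -/
theorem divDiff_cube {p q r : ℂ} (h1 : p ≠ q) (h2 : q ≠ r) (h3 : r ≠ p) :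
    divDiff p q r (p ^ 3) (q ^ 3) (r ^ 3) = p + q + r := by
  have e1 := sub_ne_zero.mpr h1
  have e2 := sub_ne_zero.mpr h2
  have e3 := sub_ne_zero.mpr h3
  have e1' := sub_ne_zero.mpr h1.symm
  have e2' := sub_ne_zero.mpr h2.symm
  have e3' := sub_ne_zero.mpr h3.symm
  simp only [divDiff]
  field_simp
  ring

/-- The second divided differences at the triples from four points depend linearly on the omitted
point. -/
theorem exists_divDiff_eq {a b c d : ℂ} (hab : a ≠ b) (hac : a ≠ c) (had : a ≠ d) (hbc : b ≠ c)
    (hbd : b ≠ d) (hcd : c ≠ d) (x y w u : ℂ) :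
    ∃ G k : ℂ, divDiff b c d y w u = G - k * a ∧ divDiff a c d x w u = G - k * b ∧
      divDiff a b d x y u = G - k * c ∧ divDiff a b c x y w = G - k * d := by
  have e1 := sub_ne_zero.mpr hab
  have e2 := sub_ne_zero.mpr hac
  have e3 := sub_ne_zero.mpr had
  have e4 := sub_ne_zero.mpr hbc
  have e5 := sub_ne_zero.mpr hbd
  have e6 := sub_ne_zero.mpr hcd
  have e1' := sub_ne_zero.mpr hab.symm
  have e2' := sub_ne_zero.mpr hac.symm
  have e3' := sub_ne_zero.mpr had.symm
  have e4' := sub_ne_zero.mpr hbc.symm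
  have e5' := sub_ne_zero.mpr hbd.symm
  have e6' := sub_ne_zero.mpr hcd.symm
  -- The third divided difference at `a, b, c, d`.
  let k := x / ((a - b) * (a - c) * (a - d)) + y / ((b - a) * (b - c) * (b - d)) +
    w / ((c - a) * (c - b) * (c - d)) + u / ((d - a) * (d - b) * (d - c))
  refine ⟨divDiff b c d y w u + k * a, k, by ring, ?_, ?_, ?_⟩
  all_goals
    simp only [divDiff, k]
    field_simp
    ring

/-- The alternating orientations annihilate affine functions, so of `|G - k w|²` only `|k|² |w|²`
survives, and it yields the in-circle determinant. -/
theorem orient_normSq_coboundary {a b c d o : ℂ} (G k : ℂ) (hb : power o a b = 0)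
    (hc : power o a c = 0) :
    orient b c d * Complex.normSq (G - k * a) - orient a c d * Complex.normSq (G - k * b) +
        orient a b d * Complex.normSq (G - k * c) - orient a b c * Complex.normSq (G - k * d) =
      - Complex.normSq k * (orient a b c * power o a d) := by
  have h1 : orient a b c * power o a d = -(orient b c d * Complex.normSq a -
      orient a c d * Complex.normSq b + orient a b d * Complex.normSq c -
      orient a b c * Complex.normSq d) := by
    simp only [power, orient, Complex.normSq_apply, Complex.sub_re, Complex.sub_im] at *
    linear_combination
      ((a.re - c.re) * (d.im - c.im) - (a.im - c.im) * (d.re - c.re)) * hb +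
      ((b.re - a.re) * (d.im - a.im) - (b.im - a.im) * (d.re - a.re)) * hc
  rw [h1]
  simp only [orient, Complex.normSq_apply, Complex.sub_re, Complex.sub_im, Complex.mul_re,
    Complex.mul_im]
  ring

/-- The contribution of a triangle to the quadratic form of second divided differences. -/
noncomputable def faceForm {ι : Type*} (z φ : ι → ℂ) (a b c : ι) : ℝ :=
  orient (z a) (z b) (z c) / 2 *
    Complex.normSq (divDiff (z a) (z b) (z c) (φ a) (φ b) (φ c))

section faceForm

variable {ι : Type*} {z : ι → ℂ} (φ : ι → ℂ)

theorem faceForm_rotate (a b c : ι) : faceForm z φ b c a = faceForm z φ a b c := by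
  simp only [faceForm, orient_rotate, divDiff_rotate]

theorem faceForm_swap (a b c : ι) : faceForm z φ b a c = - faceForm z φ a b c := by
  simp only [faceForm, orient_swap (z a), divDiff_swap]
  ring

theorem faceForm_self (a b : ι) : faceForm z φ a a b = 0 := by simp [faceForm]

/-- The coboundary of `faceForm` is a nonnegative multiple of the power of the fourth point. -/
theorem exists_faceForm_coboundary (hz : Function.Injective z) {a b c d : ι}
    (h : 0 < orient (z a) (z b) (z c)) (had : a ≠ d) (hbd : b ≠ d) (hcd : c ≠ d) :
    ∃ k : ℂ, faceForm z φ b c d - faceForm z φ a c d + faceForm z φ a b d - faceForm z φ a b c =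
      - (Complex.normSq k / 2) *
        (orient (z a) (z b) (z c) * circumpower (z a) (z b) (z c) (z d)) ∧
      (φ = (fun i => z i ^ 3) → k = 1) := by
  obtain ⟨hab, hbc, hca⟩ := ne_of_orient_ne_zero h.ne'
  have had' := hz.ne had
  have hbd' := hz.ne hbd
  have hcd' := hz.ne hcd
  obtain ⟨G, k, e1, e2, e3, e4⟩ := exists_divDiff_eq hab hca.symm had' hbc hbd' hcd'
    (φ a) (φ b) (φ c) (φ d)
  refine ⟨k, ?_, ?_⟩
  · have := orient_normSq_coboundary (d := z d) G k (power_ccenter_snd h.ne')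
      (power_ccenter_thd h.ne')
    simp only [faceForm, e1, e2, e3, e4, circumpower]
    linarith
  · intro hφ
    subst hφ
    simp only at e1 e2
    rw [divDiff_cube hbc hcd' hbd'.symm] at e1
    rw [divDiff_cube hca.symm hcd' had'.symm] at e2
    have h3 : (k - 1) * (z a - z b) = 0 := by linear_combination e1 - e2
    have := (mul_eq_zero.mp h3).resolve_right (sub_ne_zero.mpr hab)
    linear_combination this

/-- Delaunay fillings maximise the quadratic form of second divided differences. -/
theorem IsFilling.sum_faceForm_le_of_delaunay [Fintype ι] {B : ι → ι → ℤ}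
    {m mD : ι → ι → ι → ℤ} (hz : Function.Injective z)
    (hB : ∀ a b, 0 < B a b → ∀ v, 0 ≤ orient (z a) (z b) (z v))
    (h : IsFilling z B m) (hD : IsFilling z B mD)
    (hdel : ∀ a b c, mD a b c ≠ 0 → ∀ w, 0 ≤ circumpower (z a) (z b) (z c) (z w)) :
    ∑ a, ∑ b, ∑ c, (m a b c : ℝ) * faceForm z φ a b c ≤
      ∑ a, ∑ b, ∑ c, (mD a b c : ℝ) * faceForm z φ a b c := by
  -- The form of `φ` may be unchanged by a flip; that of the cube strictly increases whenever the
  -- flipped edge violates the Delaunay condition.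
  set ψ : ι → ℂ := fun i => z i ^ 3 with hψ
  have key : ∀ ε > 0, ∑ a, ∑ b, ∑ c, (m a b c : ℝ) * (faceForm z φ a b c + ε * faceForm z ψ a b c)
      ≤ ∑ a, ∑ b, ∑ c, (mD a b c : ℝ) * (faceForm z φ a b c + ε * faceForm z ψ a b c) := by
    intro ε hε
    refine IsFilling.sum_mul_le_of_delaunay hz hB h hD hdel ?_ ?_ ?_ ?_
    · intro a b c; simp only [faceForm_rotate]
    · intro a b c; rw [faceForm_swap φ a b, faceForm_swap ψ a b]; ring
    · have : ∀ φ : ι → ℂ, ∀ a b c v, 0 < orient (z a) (z b) (z c) →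
          circumpower (z a) (z b) (z c) (z v) = 0 →
          faceForm z φ a b c = faceForm z φ a b v + faceForm z φ b c v + faceForm z φ c a v := by
        intro φ a b c v hp hv
        have s1 : ∀ x y, faceForm z φ x y x = 0 := fun x y => by
          rw [faceForm_rotate, faceForm_self]
        have s2 : ∀ x y, faceForm z φ x y y = 0 := fun x y => by
          rw [← faceForm_rotate, ← faceForm_rotate, s1 y x]
        by_cases ha : a = v
        · subst ha; rw [s1, s2, ← faceForm_rotate]; ring
        by_cases hb : b = v
        · subst hb; rw [s1, s2, ← faceForm_rotate φ c a b]; ring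
        by_cases hc : c = v
        · subst hc; rw [s1, s2]; ring
        obtain ⟨k, hk, -⟩ := exists_faceForm_coboundary φ hz hp ha hb hc
        rw [hv, mul_zero, mul_zero] at hk
        rw [faceForm_swap φ a c]
        linarith
      intro a b c v hp hv
      rw [this φ a b c v hp hv, this ψ a b c v hp hv]
      ring
    · intro a b c d hp hp' hd
      have hcd : c ≠ d := by
        rintro rfl; rw [orient_swap] at hp'; linarith
      have hbd : b ≠ d := by rintro rfl; simp at hp'
      have had : a ≠ d := by rintro rfl; simp at hp'
      obtain ⟨k, hk, -⟩ := exists_faceForm_coboundary φ hz hp had hbd hcd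
      obtain ⟨k', hk', hone⟩ := exists_faceForm_coboundary ψ hz hp had hbd hcd
      rw [hone rfl] at hk'
      have hneg : orient (z a) (z b) (z c) * circumpower (z a) (z b) (z c) (z d) < 0 :=
        mul_neg_of_pos_of_neg hp hd
      have t1 : 0 ≤ faceForm z φ b c d - faceForm z φ a c d + faceForm z φ a b d -
          faceForm z φ a b c := by
        rw [hk]
        have := Complex.normSq_nonneg k
        nlinarith
      have t2 : 0 < faceForm z ψ b c d - faceForm z ψ a c d + faceForm z ψ a b d -
          faceForm z ψ a b c := by
        rw [hk', map_one]
        linarith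
      have t3 := mul_pos hε t2
      have f1 : ∀ φ : ι → ℂ, faceForm z φ a d c = - faceForm z φ a c d := fun φ => by
        rw [← faceForm_rotate, faceForm_swap, faceForm_rotate φ a c d |>.symm]
      have f2 : ∀ φ : ι → ℂ, faceForm z φ d b c = faceForm z φ b c d := fun φ => by
        rw [← faceForm_rotate]
      have f3 : ∀ φ : ι → ℂ, faceForm z φ b a d = - faceForm z φ a b d := fun φ =>
        faceForm_swap φ a b d
      simp only [f1, f2, f3]
      linarith
  have hlin : ∀ (m : ι → ι → ι → ℤ) (ε : ℝ),
      ∑ a, ∑ b, ∑ c, (m a b c : ℝ) * (faceForm z φ a b c + ε * faceForm z ψ a b c) =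
      ∑ a, ∑ b, ∑ c, (m a b c : ℝ) * faceForm z φ a b c +
        ε * ∑ a, ∑ b, ∑ c, (m a b c : ℝ) * faceForm z ψ a b c := by
    intro m ε
    simp only [mul_add, Finset.sum_add_distrib, Finset.mul_sum]
    congr 1
    refine Finset.sum_congr rfl fun a _ => Finset.sum_congr rfl fun b _ =>
      Finset.sum_congr rfl fun c _ => ?_
    ring
  simp only [hlin] at key
  generalize (∑ a, ∑ b, ∑ c, (m a b c : ℝ) * faceForm z φ a b c) = X at *
  generalize (∑ a, ∑ b, ∑ c, (m a b c : ℝ) * faceForm z ψ a b c) = Y at *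
  generalize (∑ a, ∑ b, ∑ c, (mD a b c : ℝ) * faceForm z φ a b c) = X' at *
  generalize (∑ a, ∑ b, ∑ c, (mD a b c : ℝ) * faceForm z ψ a b c) = Y' at *
  by_contra hcon
  push Not at hcon
  have hM : 0 < |Y' - Y| + 1 := by positivity
  -- For this `ε` the perturbation is too small to close a gap `X' < X`; the `+ 1` keeps the
  -- denominator positive.
  have h1 := key ((X - X') / (|Y' - Y| + 1)) (div_pos (by linarith) hM)
  have h2 : (X - X') / (|Y' - Y| + 1) * (Y' - Y) < X - X' := by
    rw [div_mul_eq_mul_div, div_lt_iff₀ hM]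
    have := le_abs_self (Y' - Y)
    nlinarith
  linarith

end faceForm

/-! ### Triangulations as fillings -/

theorem orient_combo (a b x y : ℂ) {s t : ℝ} (h : s + t = 1) :
    orient a b (s • x + t • y) = s * orient a b x + t * orient a b y := by
  obtain rfl : s = 1 - t := by linarith
  simp only [orient, Complex.add_re, Complex.add_im, Complex.real_smul, Complex.mul_re,
    Complex.mul_im, Complex.ofReal_re, Complex.ofReal_im]
  ring

theorem convex_orient_nonneg (a b : ℂ) : Convex ℝ {w | 0 ≤ orient a b w} := by
  intro x hx y hy s t hs ht hst
  simp only [Set.mem_ofPred_eq, orient_combo a b x y hst] at *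
  positivity

theorem convex_orient_eq_zero (a b : ℂ) : Convex ℝ {w | orient a b w = 0} := by
  intro x hx y hy s t hs ht hst
  simp only [Set.mem_ofPred_eq, orient_combo a b x y hst] at *
  rw [hx, hy]; ring

/-- Divided by `orient a b c`, the three orientations are the barycentric coordinates of `w`. -/
theorem mem_convexHull_triangle {a b c : ℂ} (h : 0 < orient a b c) (w : ℂ) :
    w ∈ convexHull ℝ {a, b, c} ↔ 0 ≤ orient a b w ∧ 0 ≤ orient b c w ∧ 0 ≤ orient c a w := by
  have h' : 0 < orient b c a := by rwa [orient_rotate]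
  have h'' : 0 < orient c a b := by rwa [orient_rotate]
  constructor
  · intro hw
    refine ⟨?_, ?_, ?_⟩
    · refine convexHull_min ?_ (convex_orient_nonneg a b) hw
      rintro x (rfl | rfl | rfl) <;> simp [h.le]
    · refine convexHull_min ?_ (convex_orient_nonneg b c) hw
      rintro x (rfl | rfl | rfl) <;> simp [h'.le]
    · refine convexHull_min ?_ (convex_orient_nonneg c a) hw
      rintro x (rfl | rfl | rfl) <;> simp [h''.le]
  · rintro ⟨h1, h2, h3⟩
    have hsum := orient_add a b c w
    have hw : w = ∑ i : Fin 3, (![orient b c w / orient a b c, orient c a w / orient a b c,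
        orient a b w / orient a b c] : Fin 3 → ℝ) i • (![a, b, c] : Fin 3 → ℂ) i := by
      simp only [Fin.sum_univ_three, Matrix.cons_val_zero, Matrix.cons_val_one, Matrix.cons_val]
      apply Complex.ext
      · simp only [Complex.add_re, Complex.real_smul, Complex.mul_re, Complex.ofReal_re,
          Complex.ofReal_im, zero_mul, sub_zero]
        field_simp
        simp only [orient]
        ring
      · simp only [Complex.add_im, Complex.real_smul, Complex.mul_im, Complex.ofReal_re,
          Complex.ofReal_im, zero_mul, add_zero]
        field_simp
        simp only [orient]
        ring
    rw [hw]
    refine (convex_convexHull ℝ _).sum_mem ?_ ?_ ?_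
    · intro i _
      fin_cases i
      · exact div_nonneg h2 h.le
      · exact div_nonneg h3 h.le
      · exact div_nonneg h1 h.le
    · simp only [Fin.sum_univ_three, Matrix.cons_val_zero, Matrix.cons_val_one, Matrix.cons_val]
      rw [← add_div, ← add_div, hsum, div_self h.ne']
    · intro i _
      apply subset_convexHull
      fin_cases i <;> simp

namespace PointTriangulation

variable {ι : Type*} {z : ι → ℂ}

/-- A point of the configuration in a face is a vertex of this face. -/
theorem mem_of_mem_convexHull (T : PointTriangulation z) {f : Finset ι} (hf : f ∈ T.faces) {v : ι}
    (hv : z v ∈ convexHull ℝ (z '' (f : Set ι))) : v ∈ f := by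
  obtain ⟨g, hg, hvg⟩ := T.exists_face v
  have h1 : z v ∈ convexHull ℝ (z '' (g : Set ι)) :=
    subset_convexHull ℝ _ (Set.mem_image_of_mem z hvg)
  have h2 : z v ∈ convexHull ℝ (z '' ((f : Set ι) ∩ (g : Set ι))) := by
    rw [← T.inter_face f hf g hg]; exact ⟨hv, h1⟩
  -- By affine independence of `g`, the span of the common vertices contains no further vertex of
  -- `g`.
  refine ((T.affineIndependent_face g hg).mem_affineSpan_iff ⟨v, hvg⟩
    {x : g | (x : ι) ∈ f}).mp (convexHull_subset_affineSpan _ ?_)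
  · convert h2 using 2
    ext x
    constructor
    · rintro ⟨y, hy, rfl⟩
      exact ⟨y, ⟨hy, y.2⟩, rfl⟩
    · rintro ⟨y, ⟨hy1, hy2⟩, rfl⟩
      exact ⟨⟨y, hy2⟩, hy1, rfl⟩

theorem orient_ne_zero_of_affineIndependent {a b c : ℂ} (h : AffineIndependent ℝ ![a, b, c]) :
    orient a b c ≠ 0 := by
  intro h0
  have hab : a ≠ b := fun e => by
    have := h.injective (a₁ := 0) (a₂ := 1) (by simpa using e)
    simp at this
  rw [affineIndependent_iff_not_collinear_set] at h
  apply h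
  rw [collinear_iff_of_mem (p₀ := a) (by simp)]
  refine ⟨b - a, ?_⟩
  have hN := normSq_sub_pos hab
  rintro x (rfl | rfl | rfl)
  · exact ⟨0, by simp⟩
  · exact ⟨1, by simp⟩
  · refine ⟨dotp (b - a) (x - a) / Complex.normSq (b - a), ?_⟩
    simp only [orient] at h0
    apply Complex.ext
    · simp only [vadd_eq_add, Complex.add_re, Complex.real_smul, Complex.mul_re,
        Complex.ofReal_re, Complex.ofReal_im, zero_mul, sub_zero]
      field_simp
      simp only [dotp, Complex.normSq_apply, Complex.sub_re, Complex.sub_im]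
      linear_combination -(b.im - a.im) * h0
    · simp only [vadd_eq_add, Complex.add_im, Complex.real_smul, Complex.mul_im,
        Complex.ofReal_re, Complex.ofReal_im, zero_mul, add_zero]
      field_simp
      simp only [dotp, Complex.normSq_apply, Complex.sub_re, Complex.sub_im]
      linear_combination (b.re - a.re) * h0

variable [DecidableEq ι]

theorem orient_ne_zero (T : PointTriangulation z) {a b c : ι} (h : {a, b, c} ∈ T.faces) :
    orient (z a) (z b) (z c) ≠ 0 := by
  apply orient_ne_zero_of_affineIndependent
  have hcard := T.card_face _ h
  have hab : a ≠ b := by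
    rintro rfl
    have : ({a, a, c} : Finset ι).card ≤ 2 := by
      rw [Finset.insert_idem]; exact Finset.card_le_two
    omega
  have hac : a ≠ c := by
    rintro rfl
    have : ({a, b, a} : Finset ι).card ≤ 2 := by
      rw [Finset.pair_comm, Finset.insert_idem]; exact Finset.card_le_two
    omega
  have hbc : b ≠ c := by
    rintro rfl
    have : ({a, b, b} : Finset ι).card ≤ 2 := by
      rw [Finset.pair_eq_singleton]; exact Finset.card_le_two
    omega
  let e : Fin 3 ↪ ({a, b, c} : Finset ι) :=
    ⟨![⟨a, by simp⟩, ⟨b, by simp⟩, ⟨c, by simp⟩], fun i j hij => by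
      fin_cases i <;> fin_cases j <;>
        simp [Subtype.mk.injEq, hab, hac, hbc, hab.symm, hac.symm, hbc.symm] at hij ⊢⟩
  have := (T.affineIndependent_face _ h).comp_embedding e
  convert this using 1
  ext i
  fin_cases i <;> rfl

theorem exists_orient_pos (T : PointTriangulation z) {f : Finset ι} (hf : f ∈ T.faces) :
    ∃ a b c, f = {a, b, c} ∧ 0 < orient (z a) (z b) (z c) := by
  obtain ⟨a, b, c, -, -, -, rfl⟩ := Finset.card_eq_three.mp (T.card_face f hf)
  rcases (T.orient_ne_zero hf).lt_or_gt with h | h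
  · refine ⟨b, a, c, ?_, by rw [orient_swap]; linarith⟩
    rw [Finset.insert_comm]
  · exact ⟨a, b, c, rfl, h⟩

theorem mem_convexHull_face {a b c : ι} (h : 0 < orient (z a) (z b) (z c)) (w : ℂ) :
    w ∈ convexHull ℝ (z '' (({a, b, c} : Finset ι) : Set ι)) ↔
      0 ≤ orient (z a) (z b) w ∧ 0 ≤ orient (z b) (z c) w ∧ 0 ≤ orient (z c) (z a) w := by
  rw [← mem_convexHull_triangle h]
  simp [Set.image_insert_eq]

/-- The chain of positively oriented faces of a triangulation. -/
noncomputable def faceChain (T : PointTriangulation z) (a b c : ι) : ℤ :=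
  if {a, b, c} ∈ T.faces ∧ 0 < orient (z a) (z b) (z c) then 1 else 0

theorem faceChain_ne_zero {T : PointTriangulation z} {a b c : ι} :
    T.faceChain a b c ≠ 0 ↔ {a, b, c} ∈ T.faces ∧ 0 < orient (z a) (z b) (z c) := by
  simp [faceChain]

theorem faceChain_rotate (T : PointTriangulation z) (a b c : ι) :
    T.faceChain b c a = T.faceChain a b c := by
  simp only [faceChain, orient_rotate]
  rw [show ({b, c, a} : Finset ι) = {a, b, c} by ext; simp; tauto]

theorem faceChain_empty (T : PointTriangulation z) {a b c : ι} (h : T.faceChain a b c ≠ 0) {v : ι}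
    (h1 : 0 ≤ orient (z a) (z b) (z v)) (h2 : 0 ≤ orient (z b) (z c) (z v))
    (h3 : 0 ≤ orient (z c) (z a) (z v)) : v = a ∨ v = b ∨ v = c := by
  obtain ⟨hf, hp⟩ := faceChain_ne_zero.mp h
  simpa using T.mem_of_mem_convexHull hf ((mem_convexHull_face hp _).mpr ⟨h1, h2, h3⟩)

/-- There is at most one face to the left of an edge. -/
theorem faceChain_unique (T : PointTriangulation z) {a b c d : ι} (hc : T.faceChain a b c ≠ 0)
    (hd : T.faceChain a b d ≠ 0) : c = d := by
  obtain ⟨hfc, hpc⟩ := faceChain_ne_zero.mp hc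
  obtain ⟨hfd, hpd⟩ := faceChain_ne_zero.mp hd
  by_contra hcd
  have hda : d ≠ a := by rintro rfl; simp at hpd
  have hdb : d ≠ b := by rintro rfl; simp at hpd
  have hinter : (({a, b, c} : Finset ι) : Set ι) ∩ (({a, b, d} : Finset ι) : Set ι) ⊆ {a, b} := by
    intro x hx
    simp at hx ⊢
    rcases hx with ⟨h1 | h1 | h1, h2 | h2 | h2⟩ <;> simp_all
  -- A short move from the midpoint of the edge towards `c` stays in both faces, but their
  -- intersection would lie on the line `a b`.
  set M : ℂ := (1 / 2 : ℝ) • z a + (1 / 2 : ℝ) • z b with hM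
  have hMo : ∀ p q : ℂ, orient p q M = 1 / 2 * orient p q (z a) + 1 / 2 * orient p q (z b) :=
    fun p q => orient_combo p q _ _ (by norm_num)
  have hpc' : 0 < orient (z b) (z c) (z a) := by rwa [orient_rotate]
  have hpc'' : 0 < orient (z c) (z a) (z b) := by rwa [orient_rotate]
  have hpd' : 0 < orient (z b) (z d) (z a) := by rwa [orient_rotate]
  have hpd'' : 0 < orient (z d) (z a) (z b) := by rwa [orient_rotate]
  have hev : ∀ A X : ℝ, 0 < A →
      ∀ᶠ t in nhdsWithin (0 : ℝ) (Set.Ioi 0), 0 ≤ (1 - t) * A + t * X := by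
    intro A X hA
    have : ContinuousAt (fun t : ℝ => (1 - t) * A + t * X) 0 := by fun_prop
    have h1 : ∀ᶠ t in nhds (0 : ℝ), 0 < (1 - t) * A + t * X :=
      this.eventually (lt_mem_nhds (by simpa using hA))
    filter_upwards [nhdsWithin_le_nhds h1] with t ht using ht.le
  have hlt : ∀ᶠ t in nhdsWithin (0 : ℝ) (Set.Ioi 0), t < 1 :=
    nhdsWithin_le_nhds (gt_mem_nhds zero_lt_one)
  obtain ⟨t, ⟨h1, h2, ht1⟩, ht0⟩ := (((hev _ (orient (z b) (z d) (z c)) (half_pos hpd')).and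
    ((hev _ (orient (z d) (z a) (z c)) (half_pos hpd'')).and hlt)).and self_mem_nhdsWithin).exists
  have ht0' : 0 < t := ht0
  have hX : ∀ p q : ℂ, orient p q ((1 - t) • M + t • z c) =
      (1 - t) * (1 / 2 * orient p q (z a) + 1 / 2 * orient p q (z b)) + t * orient p q (z c) :=
    fun p q => by rw [orient_combo p q _ _ (by ring), hMo]
  have hXc : (1 - t) • M + t • z c ∈
      convexHull ℝ (z '' (({a, b, c} : Finset ι) : Set ι)) := by
    rw [mem_convexHull_face hpc]
    simp only [hX, orient_self_right, orient_self_outer]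
    refine ⟨by nlinarith, by nlinarith, by nlinarith⟩
  have hXd : (1 - t) • M + t • z c ∈
      convexHull ℝ (z '' (({a, b, d} : Finset ι) : Set ι)) := by
    rw [mem_convexHull_face hpd]
    simp only [hX, orient_self_right, orient_self_outer]
    refine ⟨by nlinarith, by linarith, by linarith⟩
  have hXi : (1 - t) • M + t • z c ∈ convexHull ℝ (z '' ({a, b} : Set ι)) := by
    refine convexHull_mono (Set.image_mono hinter) ?_
    rw [← T.inter_face _ hfc _ hfd]
    exact ⟨hXc, hXd⟩
  have h0 : orient (z a) (z b) ((1 - t) • M + t • z c) = 0 := by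
    refine convexHull_min ?_ (convex_orient_eq_zero (z a) (z b)) hXi
    rintro x ⟨y, (rfl | rfl), rfl⟩ <;> simp
  rw [hX] at h0
  simp only [orient_self_right, orient_self_outer] at h0
  nlinarith [mul_pos ht0' hpc]

/-- A face with vertices `a` and `b`. -/
theorem exists_eq_of_mem_of_mem (T : PointTriangulation z) {g : Finset ι} (hg : g ∈ T.faces)
    {a b : ι} (hab : a ≠ b) (ha : a ∈ g) (hb : b ∈ g) : ∃ d, g = {a, b, d} := by
  have hsub : ({a, b} : Finset ι) ⊆ g := by
    intro x hx
    simp at hx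
    rcases hx with rfl | rfl <;> assumption
  have hcard : (g \ {a, b}).card = 1 := by
    rw [Finset.card_sdiff_of_subset hsub, T.card_face g hg, Finset.card_pair hab]
  obtain ⟨d, hd⟩ := Finset.card_eq_one.mp hcard
  refine ⟨d, ?_⟩
  rw [← Finset.union_sdiff_of_subset hsub, hd]
  ext x
  simp

/-- Beyond an edge of a face there is another face, if there is a point of the configuration. -/
theorem exists_faceChain_swap (T : PointTriangulation z) {a b c w : ι} (hc : T.faceChain a b c ≠ 0)
    (hw : orient (z a) (z b) (z w) < 0) : ∃ d, T.faceChain b a d ≠ 0 := by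
  obtain ⟨hfc, hpc⟩ := faceChain_ne_zero.mp hc
  have hpc' : 0 < orient (z b) (z c) (z a) := by rwa [orient_rotate]
  have hpc'' : 0 < orient (z c) (z a) (z b) := by rwa [orient_rotate]
  set M : ℂ := (1 / 2 : ℝ) • z a + (1 / 2 : ℝ) • z b with hM
  have hMo : ∀ p q : ℂ, orient p q M = 1 / 2 * orient p q (z a) + 1 / 2 * orient p q (z b) :=
    fun p q => orient_combo p q _ _ (by norm_num)
  have hMc : M ∈ convexHull ℝ (z '' (({a, b, c} : Finset ι) : Set ι)) := by
    rw [mem_convexHull_face hpc]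
    simp only [hMo, orient_self_right, orient_self_outer]
    refine ⟨by linarith, by linarith, by linarith⟩
  -- The faces are finitely many closed sets, so near `M` only faces containing `M` are met.
  have hev : ∀ᶠ t in nhdsWithin (0 : ℝ) (Set.Ioi 0), ∀ g ∈ T.faces,
      (1 - t) • M + t • z w ∈ convexHull ℝ (z '' (g : Set ι)) →
        M ∈ convexHull ℝ (z '' (g : Set ι)) := by
    rw [Filter.eventually_all_finset]
    intro g _
    by_cases hMg : M ∈ convexHull ℝ (z '' (g : Set ι))
    · exact Filter.Eventually.of_forall fun _ _ => hMg
    · have hcl : IsClosed (convexHull ℝ (z '' (g : Set ι))) :=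
        ((g.finite_toSet.image z).isCompact_convexHull ℝ).isClosed
      have hcont : ContinuousAt (fun t : ℝ => (1 - t) • M + t • z w) 0 := by fun_prop
      have : ∀ᶠ t in nhds (0 : ℝ),
          (1 - t) • M + t • z w ∈ (convexHull ℝ (z '' (g : Set ι)))ᶜ :=
        hcont.eventually (hcl.isOpen_compl.mem_nhds (by simpa using hMg))
      filter_upwards [nhdsWithin_le_nhds this] with t ht h using absurd h ht
  have hlt : ∀ᶠ t in nhdsWithin (0 : ℝ) (Set.Ioi 0), t < 1 :=
    nhdsWithin_le_nhds (gt_mem_nhds zero_lt_one)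
  obtain ⟨t, ⟨h1, ht1⟩, ht0⟩ := ((hev.and hlt).and self_mem_nhdsWithin).exists
  have ht0' : 0 < t := ht0
  have hX : ∀ p q : ℂ, orient p q ((1 - t) • M + t • z w) =
      (1 - t) * (1 / 2 * orient p q (z a) + 1 / 2 * orient p q (z b)) + t * orient p q (z w) :=
    fun p q => by rw [orient_combo p q _ _ (by ring), hMo]
  have hhull : (1 - t) • M + t • z w ∈ convexHull ℝ (Set.range z) := by
    have hsub : ∀ v, z v ∈ convexHull ℝ (Set.range z) := fun v =>
      subset_convexHull ℝ _ (Set.mem_range_self v)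
    have hcv := convex_convexHull ℝ (Set.range z)
    exact hcv (hcv (hsub a) (hsub b) (by norm_num) (by norm_num) (by norm_num)) (hsub w)
      (by linarith) ht0'.le (by ring)
  rw [← T.iUnion_face] at hhull
  simp only [Set.mem_iUnion] at hhull
  obtain ⟨g, hg, hxg⟩ := hhull
  have hMg := h1 g hg hxg
  have hMi : M ∈ convexHull ℝ (z '' ((({a, b, c} : Finset ι) : Set ι) ∩ (g : Set ι))) := by
    rw [← T.inter_face _ hfc _ hg]; exact ⟨hMc, hMg⟩
  -- `M` is in the hull of the common vertices. Without `a` these would all lie on the line `b c`,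
  -- which misses `M`; similarly for `b`.
  have hag : a ∈ g := by
    by_contra hcon
    have h0 : orient (z b) (z c) M = 0 := by
      refine convexHull_min ?_ (convex_orient_eq_zero (z b) (z c)) hMi
      rintro x ⟨y, ⟨hy, hyg⟩, rfl⟩
      simp at hy
      rcases hy with rfl | rfl | rfl
      · exact absurd hyg hcon
      · simp
      · simp
    rw [hMo, orient_self_outer] at h0
    linarith
  have hbg : b ∈ g := by
    by_contra hcon
    have h0 : orient (z c) (z a) M = 0 := by
      refine convexHull_min ?_ (convex_orient_eq_zero (z c) (z a)) hMi
      rintro x ⟨y, ⟨hy, hyg⟩, rfl⟩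
      simp at hy
      rcases hy with rfl | rfl | rfl
      · simp
      · exact absurd hyg hcon
      · simp
    rw [hMo, orient_self_right] at h0
    linarith
  have hab : a ≠ b := by rintro rfl; simp at hpc
  obtain ⟨d, rfl⟩ := T.exists_eq_of_mem_of_mem hg hab hag hbg
  refine ⟨d, faceChain_ne_zero.mpr ⟨by rwa [Finset.insert_comm], ?_⟩⟩
  by_contra hcon
  rw [orient_swap] at hcon
  have h0 : 0 ≤ orient (z a) (z b) ((1 - t) • M + t • z w) := by
    refine convexHull_min ?_ (convex_orient_nonneg (z a) (z b)) hxg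
    rintro x ⟨y, hy, rfl⟩
    simp at hy
    rcases hy with rfl | rfl | rfl
    · simp
    · simp
    · simp only [Set.mem_ofPred_eq]; linarith
  rw [hX] at h0
  simp only [orient_self_right, orient_self_outer] at h0
  nlinarith [mul_neg_of_pos_of_neg ht0' hw]

theorem dotp_combo (e x y : ℂ) (s t : ℝ) :
    dotp e (s • x + t • y) = s * dotp e x + t * dotp e y := by
  simp only [dotp, Complex.add_re, Complex.add_im, Complex.real_smul, Complex.mul_re,
    Complex.mul_im, Complex.ofReal_re, Complex.ofReal_im]
  ring

theorem eq_of_orient_eq_of_dotp_eq {a b x y : ℂ} (hab : a ≠ b) (h : orient a b x = orient a b y)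
    (h' : dotp (b - a) x = dotp (b - a) y) : x = y := by
  have hN := (normSq_sub_pos hab).ne'
  simp only [orient, dotp, Complex.normSq_apply, Complex.sub_re, Complex.sub_im] at *
  apply Complex.ext
  · apply mul_left_cancel₀ hN
    linear_combination (b.re - a.re) * h' - (b.im - a.im) * h
  · apply mul_left_cancel₀ hN
    linear_combination (b.im - a.im) * h' + (b.re - a.re) * h

/-- The open left half-plane of the line `a b` with a half-line of its boundary is convex. -/
theorem convex_orient_pos_or (a b e : ℂ) (k : ℝ) :
    Convex ℝ {w | 0 < orient a b w ∨ (orient a b w = 0 ∧ k ≤ dotp e w)} := by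
  intro x hx y hy s t hs ht hst
  simp only [Set.mem_ofPred_eq, orient_combo a b x y hst] at *
  rw [dotp_combo]
  obtain rfl : s = 1 - t := by linarith
  rcases hs.eq_or_lt with h0 | h0
  · have : t = 1 := by linarith
    subst this
    simpa using hy
  rcases ht.eq_or_lt with h1 | h1
  · subst h1
    simpa using hx
  rcases hx with hx | ⟨hx, hx'⟩ <;> rcases hy with hy | ⟨hy, hy'⟩
  · left; positivity
  · left; rw [hy]; nlinarith
  · left; rw [hx]; nlinarith
  · right; rw [hx, hy]; exact ⟨by ring, by nlinarith⟩

theorem mem_segment_of_orient_eq_zero {a b x p q : ℂ} (hab : a ≠ b) (hx : orient a b x = 0)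
    (hp : orient a b p = 0) (hq : orient a b q = 0) (h1 : dotp (b - a) p ≤ dotp (b - a) x)
    (h2 : dotp (b - a) x ≤ dotp (b - a) q) (h3 : dotp (b - a) p < dotp (b - a) q) :
    x ∈ segment ℝ p q := by
  have hD : 0 < dotp (b - a) q - dotp (b - a) p := by linarith
  have hsum : (dotp (b - a) q - dotp (b - a) x) / (dotp (b - a) q - dotp (b - a) p) +
      (dotp (b - a) x - dotp (b - a) p) / (dotp (b - a) q - dotp (b - a) p) = 1 := by
    rw [← add_div, div_eq_one_iff_eq hD.ne']; ring
  refine ⟨(dotp (b - a) q - dotp (b - a) x) / (dotp (b - a) q - dotp (b - a) p),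
    (dotp (b - a) x - dotp (b - a) p) / (dotp (b - a) q - dotp (b - a) p),
    div_nonneg (by linarith) hD.le, div_nonneg (by linarith) hD.le, hsum,
    eq_of_orient_eq_of_dotp_eq hab ?_ ?_⟩
  · rw [orient_combo a b p q hsum, hp, hq, hx]; ring
  · rw [dotp_combo]
    field_simp
    ring

/-- The left face of a hull edge belongs to every triangulation. -/
theorem exists_faceChain_of_hull_edge (T T' : PointTriangulation z) {a b c : ι}
    (hc : T.faceChain a b c ≠ 0) (hleft : ∀ v, 0 ≤ orient (z a) (z b) (z v)) :
    ∃ d, T'.faceChain a b d ≠ 0 := by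
  obtain ⟨hfc, hpc⟩ := faceChain_ne_zero.mp hc
  have hab' : z a ≠ z b := (ne_of_orient_ne_zero hpc.ne').1
  have hab : a ≠ b := fun e => hab' (by rw [e])
  have hN := normSq_sub_pos hab'
  have hs : dotp (z b - z a) (z a) < dotp (z b - z a) (z b) := by
    simp only [dotp, Complex.normSq_apply, Complex.sub_re, Complex.sub_im] at *
    linarith
  set M : ℂ := (1 / 2 : ℝ) • z a + (1 / 2 : ℝ) • z b with hM
  have hMo : orient (z a) (z b) M = 0 := by
    rw [hM, orient_combo _ _ _ _ (by norm_num)]; simp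
  have hMd : ∀ e, dotp e M = 1 / 2 * dotp e (z a) + 1 / 2 * dotp e (z b) := fun e =>
    dotp_combo e _ _ _ _
  -- The open edge contains no point of the configuration, since such a point would be a vertex of
  -- the face `a b c` of `T`.
  have hnot : ∀ v, orient (z a) (z b) (z v) = 0 →
      dotp (z b - z a) (z v) ≤ dotp (z b - z a) (z a) ∨
        dotp (z b - z a) (z b) ≤ dotp (z b - z a) (z v) := by
    intro v hv
    by_contra hcon
    push Not at hcon
    have hmem := mem_segment_of_orient_eq_zero hab' hv (orient_self_outer _ _)
      (orient_self_right _ _) hcon.1.le hcon.2.le hs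
    have hin : z v ∈ convexHull ℝ (z '' (({a, b, c} : Finset ι) : Set ι)) :=
      segment_subset_convexHull (Set.mem_image_of_mem z (by simp))
        (Set.mem_image_of_mem z (by simp)) hmem
    have hv3 := T.mem_of_mem_convexHull hfc hin
    simp at hv3
    rcases hv3 with rfl | rfl | rfl
    · exact lt_irrefl _ hcon.1
    · exact lt_irrefl _ hcon.2
    · exact hpc.ne' hv
  have hhull : M ∈ convexHull ℝ (Set.range z) :=
    convex_convexHull ℝ _ (subset_convexHull ℝ _ (Set.mem_range_self a))
      (subset_convexHull ℝ _ (Set.mem_range_self b)) (by norm_num) (by norm_num) (by norm_num)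
  rw [← T'.iUnion_face] at hhull
  simp only [Set.mem_iUnion] at hhull
  obtain ⟨g, hg, hMg⟩ := hhull
  -- Otherwise all vertices of `g` would lie in the open half-plane or on the boundary ray from `a`
  -- away from `b`, a convex set missing `M`.
  obtain ⟨q, hqg, hqo, hqd⟩ : ∃ q ∈ g, orient (z a) (z b) (z q) = 0 ∧
      dotp (z b - z a) (z b) ≤ dotp (z b - z a) (z q) := by
    by_contra hcon
    push Not at hcon
    have : M ∈ {w | 0 < orient (z a) (z b) w ∨ (orient (z a) (z b) w = 0 ∧
        dotp (z a - z b) (z a) ≤ dotp (z a - z b) w)} := by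
      refine convexHull_min ?_ (convex_orient_pos_or _ _ _ _) hMg
      rintro x ⟨v, hv, rfl⟩
      rcases (hleft v).eq_or_lt with h0 | h0
      · refine Or.inr ⟨h0.symm, ?_⟩
        have h1 := (hnot v h0.symm).resolve_right (not_le.mpr (hcon v hv h0.symm))
        simp only [dotp, Complex.sub_re, Complex.sub_im] at h1 ⊢
        linarith
      · exact Or.inl h0
    rcases this with h0 | ⟨-, h0⟩
    · exact h0.ne' hMo
    · rw [hMd] at h0
      simp only [dotp, Complex.sub_re, Complex.sub_im] at h0 hs
      linarith
  obtain ⟨p, hpg, hpo, hpd⟩ : ∃ p ∈ g, orient (z a) (z b) (z p) = 0 ∧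
      dotp (z b - z a) (z p) ≤ dotp (z b - z a) (z a) := by
    by_contra hcon
    push Not at hcon
    have : M ∈ {w | 0 < orient (z a) (z b) w ∨ (orient (z a) (z b) w = 0 ∧
        dotp (z b - z a) (z b) ≤ dotp (z b - z a) w)} := by
      refine convexHull_min ?_ (convex_orient_pos_or _ _ _ _) hMg
      rintro x ⟨v, hv, rfl⟩
      rcases (hleft v).eq_or_lt with h0 | h0
      · exact Or.inr ⟨h0.symm, (hnot v h0.symm).resolve_left (not_le.mpr (hcon v hv h0.symm))⟩
      · exact Or.inl h0
    rcases this with h0 | ⟨-, h0⟩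
    · exact h0.ne' hMo
    · rw [hMd] at h0
      linarith
  -- Both `a` and `b` lie between `p` and `q`, hence in the face `g`, and so are vertices of it.
  have hag : a ∈ g := T'.mem_of_mem_convexHull hg
    (segment_subset_convexHull (Set.mem_image_of_mem z hpg) (Set.mem_image_of_mem z hqg)
      (mem_segment_of_orient_eq_zero hab' (orient_self_outer _ _) hpo hqo hpd (by linarith)
        (by linarith)))
  have hbg : b ∈ g := T'.mem_of_mem_convexHull hg
    (segment_subset_convexHull (Set.mem_image_of_mem z hpg) (Set.mem_image_of_mem z hqg)
      (mem_segment_of_orient_eq_zero hab' (orient_self_right _ _) hpo hqo (by linarith) hqd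
        (by linarith)))
  obtain ⟨d, rfl⟩ := T'.exists_eq_of_mem_of_mem hg hab hag hbg
  exact ⟨d, faceChain_ne_zero.mpr ⟨hg, lt_of_le_of_ne (hleft d) (T'.orient_ne_zero hg).symm⟩⟩

/-- With points strictly on both sides, a face on one side forces a face on the other, so the edge
does not contribute to the boundary. -/
theorem exists_faceChain_comm (T : PointTriangulation z) {a b : ι}
    (h1 : ¬ ∀ v, 0 ≤ orient (z a) (z b) (z v)) (h2 : ¬ ∀ v, 0 ≤ orient (z b) (z a) (z v)) :
    (∃ c, T.faceChain a b c ≠ 0) ↔ ∃ c, T.faceChain b a c ≠ 0 := by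
  push Not at h1 h2
  obtain ⟨v, hv⟩ := h1
  obtain ⟨w, hw⟩ := h2
  exact ⟨fun ⟨c, hc⟩ => T.exists_faceChain_swap hc hv, fun ⟨c, hc⟩ => T.exists_faceChain_swap hc hw⟩

theorem faceChain_eq_zero_of_left (T : PointTriangulation z) {a b : ι}
    (h : ∀ v, 0 ≤ orient (z a) (z b) (z v)) : ¬ ∃ c, T.faceChain b a c ≠ 0 := by
  rintro ⟨c, hc⟩
  have h1 := (faceChain_ne_zero.mp hc).2
  rw [orient_swap] at h1
  linarith [h c]

theorem IsDelaunay.circumpower_nonneg {T : PointTriangulation z} (hT : T.IsDelaunay) {a b c : ι}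
    (h : T.faceChain a b c ≠ 0) (w : ι) : 0 ≤ circumpower (z a) (z b) (z c) (z w) := by
  obtain ⟨hf, hp⟩ := faceChain_ne_zero.mp h
  have hb := power_ccenter_snd hp.ne'
  have hc := power_ccenter_thd hp.ne'
  have hd : ∀ x y : ℂ, Complex.normSq (x - y) = dist x y ^ 2 := fun x y => by
    rw [Complex.dist_eq, Complex.sq_norm]
  have := hT _ hf (ccenter (z a) (z b) (z c)) (dist (z a) (ccenter (z a) (z b) (z c))) (by
    intro v hv
    simp at hv
    simp only [power, hd, sub_eq_zero] at hb hc
    rw [sq_eq_sq₀ dist_nonneg dist_nonneg] at hb hc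
    rcases hv with rfl | rfl | rfl
    · rfl
    · exact hb
    · exact hc) w
  rw [circumpower, power, hd, hd, sub_nonneg]
  exact pow_le_pow_left₀ dist_nonneg this 2

variable [Fintype ι]

theorem sum_faceChain (T : PointTriangulation z) (a b : ι) [Decidable (∃ c, T.faceChain a b c ≠ 0)] :
    ∑ c, T.faceChain a b c = if ∃ c, T.faceChain a b c ≠ 0 then 1 else 0 := by
  split_ifs with h
  · obtain ⟨c, hc⟩ := h
    rw [Finset.sum_eq_single c]
    · have := faceChain_ne_zero.mp hc
      rw [faceChain, if_pos this]
    · intro d _ hd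
      by_contra hne
      exact hd (T.faceChain_unique hne hc)
    · simp
  · push Not at h
    simp [h]

/-- All triangulations of a configuration have the same boundary. -/
theorem boundary_faceChain_eq (T T' : PointTriangulation z) (a b : ι) :
    ∑ c, T.faceChain a b c - ∑ c, T.faceChain b a c =
      ∑ c, T'.faceChain a b c - ∑ c, T'.faceChain b a c := by
  classical
  simp only [sum_faceChain]
  by_cases h1 : ∀ v, 0 ≤ orient (z a) (z b) (z v)
  · rw [if_neg (T.faceChain_eq_zero_of_left h1), if_neg (T'.faceChain_eq_zero_of_left h1)]
    have : (∃ c, T.faceChain a b c ≠ 0) ↔ ∃ c, T'.faceChain a b c ≠ 0 :=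
      ⟨fun ⟨c, hc⟩ => T.exists_faceChain_of_hull_edge T' hc h1,
        fun ⟨c, hc⟩ => T'.exists_faceChain_of_hull_edge T hc h1⟩
    simp only [this]
  by_cases h2 : ∀ v, 0 ≤ orient (z b) (z a) (z v)
  · rw [if_neg (T.faceChain_eq_zero_of_left h2), if_neg (T'.faceChain_eq_zero_of_left h2)]
    have : (∃ c, T.faceChain b a c ≠ 0) ↔ ∃ c, T'.faceChain b a c ≠ 0 :=
      ⟨fun ⟨c, hc⟩ => T.exists_faceChain_of_hull_edge T' hc h2,
        fun ⟨c, hc⟩ => T'.exists_faceChain_of_hull_edge T hc h2⟩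
    simp only [this]
  simp only [T.exists_faceChain_comm h1 h2, T'.exists_faceChain_comm h1 h2, sub_self]

/-- A point strictly to the right would force a face across the edge, cancelling the one on the
left. -/
theorem left_of_boundary_pos (T : PointTriangulation z) {a b : ι}
    (h : 0 < ∑ c, T.faceChain a b c - ∑ c, T.faceChain b a c) (v : ι) :
    0 ≤ orient (z a) (z b) (z v) := by
  classical
  by_contra hcon
  push Not at hcon
  simp only [sum_faceChain] at h
  by_cases h1 : ∃ c, T.faceChain a b c ≠ 0
  · obtain ⟨c, hc⟩ := h1
    rw [if_pos (T.exists_faceChain_swap hc hcon)] at h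
    split_ifs at h <;> omega
  · rw [if_neg h1] at h
    split_ifs at h <;> omega

/-- Taking the boundary from `T'` makes two triangulations fillings of literally the same boundary.
-/
theorem isFilling_faceChain (T T' : PointTriangulation z) :
    IsFilling z (fun a b => ∑ c, T'.faceChain a b c - ∑ c, T'.faceChain b a c) T.faceChain where
  nonneg a b c := by unfold faceChain; positivity
  rotate := T.faceChain_rotate
  pos a b c h := (faceChain_ne_zero.mp h).2
  empty a b c h v := T.faceChain_empty h
  boundary := T.boundary_faceChain_eq T'

/-- Summation over the chain of a triangulation is three times summation over its faces. -/
theorem sum_faceChain_mul (T : PointTriangulation z) {W : ι → ι → ι → ℝ}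
    (hW : ∀ a b c, W b c a = W a b c) {F : Finset ι → ℝ}
    (hF : ∀ a b c, {a, b, c} ∈ T.faces → 0 < orient (z a) (z b) (z c) → F {a, b, c} = W a b c) :
    ∑ a, ∑ b, ∑ c, (T.faceChain a b c : ℝ) * W a b c = 3 * ∑ f ∈ T.faces, F f := by
  have h1 : ∀ a b c, (T.faceChain a b c : ℝ) * W a b c =
      ∑ f ∈ T.faces, (if f = {a, b, c} ∧ 0 < orient (z a) (z b) (z c) then 1 else 0) * W a b c := by
    intro a b c
    rw [← Finset.sum_mul]
    congr 1
    unfold faceChain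
    by_cases hp : 0 < orient (z a) (z b) (z c)
    · simp [hp]
    · simp [hp]
  simp only [h1]
  have h2 : ∑ a, ∑ b, ∑ c, ∑ f ∈ T.faces,
      (if f = {a, b, c} ∧ 0 < orient (z a) (z b) (z c) then 1 else 0) * W a b c =
      ∑ f ∈ T.faces, ∑ a, ∑ b, ∑ c,
        (if f = {a, b, c} ∧ 0 < orient (z a) (z b) (z c) then 1 else 0) * W a b c := by
    symm
    rw [Finset.sum_comm]
    refine Finset.sum_congr rfl fun a _ => ?_
    rw [Finset.sum_comm]
    refine Finset.sum_congr rfl fun b _ => ?_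
    rw [Finset.sum_comm]
  rw [h2, Finset.mul_sum]
  refine Finset.sum_congr rfl fun f hf => ?_
  obtain ⟨p, q, r, rfl, hp⟩ := T.exists_orient_pos hf
  rw [hF p q r hf hp, ← sum_triangleChain_mul p q r W hW]
  refine Finset.sum_congr rfl fun a _ => Finset.sum_congr rfl fun b _ =>
    Finset.sum_congr rfl fun c _ => ?_
  congr 1
  obtain ⟨hpq, hqr, hrp⟩ := ne_of_orient_ne_zero hp.ne'
  have hpq : p ≠ q := fun e => hpq (by rw [e])
  have hqr : q ≠ r := fun e => hqr (by rw [e])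
  have hrp : r ≠ p := fun e => hrp (by rw [e])
  by_cases h0 : triangleChain p q r a b c = 0
  · rw [h0, Int.cast_zero, if_neg]
    rintro ⟨heq, hpos⟩
    obtain ⟨hab, hbc, hca⟩ := ne_of_orient_ne_zero hpos.ne'
    have ha : a ∈ ({p, q, r} : Finset ι) := heq ▸ by simp
    have hb : b ∈ ({p, q, r} : Finset ι) := heq ▸ by simp
    have hc : c ∈ ({p, q, r} : Finset ι) := heq ▸ by simp
    have o1 : orient (z q) (z p) (z r) = - orient (z p) (z q) (z r) := orient_swap _ _ _
    have o2 : orient (z p) (z r) (z q) = - orient (z p) (z q) (z r) := by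
      simp only [orient]; ring
    have o3 : orient (z r) (z q) (z p) = - orient (z p) (z q) (z r) := by
      simp only [orient]; ring
    simp only [Finset.mem_insert, Finset.mem_singleton] at ha hb hc
    rcases ha with rfl | rfl | rfl <;> rcases hb with rfl | rfl | rfl <;>
      rcases hc with rfl | rfl | rfl <;>
      first
      | exact absurd rfl hab
      | exact absurd rfl hbc
      | exact absurd rfl hca
      | linarith
      | simp [triangleChain, hpq, hqr, hrp, hpq.symm, hqr.symm, hrp.symm] at h0
  · rcases triangleChain_ne_zero h0 with ⟨rfl, rfl, rfl⟩ | ⟨rfl, rfl, rfl⟩ | ⟨rfl, rfl, rfl⟩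
    · rw [if_pos ⟨rfl, hp⟩]
      simp [triangleChain, hpq, hqr, hrp, hpq.symm, hqr.symm, hrp.symm]
    · rw [if_pos ⟨by ext; simp; tauto, by rwa [orient_rotate]⟩]
      simp [triangleChain, hpq, hqr, hrp, hpq.symm, hqr.symm, hrp.symm]
    · rw [if_pos ⟨by ext; simp; tauto, by rwa [← orient_rotate]⟩]
      simp [triangleChain, hpq, hqr, hrp, hpq.symm, hqr.symm, hrp.symm]

end PointTriangulation

/-! ### The volume of an ideal tetrahedron -/


/-- The integral of `dh / h ^ 3` over the heights above a point of power `p`. -/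
noncomputable def fibreVolume (p : ℝ) : ℝ≥0∞ :=
  ∫⁻ h, {h : ℝ | 0 < h ∧ 0 ≤ p + h ^ 2}.indicator (fun h => ENNReal.ofReal (1 / h ^ 3)) h

/-- A larger power enlarges the set of heights, and monotone functions are measurable. -/
theorem measurable_fibreVolume : Measurable fibreVolume := by
  refine Monotone.measurable fun p q hpq => ?_
  refine lintegral_mono fun h => ?_
  refine Set.indicator_le_indicator_of_subset (fun x hx => ?_) (fun _ => zero_le) h
  exact ⟨hx.1, by linarith [hx.2]⟩

/-- Over a point inside the circle the heights start at `√(-p)`. -/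
theorem fibreVolume_of_neg {p : ℝ} (hp : p < 0) :
    fibreVolume p = ENNReal.ofReal (1 / (2 * -p)) := by
  have hs : 0 < Real.sqrt (-p) := Real.sqrt_pos.mpr (by linarith)
  have hset : {h : ℝ | 0 < h ∧ 0 ≤ p + h ^ 2} = Set.Ici (Real.sqrt (-p)) := by
    ext h
    simp only [Set.mem_ofPred_eq, Set.mem_Ici]
    constructor
    · rintro ⟨h1, h2⟩
      exact Real.sqrt_le_iff.mpr ⟨h1.le, by linarith⟩
    · intro h1
      have h0 := hs.trans_le h1
      have := (Real.sqrt_le_left h0.le).mp h1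
      exact ⟨h0, by linarith⟩
  have hcongr : ∀ h ∈ Set.Ioi (Real.sqrt (-p)), (h : ℝ) ^ (-3 : ℝ) = 1 / h ^ 3 := by
    intro h hh
    have : 0 < h := hs.trans hh
    rw [Real.rpow_neg this.le, one_div]
    norm_cast
  have hint : IntegrableOn (fun h : ℝ => 1 / h ^ 3) (Set.Ioi (Real.sqrt (-p))) :=
    (integrableOn_Ioi_rpow_of_lt (by norm_num) hs).congr_fun hcongr measurableSet_Ioi
  rw [fibreVolume, hset, lintegral_indicator measurableSet_Ici, ← restrict_Ioi_eq_restrict_Ici,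
    ← ofReal_integral_eq_lintegral_ofReal hint]
  · congr 1
    rw [← setIntegral_congr_fun measurableSet_Ioi hcongr,
      integral_Ioi_rpow_of_lt (by norm_num) hs]
    have h2 : Real.sqrt (-p) ^ (-3 + 1 : ℝ) = 1 / (-p) := by
      rw [show (-3 + 1 : ℝ) = -(2 : ℕ) by norm_num, Real.rpow_neg hs.le, Real.rpow_natCast,
        Real.sq_sqrt (by linarith), one_div]
    rw [h2]
    have : p ≠ 0 := hp.ne
    field_simp
    norm_num
  · filter_upwards [ae_restrict_mem measurableSet_Ioi] with h hh
    have : 0 < h := hs.trans hh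
    simp only [Pi.zero_apply]
    positivity

theorem continuous_power (o a : ℂ) : Continuous (power o a) := by
  unfold power
  fun_prop

/-- A nondegenerate triangle has only one circumcircle, so the quantifier over circles reduces to a
single condition. -/
theorem mem_idealTetrahedron {a b c : ℂ} (h : 0 < orient a b c) (p : ℂ × ℝ) :
    p ∈ idealTetrahedron {a, b, c} ↔ p.1 ∈ convexHull ℝ {a, b, c} ∧
      (0 < p.2 ∧ 0 ≤ power (ccenter a b c) a p.1 + p.2 ^ 2) := by
  have hb := power_ccenter_snd h.ne'
  have hc := power_ccenter_thd h.ne'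
  have hd : ∀ x y : ℂ, Complex.normSq (x - y) = dist x y ^ 2 := fun x y => by
    rw [Complex.dist_eq, Complex.sq_norm]
  refine and_congr_right fun _ => and_congr_right fun _ => ⟨fun H => ?_, fun H o R hR => ?_⟩
  · have := H (ccenter a b c) (dist a (ccenter a b c)) (by
      simp only [power, hd, sub_eq_zero] at hb hc
      rw [sq_eq_sq₀ dist_nonneg dist_nonneg] at hb hc
      rintro x (rfl | rfl | rfl)
      · rfl
      · exact hb
      · exact hc)
    simp only [power, hd]
    linarith
  · have ha' := hR a (by simp)
    have ho : o = ccenter a b c := by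
      refine eq_ccenter h.ne' ?_ ?_
      · rw [power, hd, hd, hR b (by simp), ha', sub_self]
      · rw [power, hd, hd, hR c (by simp), ha', sub_self]
    subst ho
    simp only [power, hd, ha'] at H
    linarith

theorem idealVolume_eq_lintegral {a b c : ℂ} (h : 0 < orient a b c) :
    idealVolume {a, b, c} = (∫⁻ w, (convexHull ℝ {a, b, c}).indicator
      (fun w => fibreVolume (power (ccenter a b c) a w)) w).toReal := by
  have hconv : MeasurableSet (convexHull ℝ ({a, b, c} : Set ℂ)) :=
    ((Set.toFinite _).isCompact_convexHull ℝ).isClosed.measurableSet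
  have hpow := (continuous_power (ccenter a b c) a).measurable
  have hset : MeasurableSet (idealTetrahedron {a, b, c}) := by
    have : idealTetrahedron {a, b, c} = Prod.fst ⁻¹' convexHull ℝ {a, b, c} ∩
        ({p : ℂ × ℝ | 0 < p.2} ∩ {p : ℂ × ℝ | 0 ≤ power (ccenter a b c) a p.1 + p.2 ^ 2}) :=
      Set.ext fun p => mem_idealTetrahedron h p
    rw [this]
    refine (measurable_fst hconv).inter ((measurableSet_lt measurable_const measurable_snd).inter
      (measurableSet_le measurable_const ?_))
    exact (hpow.comp measurable_fst).add (measurable_snd.pow_const 2)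
  have hdens : Measurable fun p : ℂ × ℝ => ENNReal.ofReal (1 / p.2 ^ 3) := by fun_prop
  rw [idealVolume, Measure.real, hyperbolicVolume, withDensity_apply _ hset,
    Measure.restrict_restrict hset]
  congr 1
  have hinter : idealTetrahedron {a, b, c} ∩ {p : ℂ × ℝ | 0 < p.2} =
      idealTetrahedron {a, b, c} :=
    Set.inter_eq_left.mpr fun p hp => hp.2.1
  rw [hinter, ← lintegral_indicator hset, Measure.volume_eq_prod, lintegral_prod]
  · refine lintegral_congr fun w => ?_
    by_cases hw : w ∈ convexHull ℝ ({a, b, c} : Set ℂ)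
    · rw [Set.indicator_of_mem hw, fibreVolume]
      refine lintegral_congr fun x => ?_
      simp only [Set.indicator, mem_idealTetrahedron h, hw, true_and, Set.mem_ofPred_eq]
    · rw [Set.indicator_of_notMem hw]
      simp only [Set.indicator, mem_idealTetrahedron h, hw, false_and, if_false,
        lintegral_zero]
  · exact (hdens.indicator hset).aemeasurable

/-- The power is `|w - a|²` minus the affine function with values `0`, `|b - a|²`, `|c - a|²` at
`a`, `b`, `c`; this form is easy to evaluate in polar coordinates at `a`. -/
theorem orient_mul_power {a b c o w : ℂ} (hb : power o a b = 0) (hc : power o a c = 0) :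
    orient a b c * power o a w = orient a b c * Complex.normSq (w - a) -
      orient c a w * Complex.normSq (b - a) - orient a b w * Complex.normSq (c - a) := by
  simp only [power, orient, Complex.normSq_apply, Complex.sub_re, Complex.sub_im] at *
  linear_combination
    ((a.re - c.re) * (w.im - c.im) - (a.im - c.im) * (w.re - c.re)) * hb +
    ((b.re - a.re) * (w.im - a.im) - (b.im - a.im) * (w.re - a.re)) * hc

theorem orient_similarity (t u a b c : ℂ) :
    orient (t + u * a) (t + u * b) (t + u * c) = Complex.normSq u * orient a b c := by
  simp only [orient, Complex.normSq_apply, Complex.add_re, Complex.add_im, Complex.mul_re,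
    Complex.mul_im]
  ring

theorem lintegral_comp_similarity (t u : ℂ) (hu : ‖u‖ = 1) (F : ℂ → ℝ≥0∞) :
    ∫⁻ w, F (t + u * w) = ∫⁻ w, F w := by
  rw [← lintegral_add_left_eq_self F t]
  let v : Circle := ⟨u, by simp [Submonoid.unitSphere, hu]⟩
  have := (rotation v).measurePreserving.lintegral_comp_emb
    (rotation v).toHomeomorph.measurableEmbedding (fun w => F (t + w))
  rw [← this]
  rfl

theorem lintegral_inv_sub {ρ q : ℝ} (hρ : 0 < ρ) (hq : ρ < q) :
    ∫⁻ r in Set.Ioc 0 ρ, ENNReal.ofReal (1 / (2 * (q - r))) =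
      ENNReal.ofReal (1 / 2 * (Real.log q - Real.log (q - ρ))) := by
  have hne : ∀ r ∈ Set.uIcc 0 ρ, q - r ≠ 0 := by
    intro r hr
    rw [Set.uIcc_of_le hρ.le] at hr
    linarith [hr.2]
  have hder : ∀ r ∈ Set.uIcc 0 ρ,
      HasDerivAt (fun r => -(1 / 2) * Real.log (q - r)) (1 / (2 * (q - r))) r := by
    intro r hr
    have h1 := (((hasDerivAt_id r).const_sub q).log (hne r hr)).const_mul (-(1 / 2) : ℝ)
    refine h1.congr_deriv ?_
    have := hne r hr
    simp only [id]
    field_simp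
  have hcont : ContinuousOn (fun r => 1 / (2 * (q - r))) (Set.uIcc 0 ρ) := by
    refine continuousOn_const.div (by fun_prop) fun r hr => ?_
    exact mul_ne_zero two_ne_zero (hne r hr)
  have hint := hcont.intervalIntegrable (μ := volume)
  have hval := intervalIntegral.integral_eq_sub_of_hasDerivAt hder hint
  rw [intervalIntegral.integral_of_le hρ.le] at hval
  rw [← ofReal_integral_eq_lintegral_ofReal, hval]
  · congr 1
    simp only [sub_zero]
    ring
  · exact (intervalIntegrable_iff_integrableOn_Ioc_of_le hρ.le).mp hint
  · filter_upwards [ae_restrict_mem measurableSet_Ioc] with r hr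
    have : 0 < q - r := by linarith [hr.2]
    simp only [Pi.zero_apply]
    positivity

/-- The volume of an ideal tetrahedron in polar coordinates around the vertex `a`. -/
theorem lintegral_triangle_polar {a u : ℂ} (hu : ‖u‖ = 1) {L M α : ℝ} (hL : 0 < L) (hM : 0 < M)
    (hα : α ∈ Set.Ioo 0 Real.pi) {b c : ℂ} (hb : b = a + u * L)
    (hc : c = a + u * (M * (cos α + sin α * Complex.I))) :
    ∫⁻ w, (convexHull ℝ {a, b, c}).indicator
      (fun w => fibreVolume (power (ccenter a b c) a w)) w =
    ∫⁻ θ in Set.Ioo 0 α, ENNReal.ofReal (1 / 2 * (Real.log (L * sin (α - θ) + M * sin θ) +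
      Real.log (L * sin θ + M * sin (α - θ)) - Real.log (sin θ) - Real.log (sin (α - θ)) -
      Real.log (L ^ 2 + M ^ 2 - 2 * L * M * cos α))) := by
  have hsα : 0 < sin α := Real.sin_pos_of_pos_of_lt_pi hα.1 hα.2
  have hu2 : Complex.normSq u = 1 := by rw [Complex.normSq_eq_norm_sq, hu]; norm_num
  have hD : orient a b c = L * M * sin α := by
    have := orient_similarity a u 0 L (M * (cos α + sin α * Complex.I))
    rw [mul_zero, add_zero, ← hb, ← hc, hu2, one_mul] at this
    rw [this]
    simp [orient, -Complex.ofReal_cos, -Complex.ofReal_sin]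
    ring
  have hpos : 0 < orient a b c := by rw [hD]; positivity
  set P : ℝ → ℝ → ℂ := fun r θ => a + u * (r * (cos θ + sin θ * Complex.I)) with hP
  have o1 : ∀ r θ, orient a b (P r θ) = L * r * sin θ := by
    intro r θ
    have := orient_similarity a u 0 L (r * (cos θ + sin θ * Complex.I))
    rw [mul_zero, add_zero, ← hb, hu2, one_mul] at this
    rw [hP, this]
    simp [orient, -Complex.ofReal_cos, -Complex.ofReal_sin]
    ring
  have o2 : ∀ r θ, orient c a (P r θ) = r * M * sin (α - θ) := by
    intro r θ
    have := orient_similarity a u (M * (cos α + sin α * Complex.I)) 0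
      (r * (cos θ + sin θ * Complex.I))
    rw [mul_zero, add_zero, ← hc, hu2, one_mul] at this
    rw [hP, this, Real.sin_sub]
    simp [orient, -Complex.ofReal_cos, -Complex.ofReal_sin]
    ring
  have o3 : ∀ r θ, orient b c (P r θ) =
      L * M * sin α - r * (L * sin θ + M * sin (α - θ)) := by
    intro r θ
    have := orient_add a b c (P r θ)
    rw [o1, o2, hD] at this
    linarith
  have hnb : Complex.normSq (b - a) = L ^ 2 := by
    rw [hb, add_sub_cancel_left, Complex.normSq_mul, hu2, Complex.normSq_ofReal]; ring
  have hnE : ∀ r θ : ℝ, Complex.normSq (r * (cos θ + sin θ * Complex.I) : ℂ) = r ^ 2 := by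
    intro r θ
    simp [Complex.normSq_apply, -Complex.ofReal_cos, -Complex.ofReal_sin]
    linear_combination r ^ 2 * Real.cos_sq_add_sin_sq θ
  have hnc : Complex.normSq (c - a) = M ^ 2 := by
    rw [hc, add_sub_cancel_left, Complex.normSq_mul, hu2, hnE, one_mul]
  have hnP : ∀ r θ, Complex.normSq (P r θ - a) = r ^ 2 := by
    intro r θ
    rw [hP, add_sub_cancel_left, Complex.normSq_mul, hu2, hnE, one_mul]
  have hpw : ∀ r θ, power (ccenter a b c) a (P r θ) =
      - (r * ((L * sin (α - θ) + M * sin θ) / sin α - r)) := by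
    intro r θ
    have := orient_mul_power (w := P r θ) (power_ccenter_snd hpos.ne') (power_ccenter_thd hpos.ne')
    rw [o1, o2, hnP, hnb, hnc, hD] at this
    have hne : L * M * sin α ≠ 0 := by positivity
    apply mul_left_cancel₀ hne
    rw [this]
    field_simp
    ring
  have hmem : ∀ r θ, P r θ ∈ convexHull ℝ {a, b, c} ↔ 0 ≤ L * r * sin θ ∧
      0 ≤ L * M * sin α - r * (L * sin θ + M * sin (α - θ)) ∧ 0 ≤ r * M * sin (α - θ) := by
    intro r θ
    rw [mem_convexHull_triangle hpos, o1, o2, o3]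
  have hconv : MeasurableSet (convexHull ℝ ({a, b, c} : Set ℂ)) :=
    ((Set.toFinite _).isCompact_convexHull ℝ).isClosed.measurableSet
  have hF : Measurable ((convexHull ℝ {a, b, c}).indicator
      (fun w => fibreVolume (power (ccenter a b c) a w))) :=
    (measurable_fibreVolume.comp (continuous_power _ _).measurable).indicator hconv
  set F := (convexHull ℝ {a, b, c}).indicator
      (fun w => fibreVolume (power (ccenter a b c) a w)) with hFdef
  rw [← lintegral_comp_similarity a u hu F, ← Complex.lintegral_comp_polarCoord_symm]
  simp only [Complex.polarCoord_symm_apply, smul_eq_mul, polarCoord_target]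
  rw [Measure.volume_eq_prod, setLIntegral_prod_symm _ (Measurable.aemeasurable (by fun_prop))]
  change ∫⁻ θ in Set.Ioo (-Real.pi) Real.pi, ∫⁻ r in Set.Ioi 0, ENNReal.ofReal r * F (P r θ) = _
  -- outside the angle of the triangle the integrand vanishes
  have hout : ∀ᵐ θ : ℝ, θ ∈ Set.Ioo (-Real.pi) Real.pi →
      ∫⁻ r in Set.Ioi 0, ENNReal.ofReal r * F (P r θ) =
        (Set.Ioo 0 α).indicator (fun θ => ∫⁻ r in Set.Ioi 0, ENNReal.ofReal r * F (P r θ)) θ := by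
    have h0 : ∀ᵐ θ : ℝ, θ ≠ 0 := Measure.ae_ne volume 0
    have h1 : ∀ᵐ θ : ℝ, θ ≠ α := Measure.ae_ne volume α
    filter_upwards [h0, h1] with θ hθ0 hθα hθ
    by_cases hin : θ ∈ Set.Ioo 0 α
    · rw [Set.indicator_of_mem hin]
    · rw [Set.indicator_of_notMem hin]
      have hzero : ∀ r ∈ Set.Ioi (0 : ℝ), ENNReal.ofReal r * F (P r θ) = 0 := by
        intro r hr
        have hr' : 0 < r := hr
        have hnot : P r θ ∉ convexHull ℝ {a, b, c} := by
          rw [hmem]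
          rintro ⟨e1, -, e3⟩
          rcases lt_or_gt_of_ne hθ0 with hlt | hgt
          · have hs := Real.sin_neg_of_neg_of_neg_pi_lt hlt hθ.1
            have : L * r * sin θ < 0 := mul_neg_of_pos_of_neg (by positivity) hs
            linarith
          · have hgt' : α < θ := by
              by_contra hc'
              exact hin ⟨hgt, lt_of_le_of_ne (not_lt.mp hc') hθα⟩
            have hs := Real.sin_neg_of_neg_of_neg_pi_lt (x := α - θ) (by linarith)
              (by linarith [hθ.2, hα.1])
            have : r * M * sin (α - θ) < 0 := mul_neg_of_pos_of_neg (by positivity) hs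
            linarith
        rw [hFdef, Set.indicator_of_notMem hnot, mul_zero]
      rw [setLIntegral_congr_fun measurableSet_Ioi hzero, lintegral_zero]
  rw [setLIntegral_congr_fun_ae measurableSet_Ioo hout, lintegral_indicator measurableSet_Ioo,
    Measure.restrict_restrict measurableSet_Ioo,
    Set.inter_eq_left.mpr (Set.Ioo_subset_Ioo (by linarith [Real.pi_pos]) hα.2.le)]
  refine setLIntegral_congr_fun measurableSet_Ioo fun θ hθ => ?_
  have s1 : 0 < sin θ := Real.sin_pos_of_pos_of_lt_pi hθ.1 (by linarith [hθ.2, hα.2])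
  have s2 : 0 < sin (α - θ) := Real.sin_pos_of_pos_of_lt_pi (by linarith [hθ.2])
    (by linarith [hθ.1, hα.2])
  have hX : 0 < L * sin (α - θ) + M * sin θ := by positivity
  have hY : 0 < L * sin θ + M * sin (α - θ) := by positivity
  have hN : 0 < L ^ 2 + M ^ 2 - 2 * L * M * cos α := by
    have hcs := Real.sin_sq_add_cos_sq α
    have : L ^ 2 + M ^ 2 - 2 * L * M * cos α = (L - M * cos α) ^ 2 + (M * sin α) ^ 2 := by
      linear_combination (-M ^ 2) * hcs
    rw [this]; positivity
  -- The ray at angle `θ` leaves the circumcircle at radius `q` and the triangle at radius `ρ`.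
  set q := (L * sin (α - θ) + M * sin θ) / sin α with hq
  set ρ := L * M * sin α / (L * sin θ + M * sin (α - θ)) with hρ
  have hρ0 : 0 < ρ := by positivity
  have hqρ : q - ρ = sin θ * sin (α - θ) * (L ^ 2 + M ^ 2 - 2 * L * M * cos α) /
      (sin α * (L * sin θ + M * sin (α - θ))) := by
    rw [hq, hρ, div_sub_div _ _ hsα.ne' hY.ne']
    congr 1
    have hc1 := Real.sin_sq_add_cos_sq α
    have hc2 := Real.sin_sq_add_cos_sq θ
    rw [Real.sin_sub]
    linear_combination L * M * (sin α ^ 2 * hc2 - sin θ ^ 2 * hc1)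
  have hlt : ρ < q := by
    have : 0 < q - ρ := by rw [hqρ]; positivity
    linarith
  have hinner : ∫⁻ r in Set.Ioi 0, ENNReal.ofReal r * F (P r θ) =
      ∫⁻ r in Set.Ioc 0 ρ, ENNReal.ofReal (1 / (2 * (q - r))) := by
    have : ∀ r ∈ Set.Ioi (0 : ℝ), ENNReal.ofReal r * F (P r θ) =
        (Set.Ioc 0 ρ).indicator (fun r => ENNReal.ofReal (1 / (2 * (q - r)))) r := by
      intro r hr
      have hr0 : 0 < r := hr
      by_cases hrρ : r ≤ ρ
      · have hin : P r θ ∈ convexHull ℝ {a, b, c} := by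
          rw [hmem]
          refine ⟨by positivity, ?_, by positivity⟩
          rw [hρ, le_div_iff₀ hY] at hrρ
          linarith
        have hqr : 0 < q - r := by linarith
        have hneg : power (ccenter a b c) a (P r θ) < 0 := by
          rw [hpw]
          have : 0 < r * (q - r) := by positivity
          linarith
        -- The polar Jacobian `r` cancels the zero of the power `-r (q - r)` at `a`.
        rw [Set.indicator_of_mem (show r ∈ Set.Ioc 0 ρ from ⟨hr0, hrρ⟩), hFdef, Set.indicator_of_mem hin,
          fibreVolume_of_neg hneg, ← ENNReal.ofReal_mul hr0.le, hpw, ← hq]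
        congr 1
        field_simp
      · have hnot : P r θ ∉ convexHull ℝ {a, b, c} := by
          rw [hmem]
          rintro ⟨-, e2, -⟩
          apply hrρ
          rw [hρ, le_div_iff₀ hY]
          linarith
        rw [Set.indicator_of_notMem (fun h => hrρ h.2), hFdef, Set.indicator_of_notMem hnot,
          mul_zero]
    rw [setLIntegral_congr_fun measurableSet_Ioi this, lintegral_indicator measurableSet_Ioc,
      Measure.restrict_restrict measurableSet_Ioc,
      Set.inter_eq_left.mpr (fun r hr => hr.1)]
  rw [hinner, lintegral_inv_sub hρ0 hlt, hqρ]
  congr 2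
  rw [hq, Real.log_div hX.ne' hsα.ne', Real.log_div (by positivity) (by positivity),
    Real.log_mul (by positivity) hN.ne', Real.log_mul s1.ne' s2.ne', Real.log_mul hsα.ne' hY.ne']
  ring

/-! ### The volume as a function of the angles. -/

/-- The angle at `a` of the positively oriented triangle `a b c`. -/
noncomputable def angleAt (a b c : ℂ) : ℝ := Complex.arg ((c - a) / (b - a))

/-- The function `x ↦ ∫ t in 0..x, log (sin t)`. -/
noncomputable def logSinIntegral (x : ℝ) : ℝ := ∫ t in (0 : ℝ)..x, Real.log (sin t)

theorem im_div_eq_orient (a b c : ℂ) :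
    ((c - a) / (b - a)).im = orient a b c / Complex.normSq (b - a) := by
  simp only [Complex.div_im, orient, Complex.sub_re, Complex.sub_im]
  ring

theorem re_div_eq_dotp (a b c : ℂ) :
    ((c - a) / (b - a)).re = dotp (b - a) (c - a) / Complex.normSq (b - a) := by
  simp only [Complex.div_re, dotp, Complex.sub_re, Complex.sub_im]
  ring

theorem sin_angleAt {a b c : ℂ} (h : a ≠ b) :
    sin (angleAt a b c) = orient a b c / (‖b - a‖ * ‖c - a‖) := by
  have hn : ‖b - a‖ ≠ 0 := norm_ne_zero_iff.mpr (sub_ne_zero.mpr h.symm)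
  rw [angleAt, Complex.sin_arg, im_div_eq_orient, Complex.normSq_eq_norm_sq, norm_div]
  field_simp

theorem cos_angleAt {a b c : ℂ} (h : a ≠ b) (hc : c ≠ a) :
    cos (angleAt a b c) = dotp (b - a) (c - a) / (‖b - a‖ * ‖c - a‖) := by
  have hn : ‖b - a‖ ≠ 0 := norm_ne_zero_iff.mpr (sub_ne_zero.mpr h.symm)
  have hne : (c - a) / (b - a) ≠ 0 := div_ne_zero (sub_ne_zero.mpr hc) (sub_ne_zero.mpr h.symm)
  rw [angleAt, Complex.cos_arg hne, re_div_eq_dotp, Complex.normSq_eq_norm_sq, norm_div]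
  field_simp

theorem im_div_pos {a b c : ℂ} (h : 0 < orient a b c) : 0 < ((c - a) / (b - a)).im := by
  rw [im_div_eq_orient]
  exact div_pos h (normSq_sub_pos (ne_of_orient_ne_zero h.ne').1)

theorem angleAt_mem {a b c : ℂ} (h : 0 < orient a b c) : angleAt a b c ∈ Set.Ioo 0 Real.pi := by
  have him := im_div_pos h
  refine ⟨lt_of_le_of_ne (Complex.arg_nonneg_iff.mpr him.le) fun h0 => ?_,
    lt_of_le_of_ne (Complex.arg_le_pi _) fun h0 => ?_⟩
  · exact him.ne' (Complex.arg_eq_zero_iff.mp h0.symm).2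
  · exact him.ne' (Complex.arg_eq_pi_iff.mp h0).2

theorem intervalIntegrable_log_sin' (a b : ℝ) :
    IntervalIntegrable (fun t => Real.log (sin t)) volume a b :=
  intervalIntegrable_log_sin

theorem integral_log_sin_add (γ α : ℝ) :
    ∫ θ in (0 : ℝ)..α, Real.log (sin (γ + θ)) = logSinIntegral (γ + α) - logSinIntegral γ := by
  rw [intervalIntegral.integral_comp_add_left (fun x => Real.log (sin x)), add_zero,
    logSinIntegral, logSinIntegral, intervalIntegral.integral_interval_sub_left]
  · exact intervalIntegrable_log_sin' _ _
  · exact intervalIntegrable_log_sin' _ _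

theorem integral_log_sin_sub (α : ℝ) :
    ∫ θ in (0 : ℝ)..α, Real.log (sin (α - θ)) = logSinIntegral α := by
  rw [intervalIntegral.integral_comp_sub_left (fun x => Real.log (sin x)), sub_self, sub_zero,
    logSinIntegral]

theorem logSinIntegral_pi_sub (x : ℝ) :
    logSinIntegral (Real.pi - x) = logSinIntegral Real.pi - logSinIntegral x := by
  have h1 : ∫ t in (0 : ℝ)..x, Real.log (sin (Real.pi - t)) =
      ∫ t in Real.pi - x..Real.pi, Real.log (sin t) := by
    rw [intervalIntegral.integral_comp_sub_left (fun x => Real.log (sin x)), sub_zero]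
  simp only [Real.sin_pi_sub] at h1
  have h2 := intervalIntegral.integral_add_adjacent_intervals
    (intervalIntegrable_log_sin' 0 (Real.pi - x))
    (intervalIntegrable_log_sin' (Real.pi - x) Real.pi)
  rw [logSinIntegral, logSinIntegral, logSinIntegral, h1]
  linarith

/-- The volume of an ideal tetrahedron in terms of its dihedral angles. -/
theorem idealVolume_eq_logSinIntegral {a b c : ℂ} (h : 0 < orient a b c) :
    idealVolume {a, b, c} = logSinIntegral Real.pi - logSinIntegral (angleAt a b c) -
      logSinIntegral (angleAt b c a) - logSinIntegral (angleAt c a b) := by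
  obtain ⟨hab, hbc, hca⟩ := ne_of_orient_ne_zero h.ne'
  have h' : 0 < orient b c a := by rwa [orient_rotate]
  have h'' : 0 < orient c a b := by rwa [orient_rotate]
  have hα := angleAt_mem h
  have hβ := angleAt_mem h'
  have hγ := angleAt_mem h''
  have sα := sin_angleAt (c := c) hab
  have cα := cos_angleAt hab hca
  have sβ := sin_angleAt (c := a) hbc
  have cβ := cos_angleAt hbc hab
  have sγ := sin_angleAt (c := b) hca
  have cγ := cos_angleAt hca hbc
  rw [orient_rotate] at sβ
  rw [← orient_rotate c a b] at sγ
  have hL : 0 < ‖b - a‖ := norm_pos_iff.mpr (sub_ne_zero.mpr hab.symm)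
  have hM : 0 < ‖c - a‖ := norm_pos_iff.mpr (sub_ne_zero.mpr hca)
  have hk : 0 < ‖c - b‖ := norm_pos_iff.mpr (sub_ne_zero.mpr hbc.symm)
  rw [norm_sub_rev a b] at sβ cβ
  rw [norm_sub_rev a c, norm_sub_rev b c] at sγ cγ
  have d1 : dotp (c - b) (a - b) = ‖b - a‖ ^ 2 - dotp (b - a) (c - a) := by
    rw [← Complex.normSq_eq_norm_sq]
    simp only [dotp, Complex.normSq_apply, Complex.sub_re, Complex.sub_im]; ring
  have d2 : dotp (a - c) (b - c) = ‖c - a‖ ^ 2 - dotp (b - a) (c - a) := by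
    rw [← Complex.normSq_eq_norm_sq]
    simp only [dotp, Complex.normSq_apply, Complex.sub_re, Complex.sub_im]; ring
  have d3 : ‖c - b‖ ^ 2 = ‖b - a‖ ^ 2 + ‖c - a‖ ^ 2 - 2 * dotp (b - a) (c - a) := by
    rw [← Complex.normSq_eq_norm_sq, ← Complex.normSq_eq_norm_sq, ← Complex.normSq_eq_norm_sq]
    simp only [dotp, Complex.normSq_apply, Complex.sub_re, Complex.sub_im]; ring
  rw [d1] at cβ
  rw [d2] at cγ
  have hpolar : (c - a) / (b - a) = (‖c - a‖ / ‖b - a‖ : ℝ) *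
      (cos (angleAt a b c) + sin (angleAt a b c) * Complex.I) := by
    have := Complex.norm_mul_cos_add_sin_mul_I ((c - a) / (b - a))
    rw [norm_div] at this
    rw [angleAt, Complex.ofReal_cos, Complex.ofReal_sin, this]
  set α := angleAt a b c with hαdef
  set β := angleAt b c a with hβdef
  set γ := angleAt c a b with hγdef
  set L := ‖b - a‖ with hLdef
  set M := ‖c - a‖ with hMdef
  set k := ‖c - b‖ with hkdef
  have hdot : dotp (b - a) (c - a) = L * M * cos α := by rw [cα]; field_simp
  have hor : orient a b c = L * M * sin α := by rw [sα]; field_simp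
  rw [hdot] at d3 cβ cγ
  rw [hor] at sβ sγ
  have sβ' : k * sin β = M * sin α := by rw [sβ]; field_simp
  have cβ' : k * cos β = L - M * cos α := by rw [cβ]; field_simp
  have sγ' : k * sin γ = L * sin α := by rw [sγ]; field_simp
  have cγ' : k * cos γ = M - L * cos α := by rw [cγ]; field_simp
  -- Cosines of `α + β` and `π - γ` agree; positivity of `sin (α + β)` places `α + β` in the range
  -- where the cosine is injective.
  have hsum : α + β + γ = Real.pi := by
    have hs : sin (α + β) = sin γ := by
      apply mul_left_cancel₀ hk.ne'
      rw [Real.sin_add]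
      linear_combination sin α * cβ' + cos α * sβ' - sγ'
    have hc : cos (α + β) = cos (Real.pi - γ) := by
      apply mul_left_cancel₀ hk.ne'
      rw [Real.cos_add, Real.cos_pi_sub]
      linear_combination cos α * cβ' - sin α * sβ' + cγ' - M * Real.sin_sq_add_cos_sq α
    have hpos : 0 < sin (α + β) := by rw [hs]; exact Real.sin_pos_of_pos_of_lt_pi hγ.1 hγ.2
    have hlt : α + β < Real.pi := by
      by_contra hcon
      push Not at hcon
      have h0 : sin (α + β - Real.pi) = - sin (α + β) := Real.sin_sub_pi _
      have h1 := Real.sin_nonneg_of_nonneg_of_le_pi (x := α + β - Real.pi) (by linarith)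
        (by linarith [hα.2, hβ.2])
      linarith
    have := Real.injOn_cos (⟨by linarith [hα.1, hβ.1], hlt.le⟩ : α + β ∈ Set.Icc 0 Real.pi)
      (⟨by linarith [hγ.2], by linarith [hγ.1]⟩ : Real.pi - γ ∈ Set.Icc 0 Real.pi) hc
    linarith
  have hba : b - a ≠ 0 := sub_ne_zero.mpr hab.symm
  have hLc : (L : ℂ) ≠ 0 := by exact_mod_cast hL.ne'
  have hu : ‖(b - a) / (L : ℂ)‖ = 1 := by
    rw [norm_div, Complex.norm_real, Real.norm_of_nonneg hL.le, ← hLdef, div_self hL.ne']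
  rw [idealVolume_eq_lintegral h, lintegral_triangle_polar hu hL hM hα (b := b) (c := c)
    (by field_simp; ring) (by
      have := (div_eq_iff hba).mp hpolar
      push_cast at this ⊢
      linear_combination this)]
  -- By the law of sines all lengths combine into powers of `k`, which cancel; only the angles
  -- remain.
  have hf : ∀ θ ∈ Set.Ioo 0 α, 1 / 2 * (Real.log (L * sin (α - θ) + M * sin θ) +
      Real.log (L * sin θ + M * sin (α - θ)) - Real.log (sin θ) - Real.log (sin (α - θ)) -
      Real.log (L ^ 2 + M ^ 2 - 2 * L * M * cos α)) =
      1 / 2 * (Real.log (sin (γ + θ)) + Real.log (sin (β + θ)) - Real.log (sin θ) -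
        Real.log (sin (α - θ))) := by
    intro θ hθ
    have p1 : 0 < sin (γ + θ) := Real.sin_pos_of_pos_of_lt_pi (by linarith [hγ.1, hθ.1])
      (by linarith [hβ.1, hθ.2])
    have p2 : 0 < sin (β + θ) := Real.sin_pos_of_pos_of_lt_pi (by linarith [hβ.1, hθ.1])
      (by linarith [hγ.1, hθ.2])
    have e1 : L * sin (α - θ) + M * sin θ = k * sin (γ + θ) := by
      rw [Real.sin_sub, Real.sin_add]
      linear_combination -cos θ * sγ' - sin θ * cγ'
    have e2 : L * sin θ + M * sin (α - θ) = k * sin (β + θ) := by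
      rw [Real.sin_sub, Real.sin_add]
      linear_combination -cos θ * sβ' - sin θ * cβ'
    have e3 : L ^ 2 + M ^ 2 - 2 * L * M * cos α = k ^ 2 := by linarith
    rw [e1, e2, e3, Real.log_mul hk.ne' p1.ne', Real.log_mul hk.ne' p2.ne', Real.log_pow]
    push_cast
    ring
  have i1 : IntervalIntegrable (fun θ => Real.log (sin (γ + θ))) volume 0 α := by
    have := (intervalIntegrable_log_sin' (γ + 0) (γ + α)).comp_add_left γ
    simpa using this
  have i2 : IntervalIntegrable (fun θ => Real.log (sin (β + θ))) volume 0 α := by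
    have := (intervalIntegrable_log_sin' (β + 0) (β + α)).comp_add_left β
    simpa using this
  have i3 := intervalIntegrable_log_sin' 0 α
  have i4 : IntervalIntegrable (fun θ => Real.log (sin (α - θ))) volume 0 α := by
    have := (intervalIntegrable_log_sin' (α - 0) (α - α)).comp_sub_left α
    simpa using this
  have itot := (((i1.add i2).sub i3).sub i4).const_mul (1 / 2)
  rw [setLIntegral_congr_fun measurableSet_Ioo
    (fun θ hθ => congrArg ENNReal.ofReal (hf θ hθ)), ← integral_eq_lintegral_of_nonneg_ae]
  · rw [← integral_Ioc_eq_integral_Ioo, ← intervalIntegral.integral_of_le hα.1.le,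
      intervalIntegral.integral_const_mul, intervalIntegral.integral_sub ((i1.add i2).sub i3) i4,
      intervalIntegral.integral_sub (i1.add i2) i3, intervalIntegral.integral_add i1 i2,
      integral_log_sin_add, integral_log_sin_add, integral_log_sin_sub]
    rw [show γ + α = Real.pi - β by linarith, show β + α = Real.pi - γ by linarith,
      logSinIntegral_pi_sub, logSinIntegral_pi_sub]
    rw [← logSinIntegral]
    ring
  · filter_upwards [ae_restrict_mem measurableSet_Ioo] with θ hθ
    have p1 : 0 < sin (γ + θ) := Real.sin_pos_of_pos_of_lt_pi (by linarith [hγ.1, hθ.1])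
      (by linarith [hβ.1, hθ.2])
    have p2 : 0 < sin (β + θ) := Real.sin_pos_of_pos_of_lt_pi (by linarith [hβ.1, hθ.1])
      (by linarith [hγ.1, hθ.2])
    have p3 : 0 < sin θ := Real.sin_pos_of_pos_of_lt_pi hθ.1 (by linarith [hθ.2, hα.2])
    have p4 : 0 < sin (α - θ) := Real.sin_pos_of_pos_of_lt_pi (by linarith [hθ.2])
      (by linarith [hθ.1, hα.2])
    -- The difference of the two sides is `sin β * sin γ`.
    have hle : sin θ * sin (α - θ) ≤ sin (γ + θ) * sin (β + θ) := by
      have h1 : sin (α - θ) = sin (β + γ + θ) := by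
        rw [← Real.sin_pi_sub]; congr 1; linarith
      have q1 := Real.sin_pos_of_pos_of_lt_pi hβ.1 hβ.2
      have q2 := Real.sin_pos_of_pos_of_lt_pi hγ.1 hγ.2
      have h2 : sin (γ + θ) * sin (β + θ) - sin θ * sin (β + γ + θ) = sin β * sin γ := by
        rw [Real.sin_add, Real.sin_add, Real.sin_add, Real.sin_add, Real.cos_add]
        linear_combination sin β * sin γ * Real.sin_sq_add_cos_sq θ
      rw [h1]
      nlinarith [mul_pos q1 q2]
    have := Real.log_le_log (mul_pos p3 p4) hle
    rw [Real.log_mul p3.ne' p4.ne', Real.log_mul p1.ne' p2.ne'] at this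
    simp only [Pi.zero_apply]
    linarith
  · exact ((intervalIntegrable_iff_integrableOn_Ioo_of_le hα.1.le).mp itot).aestronglyMeasurable

/-! ### Derivatives of the volume -/

theorem hasDerivAt_logSinIntegral {x : ℝ} (hx : x ∈ Set.Ioo 0 Real.pi) :
    HasDerivAt logSinIntegral (Real.log (sin x)) x := by
  have hs : sin x ≠ 0 := (Real.sin_pos_of_pos_of_lt_pi hx.1 hx.2).ne'
  refine intervalIntegral.integral_hasDerivAt_right (intervalIntegrable_log_sin' 0 x) ?_
    (Real.continuous_sin.continuousAt.log hs)
  exact (Real.measurable_log.comp Real.measurable_sin).stronglyMeasurable.stronglyMeasurableAtFilter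

section Curves

variable {p q r : ℝ → ℂ} {p' q' r' : ℂ} {t : ℝ}

/-- The angle is the imaginary part of `log ((r - p) / (q - p))`. -/
theorem hasDerivAt_angleAt (hp : HasDerivAt p p' t) (hq : HasDerivAt q q' t)
    (hr : HasDerivAt r r' t) (h : 0 < orient (p t) (q t) (r t)) :
    HasDerivAt (fun t => angleAt (p t) (q t) (r t))
      (((r' - p') / (r t - p t)).im - ((q' - p') / (q t - p t)).im) t := by
  obtain ⟨hpq, hqr, hrp⟩ := ne_of_orient_ne_zero h.ne'
  have e1 : q t - p t ≠ 0 := sub_ne_zero.mpr hpq.symm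
  have e2 : r t - p t ≠ 0 := sub_ne_zero.mpr hrp
  have hw : (r t - p t) / (q t - p t) ∈ Complex.slitPlane := Or.inr (im_div_pos h).ne'
  have h1 := ((hr.fun_sub hp).fun_div (hq.fun_sub hp) e1).clog_real hw
  have h2 := Complex.imCLM.hasFDerivAt.comp_hasDerivAt t h1
  have heq : (fun t => angleAt (p t) (q t) (r t)) =
      ⇑Complex.imCLM ∘ fun t => Complex.log ((r t - p t) / (q t - p t)) := by
    funext s
    simp [angleAt, Complex.log_im]
  rw [heq]
  refine h2.congr_deriv ?_
  rw [← Complex.sub_im]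
  simp only [Complex.imCLM_apply]
  congr 1
  field_simp

theorem log_sin_angleAt {a b c : ℂ} (h : 0 < orient a b c) :
    Real.log (sin (angleAt a b c)) =
      Real.log (orient a b c) - Real.log ‖b - a‖ - Real.log ‖c - a‖ := by
  obtain ⟨hab, hbc, hca⟩ := ne_of_orient_ne_zero h.ne'
  have h1 : ‖b - a‖ ≠ 0 := norm_ne_zero_iff.mpr (sub_ne_zero.mpr hab.symm)
  have h2 : ‖c - a‖ ≠ 0 := norm_ne_zero_iff.mpr (sub_ne_zero.mpr hca)
  rw [sin_angleAt hab, Real.log_div h.ne' (mul_ne_zero h1 h2), Real.log_mul h1 h2]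
  ring

theorem continuous_orient : Continuous fun x : ℂ × ℂ × ℂ => orient x.1 x.2.1 x.2.2 := by
  unfold orient
  fun_prop

/-- The derivative is minus the sum of `log (sin angle)` times the derivative of the angle. Each
`log (sin angle)` is the log of the orientation minus the logs of two sides; the former drops out
because the derivatives of the angles sum to zero. -/
theorem hasDerivAt_idealVolume (hp : HasDerivAt p p' t) (hq : HasDerivAt q q' t)
    (hr : HasDerivAt r r' t) (h : 0 < orient (p t) (q t) (r t)) :
    HasDerivAt (fun t => idealVolume {p t, q t, r t})
      (((r' - p') / (r t - p t)).im * (Real.log ‖q t - p t‖ - Real.log ‖r t - q t‖) +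
        ((q' - p') / (q t - p t)).im * (Real.log ‖r t - q t‖ - Real.log ‖r t - p t‖) +
        ((r' - q') / (r t - q t)).im * (Real.log ‖r t - p t‖ - Real.log ‖q t - p t‖)) t := by
  have h' : 0 < orient (q t) (r t) (p t) := by rwa [orient_rotate]
  have h'' : 0 < orient (r t) (p t) (q t) := by rwa [orient_rotate]
  have hev : ∀ᶠ s in nhds t, 0 < orient (p s) (q s) (r s) := by
    have hc : ContinuousAt (fun s => orient (p s) (q s) (r s)) t :=
      continuous_orient.continuousAt.comp
        (hp.continuousAt.prodMk (hq.continuousAt.prodMk hr.continuousAt))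
    exact hc.eventually (lt_mem_nhds h)
  have d1 := (hasDerivAt_logSinIntegral (angleAt_mem h)).comp t (hasDerivAt_angleAt hp hq hr h)
  have d2 := (hasDerivAt_logSinIntegral (angleAt_mem h')).comp t (hasDerivAt_angleAt hq hr hp h')
  have d3 := (hasDerivAt_logSinIntegral (angleAt_mem h'')).comp t (hasDerivAt_angleAt hr hp hq h'')
  have d := ((d1.const_sub (logSinIntegral Real.pi)).sub d2).sub d3
  refine (d.congr_deriv ?_).congr_of_eventuallyEq ?_
  · have o2 : orient (q t) (r t) (p t) = orient (p t) (q t) (r t) := orient_rotate ..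
    have o3 : orient (r t) (p t) (q t) = orient (p t) (q t) (r t) := (orient_rotate ..).symm
    rw [log_sin_angleAt h, log_sin_angleAt h', log_sin_angleAt h'', o2, o3, norm_sub_rev (p t) (q t), norm_sub_rev (p t) (r t),
      norm_sub_rev (q t) (r t)]
    have s1 : (p' - q') / (p t - q t) = (q' - p') / (q t - p t) := by
      rw [← neg_sub q' p', ← neg_sub (q t), neg_div_neg_eq]
    have s2 : (p' - r') / (p t - r t) = (r' - p') / (r t - p t) := by
      rw [← neg_sub r' p', ← neg_sub (r t), neg_div_neg_eq]
    have s3 : (q' - r') / (q t - r t) = (r' - q') / (r t - q t) := by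
      rw [← neg_sub r' q', ← neg_sub (r t), neg_div_neg_eq]
    rw [s1, s2, s3]
    ring
  · filter_upwards [hev] with s hs
    exact idealVolume_eq_logSinIntegral hs

theorem hasDerivAt_log_norm {f : ℝ → ℂ} {f' : ℂ} (hf : HasDerivAt f f' t) (h0 : f t ≠ 0) :
    HasDerivAt (fun s => Real.log ‖f s‖) (f' / f t).re t := by
  -- Dividing by `f t` moves the base value to 1, away from the branch cut.
  have h1 : HasDerivAt (fun s => f s / f t) (f' / f t) t := hf.div_const _
  have hone : f t / f t = 1 := div_self h0
  have h2 := h1.clog_real (by rw [hone]; exact Complex.one_mem_slitPlane)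
  have h3 := (Complex.reCLM.hasFDerivAt.comp_hasDerivAt t h2).add_const (Real.log ‖f t‖)
  refine (h3.congr_deriv ?_).congr_of_eventuallyEq ?_
  · simp [hone]
  · filter_upwards [hf.continuousAt.eventually_ne h0] with s hs
    have e1 : ‖f s‖ ≠ 0 := norm_ne_zero_iff.mpr hs
    have e2 : ‖f t‖ ≠ 0 := norm_ne_zero_iff.mpr h0
    simp only [Function.comp_apply, Complex.reCLM_apply, Complex.log_re, norm_div]
    rw [Real.log_div e1 e2]
    ring

end Curves

/-! ### Wirtinger derivatives of the volume. -/

section Wirtinger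

variable {ι : Type*}

theorem hasDerivAt_line (x e : ι → ℂ) (j : ι) :
    HasDerivAt (fun t : ℝ => (x + t • e) j) (e j) 0 := by
  have h1 : HasDerivAt (fun t : ℝ => x j + (t : ℂ) * e j) (e j) 0 := by
    have := ((hasDerivAt_id (0 : ℝ)).ofReal_comp.mul_const (e j)).const_add (x j)
    simpa using this
  simpa using h1

theorem hasLineDerivAt_idealVolume {p q r : ι} {x : ι → ℂ}
    (h : 0 < orient (x p) (x q) (x r)) (e : ι → ℂ) :
    HasLineDerivAt ℝ (fun x : ι → ℂ => (idealVolume {x p, x q, x r} : ℂ))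
      ((((e r - e p) / (x r - x p)).im * (Real.log ‖x q - x p‖ - Real.log ‖x r - x q‖) +
        ((e q - e p) / (x q - x p)).im * (Real.log ‖x r - x q‖ - Real.log ‖x r - x p‖) +
        ((e r - e q) / (x r - x q)).im * (Real.log ‖x r - x p‖ - Real.log ‖x q - x p‖) : ℝ) : ℂ)
      x e := by
  have := (hasDerivAt_idealVolume (hasDerivAt_line x e p) (hasDerivAt_line x e q)
    (hasDerivAt_line x e r) (by simpa using h)).ofReal_comp
  simpa [HasLineDerivAt] using this

variable [DecidableEq ι]

open scoped ComplexConjugate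

/-- The coordinates of the `v`-th unit vector. -/
def unitCoord (v j : ι) : ℂ := if j = v then 1 else 0

theorem single_one_apply (v j : ι) : (Pi.single v 1 : ι → ℂ) j = unitCoord v j := by
  simp [unitCoord, Pi.single_apply]

theorem single_I_apply (v j : ι) :
    (Pi.single v Complex.I : ι → ℂ) j = Complex.I * unitCoord v j := by
  simp [unitCoord, Pi.single_apply]

/-- The first Wirtinger derivative of the volume over the face `p q r`. -/
noncomputable def volumeWirtingerBar (v p q r : ι) (x : ι → ℂ) : ℂ :=
  Complex.I / 2 *
    (conj ((unitCoord v r - unitCoord v p) / (x r - x p)) *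
        (Real.log ‖x q - x p‖ - Real.log ‖x r - x q‖ : ℝ) +
      conj ((unitCoord v q - unitCoord v p) / (x q - x p)) *
        (Real.log ‖x r - x q‖ - Real.log ‖x r - x p‖ : ℝ) +
      conj ((unitCoord v r - unitCoord v q) / (x r - x q)) *
        (Real.log ‖x r - x p‖ - Real.log ‖x q - x p‖ : ℝ))

theorem half_mul_im_add_I_mul (ζ : ℂ) :
    (1 / 2 : ℂ) * ((ζ.im : ℂ) + Complex.I * ((Complex.I * ζ).im : ℂ)) =
      Complex.I / 2 * conj ζ := by
  apply Complex.ext <;> simp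

theorem re_sub_I_mul_re_I_mul (ζ : ℂ) :
    (ζ.re : ℂ) - Complex.I * ((Complex.I * ζ).re : ℂ) = ζ := by
  apply Complex.ext <;> simp

theorem hasDerivAt_conj_div {f : ℝ → ℂ} {f' : ℂ} {t : ℝ} (d : ℂ) (hf : HasDerivAt f f' t)
    (h0 : f t ≠ 0) :
    HasDerivAt (fun s => conj (d / f s)) (conj (-(d / f t ^ 2) * f')) t := by
  have h1 : HasDerivAt (fun s => d / f s) (-(d / f t ^ 2) * f') t := by
    refine ((hasDerivAt_const t d).fun_div hf h0).congr_deriv ?_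
    field_simp
    ring
  exact h1.star

/-- The derivative of `volumeWirtingerBar` in the direction `e`. -/
theorem hasLineDerivAt_volumeWirtingerBar (v : ι) {p q r : ι} {x : ι → ℂ}
    (h : 0 < orient (x p) (x q) (x r)) (e : ι → ℂ) :
    HasLineDerivAt ℝ (volumeWirtingerBar v p q r)
      (Complex.I / 2 *
        ((conj (-((unitCoord v r - unitCoord v p) / (x r - x p) ^ 2) * (e r - e p)) *
            (Real.log ‖x q - x p‖ - Real.log ‖x r - x q‖ : ℝ) +
          conj ((unitCoord v r - unitCoord v p) / (x r - x p)) *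
            (((e q - e p) / (x q - x p)).re - ((e r - e q) / (x r - x q)).re : ℝ)) +
        (conj (-((unitCoord v q - unitCoord v p) / (x q - x p) ^ 2) * (e q - e p)) *
            (Real.log ‖x r - x q‖ - Real.log ‖x r - x p‖ : ℝ) +
          conj ((unitCoord v q - unitCoord v p) / (x q - x p)) *
            (((e r - e q) / (x r - x q)).re - ((e r - e p) / (x r - x p)).re : ℝ)) +
        (conj (-((unitCoord v r - unitCoord v q) / (x r - x q) ^ 2) * (e r - e q)) *
            (Real.log ‖x r - x p‖ - Real.log ‖x q - x p‖ : ℝ) +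
          conj ((unitCoord v r - unitCoord v q) / (x r - x q)) *
            (((e r - e p) / (x r - x p)).re - ((e q - e p) / (x q - x p)).re : ℝ)))) x e := by
  obtain ⟨hpq, hqr, hrp⟩ := ne_of_orient_ne_zero h.ne'
  have n1 : x q - x p ≠ 0 := sub_ne_zero.mpr hpq.symm
  have n2 : x r - x p ≠ 0 := sub_ne_zero.mpr hrp
  have n3 : x r - x q ≠ 0 := sub_ne_zero.mpr hqr.symm
  have f1 := (hasDerivAt_line x e q).fun_sub (hasDerivAt_line x e p)
  have f2 := (hasDerivAt_line x e r).fun_sub (hasDerivAt_line x e p)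
  have f3 := (hasDerivAt_line x e r).fun_sub (hasDerivAt_line x e q)
  have n1' : (fun t : ℝ => (x + t • e) q - (x + t • e) p) 0 ≠ 0 := by simpa using n1
  have n2' : (fun t : ℝ => (x + t • e) r - (x + t • e) p) 0 ≠ 0 := by simpa using n2
  have n3' : (fun t : ℝ => (x + t • e) r - (x + t • e) q) 0 ≠ 0 := by simpa using n3
  have l1 := hasDerivAt_log_norm f1 n1'
  have l2 := hasDerivAt_log_norm f2 n2'
  have l3 := hasDerivAt_log_norm f3 n3'
  have c1 := hasDerivAt_conj_div (unitCoord v q - unitCoord v p) f1 n1'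
  have c2 := hasDerivAt_conj_div (unitCoord v r - unitCoord v p) f2 n2'
  have c3 := hasDerivAt_conj_div (unitCoord v r - unitCoord v q) f3 n3'
  have key := (((c2.fun_mul (l1.fun_sub l3).ofReal_comp).fun_add
    (c1.fun_mul (l3.fun_sub l2).ofReal_comp)).fun_add
      (c3.fun_mul (l2.fun_sub l1).ofReal_comp)).const_mul (Complex.I / 2)
  simp only [zero_smul, add_zero] at key
  exact key

/-- The recursion for divided differences; it turns the edge quotients from differentiating the
volume into one face quantity. -/
theorem div_sub_div_eq_mul_divDiff {a b c : ℂ} (hab : a ≠ b) (hbc : b ≠ c) (hca : c ≠ a)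
    (x y w : ℂ) :
    (w - x) / (c - a) - (y - x) / (b - a) = (c - b) * divDiff a b c x y w ∧
      (w - y) / (c - b) - (y - x) / (b - a) = (c - a) * divDiff a b c x y w := by
  have h1 : b - a ≠ 0 := sub_ne_zero.mpr hab.symm
  have h2 : c - a ≠ 0 := sub_ne_zero.mpr hca
  have h3 : c - b ≠ 0 := sub_ne_zero.mpr hbc.symm
  have h : divDiff a b c x y w = x / ((b - a) * (c - a)) - y / ((b - a) * (c - b)) +
      w / ((c - a) * (c - b)) := by
    unfold divDiff
    rw [← neg_sub b a, ← neg_sub c a, ← neg_sub c b, neg_mul_neg, mul_neg, div_neg]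
    ring
  rw [h]
  constructor <;> field_simp <;> ring

theorem two_I_mul_orient (a b c : ℂ) :
    2 * Complex.I * (orient a b c : ℂ) =
      (c - b) * conj (c - a) - (c - a) * conj (c - b) := by
  apply Complex.ext <;> simp [orient] <;> ring

/-- The second Wirtinger derivatives of the volume over a face form a matrix of rank one. -/
theorem wirtinger_volumeWirtingerBar (u v : ι) {p q r : ι} {x : ι → ℂ}
    (h : 0 < orient (x p) (x q) (x r)) :
    wirtinger u (volumeWirtingerBar v p q r) x = -((orient (x p) (x q) (x r) / 2 : ℝ) *
      divDiff (x p) (x q) (x r) (unitCoord u p) (unitCoord u q) (unitCoord u r) *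
      conj (divDiff (x p) (x q) (x r) (unitCoord v p) (unitCoord v q) (unitCoord v r))) := by
  obtain ⟨hpq, hqr, hrp⟩ := ne_of_orient_ne_zero h.ne'
  have n1 : x q - x p ≠ 0 := sub_ne_zero.mpr hpq.symm
  have n2 : x r - x p ≠ 0 := sub_ne_zero.mpr hrp
  have n3 : x r - x q ≠ 0 := sub_ne_zero.mpr hqr.symm
  -- The conjugated quotients are antiholomorphic, so `∂/∂z_u` annihilates them and acts only on the
  -- logarithms.
  have hconj : ∀ s d : ℂ, conj (-s * (Complex.I * d)) = -Complex.I * conj (-s * d) := by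
    intro s d
    simp only [map_mul, map_neg, Complex.conj_I]
    ring
  have a1 := div_sub_div_eq_mul_divDiff hpq hqr hrp (unitCoord u p) (unitCoord u q) (unitCoord u r)
  have a2 := div_sub_div_eq_mul_divDiff hpq hqr hrp (unitCoord v p) (unitCoord v q) (unitCoord v r)
  unfold wirtinger
  rw [(hasLineDerivAt_volumeWirtingerBar v h _).lineDeriv,
    (hasLineDerivAt_volumeWirtingerBar v h _).lineDeriv]
  simp only [single_one_apply, single_I_apply, ← mul_sub, hconj, mul_div_assoc,
    Complex.ofReal_sub]
  have r1 := re_sub_I_mul_re_I_mul ((unitCoord u q - unitCoord u p) / (x q - x p))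
  have r2 := re_sub_I_mul_re_I_mul ((unitCoord u r - unitCoord u p) / (x r - x p))
  have r3 := re_sub_I_mul_re_I_mul ((unitCoord u r - unitCoord u q) / (x r - x q))
  have o := two_I_mul_orient (x p) (x q) (x r)
  obtain ⟨a2, a3⟩ := a2
  obtain ⟨a1, a4⟩ := a1
  replace a2 := congrArg conj a2
  replace a3 := congrArg conj a3
  simp only [map_sub, map_mul] at a2 a3
  generalize divDiff (x p) (x q) (x r) (unitCoord u p) (unitCoord u q) (unitCoord u r) = A at *
  generalize divDiff (x p) (x q) (x r) (unitCoord v p) (unitCoord v q) (unitCoord v r) = B at *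
  generalize (unitCoord u q - unitCoord u p) / (x q - x p) = ζ₁ at *
  generalize (unitCoord u r - unitCoord u p) / (x r - x p) = ζ₂ at *
  generalize (unitCoord u r - unitCoord u q) / (x r - x q) = ζ₃ at *
  generalize (unitCoord v q - unitCoord v p) / (x q - x p) = η₁ at *
  generalize (unitCoord v r - unitCoord v p) / (x r - x p) = η₂ at *
  generalize (unitCoord v r - unitCoord v q) / (x r - x q) = η₃ at *
  generalize conj (-((unitCoord v r - unitCoord v p) / (x r - x p) ^ 2) *
    (unitCoord u r - unitCoord u p)) = K₂
  generalize conj (-((unitCoord v q - unitCoord v p) / (x q - x p) ^ 2) *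
    (unitCoord u q - unitCoord u p)) = K₁
  generalize conj (-((unitCoord v r - unitCoord v q) / (x r - x q) ^ 2) *
    (unitCoord u r - unitCoord u q)) = K₃
  generalize (Real.log ‖x q - x p‖ : ℂ) = L₁
  generalize (Real.log ‖x r - x p‖ : ℂ) = L₂
  generalize (Real.log ‖x r - x q‖ : ℂ) = L₃
  simp only [map_sub] at o
  push_cast
  linear_combination (Complex.I / 4) * (conj η₂ * (r1 - r3) + conj η₁ * (r3 - r2) +
      conj η₃ * (r2 - r1)) +
    (Complex.I / 4) * (K₂ * (L₁ - L₃) + K₁ * (L₃ - L₂) + K₃ * (L₂ - L₁)) * Complex.I_sq +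
    (Complex.I / 4) * (-(conj η₂ - conj η₁) * a4 - (x r - x p) * A * a2 +
      (conj η₃ - conj η₁) * a1 + (x r - x q) * A * a3 - A * conj B * o) +
    (orient (x p) (x q) (x r) / 2 * A * conj B : ℂ) * Complex.I_sq

theorem wirtingerBar_idealVolume (v : ι) {p q r : ι} {x : ι → ℂ}
    (h : 0 < orient (x p) (x q) (x r)) :
    wirtingerBar v (fun x : ι → ℂ => (idealVolume {x p, x q, x r} : ℂ)) x =
      volumeWirtingerBar v p q r x := by
  unfold wirtingerBar volumeWirtingerBar
  rw [(hasLineDerivAt_idealVolume h _).lineDeriv, (hasLineDerivAt_idealVolume h _).lineDeriv]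
  simp only [single_one_apply, single_I_apply, ← mul_sub, mul_div_assoc, Complex.ofReal_sub,
    Complex.ofReal_add, Complex.ofReal_mul]
  linear_combination
    (Real.log ‖x q - x p‖ - Real.log ‖x r - x q‖ : ℂ) *
      half_mul_im_add_I_mul ((unitCoord v r - unitCoord v p) / (x r - x p)) +
    (Real.log ‖x r - x q‖ - Real.log ‖x r - x p‖ : ℂ) *
      half_mul_im_add_I_mul ((unitCoord v q - unitCoord v p) / (x q - x p)) +
    (Real.log ‖x r - x p‖ - Real.log ‖x q - x p‖ : ℂ) *
      half_mul_im_add_I_mul ((unitCoord v r - unitCoord v q) / (x r - x q))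

/-- A Wirtinger derivative of a negated finite sum. -/
theorem wirtinger_neg_sum {κ : Type*} (u : ι) (s : Finset κ) {g : κ → (ι → ℂ) → ℂ} {x : ι → ℂ}
    (h : ∀ f ∈ s, ∀ e, LineDifferentiableAt ℝ (g f) x e) :
    wirtinger u (fun y => -∑ f ∈ s, g f y) x = -∑ f ∈ s, wirtinger u (g f) x := by
  have key : ∀ e, lineDeriv ℝ (fun y => -∑ f ∈ s, g f y) x e =
      -∑ f ∈ s, lineDeriv ℝ (g f) x e := fun e =>
    (HasDerivAt.fun_neg (HasDerivAt.fun_sum fun f hf => (h f hf e).hasLineDerivAt)).deriv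
  simp only [wirtinger, key, ← Finset.mul_sum, Finset.sum_sub_distrib]
  ring

theorem wirtingerBar_neg_sum {κ : Type*} (u : ι) (s : Finset κ) {g : κ → (ι → ℂ) → ℂ}
    {x : ι → ℂ} (h : ∀ f ∈ s, ∀ e, LineDifferentiableAt ℝ (g f) x e) :
    wirtingerBar u (fun y => -∑ f ∈ s, g f y) x = -∑ f ∈ s, wirtingerBar u (g f) x := by
  have key : ∀ e, lineDeriv ℝ (fun y => -∑ f ∈ s, g f y) x e =
      -∑ f ∈ s, lineDeriv ℝ (g f) x e := fun e =>
    (HasDerivAt.fun_neg (HasDerivAt.fun_sum fun f hf => (h f hf e).hasLineDerivAt)).deriv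
  simp only [wirtingerBar, key, ← Finset.mul_sum, Finset.sum_add_distrib]
  ring

end Wirtinger

/-! ### The Kähler matrix -/

namespace PointTriangulation

open scoped ComplexConjugate

variable {ι : Type*} [DecidableEq ι] {z : ι → ℂ}

theorem exists_positive_vertices [Nonempty ι] (T : PointTriangulation z) : ∃ p q r : Finset ι → ι,
    ∀ f ∈ T.faces, f = {p f, q f, r f} ∧ 0 < orient (z (p f)) (z (q f)) (z (r f)) := by
  choose! p q r h using fun f (hf : f ∈ T.faces) => T.exists_orient_pos hf
  exact ⟨p, q, r, h⟩

variable [Fintype ι]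

/-- The faces stay positively oriented near `z`, so the formula for the first derivative holds on a
neighbourhood and may be differentiated again. -/
theorem kahlerMatrix_apply (T : PointTriangulation z) {p q r : Finset ι → ι}
    (h : ∀ f ∈ T.faces, f = {p f, q f, r f} ∧ 0 < orient (z (p f)) (z (q f)) (z (r f)))
    (u v : ι) :
    kahlerMatrix T u v = ∑ f ∈ T.faces, ((orient (z (p f)) (z (q f)) (z (r f)) / 2 : ℝ) : ℂ) *
      divDiff (z (p f)) (z (q f)) (z (r f)) (unitCoord u (p f)) (unitCoord u (q f))
        (unitCoord u (r f)) *
      conj (divDiff (z (p f)) (z (q f)) (z (r f)) (unitCoord v (p f)) (unitCoord v (q f))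
        (unitCoord v (r f))) := by
  have hpre : ∀ x : ι → ℂ, (prepotential T.faces x : ℂ) =
      -∑ f ∈ T.faces, (idealVolume {x (p f), x (q f), x (r f)} : ℂ) := by
    intro x
    unfold prepotential
    push_cast
    congr 1
    refine Finset.sum_congr rfl fun f hf => ?_
    have : (f : Set ι) = {p f, q f, r f} := by
      conv_lhs => rw [(h f hf).1]
      simp
    rw [this, Set.image_insert_eq, Set.image_pair]
  have hev : ∀ᶠ x : ι → ℂ in nhds z,
      ∀ f ∈ T.faces, 0 < orient (x (p f)) (x (q f)) (x (r f)) := by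
    rw [Filter.eventually_all_finset]
    intro f hf
    have hc : Continuous fun x : ι → ℂ => orient (x (p f)) (x (q f)) (x (r f)) :=
      continuous_orient.comp (by fun_prop :
        Continuous fun x : ι → ℂ => (x (p f), x (q f), x (r f)))
    exact hc.continuousAt.eventually (lt_mem_nhds (h f hf).2)
  have hbar : wirtingerBar v (fun x => (prepotential T.faces x : ℂ)) =ᶠ[nhds z]
      fun x => -∑ f ∈ T.faces, volumeWirtingerBar v (p f) (q f) (r f) x := by
    filter_upwards [hev] with x hx
    simp only [hpre]
    rw [wirtingerBar_neg_sum v T.faces fun f hf e =>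
      (hasLineDerivAt_idealVolume (hx f hf) e).lineDifferentiableAt]
    congr 1
    exact Finset.sum_congr rfl fun f hf => wirtingerBar_idealVolume v (hx f hf)
  have hw : kahlerMatrix T u v =
      wirtinger u (fun x => -∑ f ∈ T.faces, volumeWirtingerBar v (p f) (q f) (r f) x) z := by
    simp only [kahlerMatrix, Matrix.of_apply, wirtinger, hbar.lineDeriv_eq]
  rw [hw, wirtinger_neg_sum u T.faces fun f hf e =>
    (hasLineDerivAt_volumeWirtingerBar v (h f hf).2 e).lineDifferentiableAt,
    ← Finset.sum_neg_distrib]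
  refine Finset.sum_congr rfl fun f hf => ?_
  rw [wirtinger_volumeWirtingerBar u v (h f hf).2, neg_neg]

theorem sum_mul_divDiff_unitCoord (φ : ι → ℂ) (a b c : ℂ) (p q r : ι) :
    ∑ u, φ u * divDiff a b c (unitCoord u p) (unitCoord u q) (unitCoord u r) =
      divDiff a b c (φ p) (φ q) (φ r) := by
  simp [divDiff, unitCoord, mul_add, Finset.sum_add_distrib, div_eq_mul_inv]

theorem isHermitian_kahlerMatrix [Nonempty ι] (T : PointTriangulation z) :
    (kahlerMatrix T).IsHermitian := by
  obtain ⟨p, q, r, h⟩ := T.exists_positive_vertices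
  ext u v
  rw [Matrix.conjTranspose_apply, T.kahlerMatrix_apply h, T.kahlerMatrix_apply h, star_sum]
  refine Finset.sum_congr rfl fun f _ => ?_
  simp only [star_mul', RCLike.star_def, Complex.conj_conj, Complex.conj_ofReal]
  ring

/-- The Hermitian form of the Kähler matrix. -/
theorem star_dotProduct_kahlerMatrix_mulVec [Nonempty ι] (T : PointTriangulation z) (x : ι → ℂ) :
    ((∑ a, ∑ b, ∑ c, (T.faceChain a b c : ℝ) * faceForm z (star x) a b c : ℝ) : ℂ) =
      3 * (star x ⬝ᵥ (kahlerMatrix T).mulVec x) := by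
  obtain ⟨p, q, r, h⟩ := T.exists_positive_vertices
  have hrot : ∀ f ∈ T.faces, ∀ a b c, f = {a, b, c} → 0 < orient (z a) (z b) (z c) →
      faceForm z (star x) (p f) (q f) (r f) = faceForm z (star x) a b c := by
    intro f hf a b c hfe ho
    obtain ⟨hpqr, hpos⟩ := h f hf
    have hset : ({p f, q f, r f} : Finset ι) = {a, b, c} := hpqr.symm.trans hfe
    have hp : p f ∈ ({a, b, c} : Finset ι) := hset ▸ by simp
    have hq : q f ∈ ({a, b, c} : Finset ι) := hset ▸ by simp
    have hr : r f ∈ ({a, b, c} : Finset ι) := hset ▸ by simp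
    simp only [Finset.mem_insert, Finset.mem_singleton] at hp hq hr
    rcases hp with e1 | e1 | e1 <;> rcases hq with e2 | e2 | e2 <;>
      rcases hr with e3 | e3 | e3 <;> rw [e1, e2, e3] at hpos ⊢ <;>
      first
      | rfl
      | exact faceForm_rotate ..
      | exact (faceForm_rotate ..).symm
      | simp at hpos
      | (simp only [orient] at hpos ho; linarith)
  -- The factor 3 arises because the chain sees each face in three rotations.
  rw [T.sum_faceChain_mul (F := fun f => faceForm z (star x) (p f) (q f) (r f))
    (fun a b c => faceForm_rotate (star x) a b c)
    (fun a b c hf ho => hrot _ hf a b c rfl ho)]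
  push_cast
  congr 1
  simp only [dotProduct, Matrix.mulVec, T.kahlerMatrix_apply h, Finset.mul_sum, Finset.sum_mul]
  have hsw : ∀ G : ι → ι → Finset ι → ℂ,
      ∑ u, ∑ v, ∑ f ∈ T.faces, G u v f = ∑ f ∈ T.faces, ∑ u, ∑ v, G u v f := by
    intro G
    rw [Finset.sum_comm]
    simp_rw [Finset.sum_comm (s := Finset.univ) (t := T.faces)]
    refine Finset.sum_congr rfl fun f _ => Finset.sum_comm
  rw [hsw]
  refine Finset.sum_congr rfl fun f _ => ?_
  have hd := sum_mul_divDiff_unitCoord (star x) (z (p f)) (z (q f)) (z (r f)) (p f) (q f) (r f)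
  have hd' := congrArg conj hd
  rw [map_sum] at hd'
  rw [faceForm, Complex.ofReal_mul, Complex.normSq_eq_conj_mul_self, ← hd', ← hd,
    Finset.sum_mul_sum, Finset.mul_sum, Finset.sum_comm]
  refine Finset.sum_congr rfl fun u _ => ?_
  rw [Finset.mul_sum]
  refine Finset.sum_congr rfl fun v _ => ?_
  simp only [Pi.star_apply, RCLike.star_def, map_mul, Complex.conj_conj]
  ring

theorem posSemidef_kahlerMatrix [Nonempty ι] (T : PointTriangulation z) :
    (kahlerMatrix T).PosSemidef := by
  refine .of_dotProduct_mulVec_nonneg T.isHermitian_kahlerMatrix fun x => ?_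
  have h := T.star_dotProduct_kahlerMatrix_mulVec x
  have hpos : 0 ≤ ∑ a, ∑ b, ∑ c, (T.faceChain a b c : ℝ) * faceForm z (star x) a b c := by
    refine Finset.sum_nonneg fun a _ => Finset.sum_nonneg fun b _ => Finset.sum_nonneg fun c _ => ?_
    by_cases h0 : T.faceChain a b c = 0
    · simp [h0]
    · refine mul_nonneg (by exact_mod_cast (T.isFilling_faceChain T).nonneg a b c) ?_
      exact mul_nonneg (half_pos (faceChain_ne_zero.mp h0).2).le (Complex.normSq_nonneg _)
  have h' : star x ⬝ᵥ (kahlerMatrix T).mulVec x =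
      ((1 / 3 * ∑ a, ∑ b, ∑ c, (T.faceChain a b c : ℝ) * faceForm z (star x) a b c : ℝ) : ℂ) := by
    rw [Complex.ofReal_mul, h]
    push_cast
    ring
  rw [h', Complex.zero_le_real]
  positivity

/-- The extremal property of Delaunay fillings holds for each `φ = star x`, hence in the Loewner
order. -/
theorem IsDelaunay.posSemidef_kahlerMatrix_sub [Nonempty ι] (hz : Function.Injective z)
    {TD : PointTriangulation z} (hTD : TD.IsDelaunay) (T : PointTriangulation z) :
    (kahlerMatrix TD - kahlerMatrix T).PosSemidef := by
  refine .of_dotProduct_mulVec_nonneg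
    (TD.isHermitian_kahlerMatrix.sub T.isHermitian_kahlerMatrix) fun x => ?_
  have h1 := T.star_dotProduct_kahlerMatrix_mulVec x
  have h2 := TD.star_dotProduct_kahlerMatrix_mulVec x
  have hle := IsFilling.sum_faceForm_le_of_delaunay (star x) hz
    (fun a b h => TD.left_of_boundary_pos h) (T.isFilling_faceChain TD) (TD.isFilling_faceChain TD)
    (fun a b c h => hTD.circumpower_nonneg h)
  rw [Matrix.sub_mulVec, dotProduct_sub]
  have h' : star x ⬝ᵥ (kahlerMatrix TD).mulVec x - star x ⬝ᵥ (kahlerMatrix T).mulVec x =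
      ((1 / 3 * (∑ a, ∑ b, ∑ c, (TD.faceChain a b c : ℝ) * faceForm z (star x) a b c -
        ∑ a, ∑ b, ∑ c, (T.faceChain a b c : ℝ) * faceForm z (star x) a b c) : ℝ) : ℂ) := by
    rw [Complex.ofReal_mul, Complex.ofReal_sub, h1, h2]
    push_cast
    ring
  rw [h', Complex.zero_le_real]
  linarith

end PointTriangulation

/-- Among all triangulations of the configuration, a Delaunay triangulation maximises every minor
`d_{(ijk)}`. -/
theorem mainTheorem2 (N : ℕ) (z : Fin (N + 3) → ℂ) (hz : Function.Injective z)
    (i j k : Fin (N + 3)) (hij : i ≠ j) (hik : i ≠ k) (hjk : j ≠ k)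
    (TD : PointTriangulation z) (hTD : TD.IsDelaunay) :
    IsGreatest (Set.range fun T : PointTriangulation z => kahlerMinor i j k T)
      (kahlerMinor i j k TD) := by
  refine ⟨⟨TD, rfl⟩, ?_⟩
  rintro _ ⟨T, rfl⟩
  -- Deleting the same rows and columns preserves positive semidefiniteness of both `kahlerMatrix T`
  -- and the difference.
  exact (T.posSemidef_kahlerMatrix.submatrix _).det_le_det
    ((hTD.posSemidef_kahlerMatrix_sub hz T).submatrix _)
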